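/- Let $n\ge 2$, $0<M\le\infty$, and let $\omega$ be a $C^2$ solution on $[0,M)$ (derivatives at $0$ being one-sided) of $$4s^{2}\omega(s)\omega''(s)=2(n-2)\omega(s)(\omega(s)-1)+s\,\omega'(s)\bigl(2s\,\omega'(s)-s-2(n-2)\bigr),\qquad \omega(0)=1,\quad \omega'(0)<0 .$$ Then $\omega$ extends to a positive $C^2$ solution on $[0,\infty)$, again denoted $\omega$. The metric $$g=\frac{da^{2}}{\omega(a^{2})}+a^{2}g_{S^{n-1}},\qquad a=|x|,$$ extends to a smooth Riemannian metric on $\mathbb R^n$ with positive sectional curvature. There is a smooth function $f$ on $\mathbb R^n$ such that $g$ and $f$ are $O(n)$-invariant and $(\mathbb R^n,g,f)$ is an expanding gradient soliton, that is, $2\operatorname{Ric}_g+g=\mathscr L_{\nabla f}g$, normalized by $|\nabla f|^2+R=f$. Moreover $(\mathbb R^n,g,f)$ is asymptotically conical as a soliton: there are $r_0>0$ and a map $F:(r_0,\infty)\times S^{n-1}\to\mathbb R^n$ such that 1. $F$ is a diffeomorphism onto its (open) image, and the complement of the image is compact; 2. $f(F(r,\theta))=r^2/4$ and $\dfrac{\partial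 F}{\partial r}=\sqrt f\,\dfrac{\nabla f}{|\nabla f|^2}$; 3. there are $\alpha\in[0,1)$ and $\epsilon>0$ such that, with $g_\alpha=dr^2+(1-\alpha)r^2g_{S^{n-1}}$ and $k=F^*g-g_\alpha$, one has $|\nabla^jk|=O(r^{-3\epsilon-j})$ as $r\to\infty$, uniformly over $S^{n-1}$, for $j=0,1,2$. Here norms and covariant derivatives are those of $g_\alpha$. -/

import Mathlib

open scoped ContDiff

noncomputable section

namespace ExpandingSoliton

/-- Euclidean space `ℝⁿ` with its standard coordinates. -/
abbrev E (n : ℕ) := EuclideanSpace ℝ (Fin n)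

variable {n : ℕ}

/-! ### Riemannian geometry on (open subsets of) `ℝⁿ`, in the standard coordinates

A metric, or any other `(0,2)`-tensor field, is given by its matrix of components `g x i j`.
All definitions below are local in `x`. -/

/-- The `i`-th partial derivative of a real function. -/
def pderiv (i : Fin n) (φ : E n → ℝ) (x : E n) : ℝ :=
  fderiv ℝ φ x (EuclideanSpace.single i 1)

/-- The inner product `g_x(u, v)`. -/
def metricInner (g : E n → Matrix (Fin n) (Fin n) ℝ) (x u v : E n) : ℝ :=
  ∑ i, ∑ j, g x i j * u i * v j

/-- The Christoffel symbol `Γ^k_{ij}` of `g` at `x`. -/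
def christoffel (g : E n → Matrix (Fin n) (Fin n) ℝ) (x : E n) (k i j : Fin n) : ℝ :=
  (1 / 2) * ∑ l, (g x)⁻¹ k l *
    (pderiv i (fun y => g y j l) x + pderiv j (fun y => g y i l) x
      - pderiv l (fun y => g y i j) x)

/-- The curvature component `R^l_{ijk}`, with `R(∂_i, ∂_j) ∂_k = ∑ l, R^l_{ijk} ∂_l` and
`R(X, Y) Z = ∇_X ∇_Y Z - ∇_Y ∇_X Z - ∇_{[X, Y]} Z`. -/
def riemann (g : E n → Matrix (Fin n) (Fin n) ℝ) (x : E n) (l i j k : Fin n) : ℝ :=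
  pderiv i (fun y => christoffel g y l j k) x - pderiv j (fun y => christoffel g y l i k) x
    + ∑ m, (christoffel g x l i m * christoffel g x m j k
      - christoffel g x l j m * christoffel g x m i k)

/-- The Ricci tensor, `Ric(Y, Z) = tr (X ↦ R(X, Y) Z)`. -/
def ricci (g : E n → Matrix (Fin n) (Fin n) ℝ) (x : E n) (j k : Fin n) : ℝ :=
  ∑ i, riemann g x i i j k

/-- The scalar curvature. -/
def scalarCurvature (g : E n → Matrix (Fin n) (Fin n) ℝ) (x : E n) : ℝ :=
  ∑ j, ∑ k, (g x)⁻¹ j k * ricci g x j k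

/-- The sectional curvature `g(R(u, v) v, u) / (|u|² |v|² - g(u, v)²)` of the plane spanned by
two linearly independent tangent vectors `u`, `v` at `x`. -/
def sectionalCurvature (g : E n → Matrix (Fin n) (Fin n) ℝ) (x u v : E n) : ℝ :=
  (∑ i, ∑ j, ∑ k, ∑ l, ∑ m, riemann g x l i j k * g x l m * u i * v j * v k * u m) /
    (metricInner g x u u * metricInner g x v v - metricInner g x u v ^ 2)

/-- All sectional curvatures of `g` are positive. -/
def HasPositiveSectionalCurvature (g : E n → Matrix (Fin n) (Fin n) ℝ) : Prop :=
  ∀ x u v : E n, LinearIndependent ℝ ![u, v] → 0 < sectionalCurvature g x u v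

/-- The gradient vector field of `f` with respect to `g`. -/
def grad (g : E n → Matrix (Fin n) (Fin n) ℝ) (f : E n → ℝ) (x : E n) : E n :=
  WithLp.toLp 2 fun k => ∑ j, (g x)⁻¹ k j * pderiv j f x

/-- The components of the Lie derivative `ℒ_X g` of a `(0,2)`-tensor field. -/
def lieDerivative (X : E n → E n) (g : E n → Matrix (Fin n) (Fin n) ℝ) (x : E n)
    (i j : Fin n) : ℝ :=
  ∑ k, (X x k * pderiv k (fun y => g y i j) x + g x k j * pderiv i (fun y => X y k) x
    + g x i k * pderiv j (fun y => X y k) x)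

/-- The covariant derivative `∇T` of a `(0,m)`-tensor field `T` with respect to the Levi-Civita
connection of `g`; the first index of `∇T` is the direction of differentiation. -/
def covDeriv (g : E n → Matrix (Fin n) (Fin n) ℝ) {m : ℕ} (T : E n → (Fin m → Fin n) → ℝ) :
    E n → (Fin (m + 1) → Fin n) → ℝ :=
  fun x I => pderiv (I 0) (fun y => T y (Fin.tail I)) x
    - ∑ p : Fin m, ∑ l : Fin n,
        christoffel g x l (I 0) (I p.succ) * T x (Function.update (Fin.tail I) p l)

/-- The iterated covariant derivative `∇ʲT`. -/
def iterCovDeriv (g : E n → Matrix (Fin n) (Fin n) ℝ) {m : ℕ}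
    (T : E n → (Fin m → Fin n) → ℝ) : (j : ℕ) → E n → (Fin (m + j) → Fin n) → ℝ
  | 0 => T
  | j + 1 => covDeriv g (iterCovDeriv g T j)

/-- The pointwise norm `|T|_g` of a `(0,m)`-tensor field. -/
def tensorNorm (g : E n → Matrix (Fin n) (Fin n) ℝ) {m : ℕ}
    (T : E n → (Fin m → Fin n) → ℝ) (x : E n) : ℝ :=
  Real.sqrt (∑ I : Fin m → Fin n, ∑ J : Fin m → Fin n,
    (∏ p, (g x)⁻¹ (I p) (J p)) * T x I * T x J)

/-- The pull-back `F^* g` of a `(0,2)`-tensor field. -/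
def pullback (F : E n → E n) (g : E n → Matrix (Fin n) (Fin n) ℝ) :
    E n → Matrix (Fin n) (Fin n) ℝ :=
  fun x => Matrix.of fun i j =>
    ∑ a, ∑ b, g (F x) a b * pderiv i (fun y => F y a) x * pderiv j (fun y => F y b) x

/-! ### Polar coordinates -/

/-- The tensor `dr ⊗ dr`, `r = |x|`, on `ℝⁿ ∖ {0}` (with value `0` at the origin). -/
def radialForm (x : E n) : Matrix (Fin n) (Fin n) ℝ :=
  Matrix.of fun i j => x i * x j / ‖x‖ ^ 2

/-- The tensor `r² g_{S^{n-1}} = |dx|² - dr ⊗ dr` on `ℝⁿ ∖ {0}` (with value `|dx|²` at the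
origin). -/
def sphereForm (x : E n) : Matrix (Fin n) (Fin n) ℝ :=
  1 - radialForm x

/-- The conical metric `g_α = dr² + (1 - α) r² g_{S^{n-1}}` on `ℝⁿ ∖ {0}`. -/
def coneMetric (α : ℝ) (x : E n) : Matrix (Fin n) (Fin n) ℝ :=
  radialForm x + (1 - α) • sphereForm x

/-- The rotationally symmetric metric `da² / w(a²) + a² g_{S^{n-1}}`, `a = |x|`, on `ℝⁿ`.
At the origin its value is `|dx|²`, the continuous extension when `w` is continuous with
`w 0 = 1`. -/
def warpedMetric (w : ℝ → ℝ) (x : E n) : Matrix (Fin n) (Fin n) ℝ :=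
  (1 / w (‖x‖ ^ 2)) • radialForm x + sphereForm x

/-! ### Expanding solitons -/

/-- `(ℝⁿ, g, f)` is an expanding gradient soliton: `g` is a smooth Riemannian metric and `f` a
smooth function with `2 Ric + g = ℒ_{∇f} g`. The constant `|∇f|² + R - f` is normalized to be
zero. -/
structure IsExpandingGradientSoliton (g : E n → Matrix (Fin n) (Fin n) ℝ) (f : E n → ℝ) :
    Prop where
  smooth_metric : ∀ i j, ContDiff ℝ ∞ fun x => g x i j
  posDef : ∀ x, (g x).PosDef
  smooth_potential : ContDiff ℝ ∞ f
  soliton : ∀ x i j, 2 * ricci g x i j + g x i j = lieDerivative (grad g f) g x i j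
  normalized : ∀ x, metricInner g x (grad g f x) (grad g f x) + scalarCurvature g x = f x

/-- `(ℝⁿ, g, f)` is invariant under all rotations and reflections fixing the origin. -/
def IsRotationallySymmetric (g : E n → Matrix (Fin n) (Fin n) ℝ) (f : E n → ℝ) : Prop :=
  ∀ A : E n ≃ₗᵢ[ℝ] E n,
    (∀ x u v, metricInner g (A x) (A u) (A v) = metricInner g x u v) ∧ ∀ x, f (A x) = f x

/-- The expanding gradient soliton `(ℝⁿ, g, f)` is asymptotically conical as a soliton.
Through polar coordinates, `(r₀, ∞) × S^{n-1}` is the exterior domain `{x | r₀ < ‖x‖}` with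
`r = ‖x‖`; the radial derivative `∂F/∂r` is the derivative of `F` in the direction `x / ‖x‖`.
Norms and covariant derivatives of the error term `k = F^* g - g_α` are those of `g_α`, and the
bounds hold as `r → ∞`, uniformly over the sphere. -/
structure IsAsymptoticallyConicalAsSoliton (g : E n → Matrix (Fin n) (Fin n) ℝ) (f : E n → ℝ) :
    Prop where
  isSoliton : IsExpandingGradientSoliton g f
  exists_end : ∃ (r₀ : ℝ) (F : E n → E n), 0 < r₀ ∧
    -- `F` is a diffeomorphism onto its image, whose complement is compact
    ContDiffOn ℝ ∞ F {x | r₀ < ‖x‖} ∧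
    IsOpen (F '' {x | r₀ < ‖x‖}) ∧
    (∃ G : E n → E n, ContDiffOn ℝ ∞ G (F '' {x | r₀ < ‖x‖}) ∧
      Set.LeftInvOn G F {x | r₀ < ‖x‖}) ∧
    IsCompact (F '' {x | r₀ < ‖x‖})ᶜ ∧
    -- `F` parametrizes the level sets of `f`
    (∀ x, r₀ < ‖x‖ → f (F x) = ‖x‖ ^ 2 / 4) ∧
    (∀ x, r₀ < ‖x‖ → fderiv ℝ F x (‖x‖⁻¹ • x) =
      (Real.sqrt (f (F x)) / metricInner g (F x) (grad g f (F x)) (grad g f (F x))) •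
        grad g f (F x)) ∧
    -- `F^* g` is `C²`-asymptotic to a conical metric
    ∃ α ε : ℝ, 0 ≤ α ∧ α < 1 ∧ 0 < ε ∧ ∀ j : ℕ, j ≤ 2 →
      (fun x : E n => tensorNorm (coneMetric α)
        (iterCovDeriv (coneMetric α)
          (fun y (I : Fin 2 → Fin n) => pullback F g y (I 0) (I 1) - coneMetric α y (I 0) (I 1))
          j) x)
        =O[Bornology.cobounded (E n)] fun x => ‖x‖ ^ (-3 * ε - (j : ℝ))

/-! ### The ordinary differential equation -/

/-- The interval `[0, M)`, where `M` may be `+∞`. -/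
def solDomain (M : EReal) : Set ℝ := {s | 0 ≤ s ∧ (s : EReal) < M}

/-- `w` is a `C²` solution on `[0, M)` of
`4 s² w w'' = 2 (n - 2) w (w - 1) + s w' (2 s w' - s - 2 (n - 2))` with `w(0) = 1` and
`w'(0) < 0`; derivatives at `0` are one-sided. -/
structure IsBryantSolution (n : ℕ) (M : EReal) (w : ℝ → ℝ) : Prop where
  contDiffOn : ContDiffOn ℝ 2 w (solDomain M)
  ode : ∀ s ∈ solDomain M,
    4 * s ^ 2 * w s * iteratedDerivWithin 2 w (solDomain M) s =
      2 * ((n : ℝ) - 2) * w s * (w s - 1)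
        + s * derivWithin w (solDomain M) s *
          (2 * s * derivWithin w (solDomain M) s - s - 2 * ((n : ℝ) - 2))
  init : w 0 = 1
  init_deriv : derivWithin w (solDomain M) 0 < 0

end ExpandingSoliton

end

noncomputable section

namespace ExpandingSoliton

open Set Filter Topology Asymptotics
open scoped NNReal

/-! ### The ordinary differential equation: a priori estimates -/

/-! Put `m = n - 2`, `p = -ω'` and `κ = (1 - ω) / s`. At `s = |x|²` these are the radial and the
tangential sectional curvature of the metric, so the theorem comes down to signs and decay of two
functions of `s`.

Existence. While `ω > 0` and `ω' < 0`, the equation forces `κ ≥ p`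
(`IsProfile.tangential_ge_radial`). Then `κ` decreases, and so does `Φ² / ω`, where `Φ = 1 + 2 p + 2
m κ ≥ 1`; this bounds `ω` below by a positive constant depending only on `m` and `ω'(0)`
(`IsProfile.lower_bound`). With that bound a linear differential inequality keeps `ω'` from reaching
zero, so both signs persist. The pair `(ω, ω')` stays in a fixed compact box, and the solution is
global (`IsBryantSolution.exists_extension`).

Smoothness at the singular point `s = 0`. Integrating the singular linear part of the equation
writes `ω''` as a smooth expression `H` minus a weighted average of `H` over `[0, s]`. This
right-hand side is as regular as `ω'`, so a bootstrap yields smoothness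
(`IsBryantSolution.exists_isSmoothProfile`).

Geometry. In Cartesian coordinates the metric is `|dx|² + (κ / ω) (x · dx)²`, smooth across the
origin, and all curvatures are explicit. The curvature form on a plane is affine in one parameter,
with end values governed by `κ` and `p`, hence positive. The potential is defined by the
normalization, `f = s Φ² / (4 ω) + R`; the equation gives `∇f = (Φ / 2) x`, and then the soliton
equation.

Asymptotics. The equation for `p` is damped with rate at least `1 / 4`, so barriers give `p =
O(s⁻²)` and `p' = O(s⁻³)` (`IsSmoothProfile.symbol_p`), while `ω` tends to some `W` in `(0, 1]` at
rate `1 / s`. Since `4 f` is strictly increasing in `s`, it has a smooth inverse `σ`, and `F(x) =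
√σ(|x|²) x / |x|` parametrizes the level sets. In this gauge `F^* g - g_α`, with `1 - α = W`, has
one radial and one tangential coefficient, both symbols of order `-2` in `|x|`. Covariant
differentiation for the cone lowers the order by one, and `ε = 2 / 3` works. -/

theorem nonneg_of_hasDerivAt_pos_of_neg {f : ℝ → ℝ} {a b : ℝ}
    (hf : ContinuousOn f (Icc a b)) (ha : 0 ≤ f a)
    (h : ∀ s ∈ Ioc a b, f s < 0 → ∃ f', HasDerivAt f f' s ∧ 0 < f') :
    ∀ s ∈ Icc a b, 0 ≤ f s := by
  intro s hs
  obtain ⟨c, hc, hmin⟩ := isCompact_Icc.exists_isMinOn ⟨s, hs⟩ hf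
  refine le_trans ?_ (hmin hs)
  by_contra! hneg
  have hac : a < c := lt_of_le_of_ne hc.1 (by rintro rfl; linarith)
  obtain ⟨f', hf', hpos⟩ := h c ⟨hac, hc.2⟩ hneg
  -- Slopes from the left at a minimum are nonpositive, against the positive derivative at `c`.
  have h1 : ∀ᶠ x in 𝓝[<] c, 0 < slope f c x :=
    ((hasDerivAt_iff_tendsto_slope.mp hf').mono_left
      (nhdsWithin_mono _ fun x hx => ne_of_lt hx)).eventually (lt_mem_nhds hpos)
  obtain ⟨x, hx1, hx2⟩ := (h1.and (Ioo_mem_nhdsLT hac)).exists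
  have h2 : f c ≤ f x := hmin ⟨hx2.1.le, hx2.2.le.trans hc.2⟩
  rw [slope_def_field] at hx1
  have : (f x - f c) / (x - c) ≤ 0 :=
    div_nonpos_of_nonneg_of_nonpos (by linarith) (by linarith [hx2.2])
  linarith

theorem le_of_tendsto_of_deriv_nonpos {f f' : ℝ → ℝ} {c l : ℝ}
    (hf : ∀ s ∈ Ioo 0 c, HasDerivAt f (f' s) s) (hf' : ∀ s ∈ Ioo 0 c, f' s ≤ 0)
    (hl : Tendsto f (𝓝[>] 0) (𝓝 l)) : ∀ s ∈ Ioo 0 c, f s ≤ l := by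
  intro s hs
  have hanti : AntitoneOn f (Ioo 0 c) := by
    refine antitoneOn_of_deriv_nonpos (convex_Ioo _ _)
      (fun x hx => (hf x hx).continuousAt.continuousWithinAt) ?_ ?_ <;> rw [interior_Ioo]
    · exact fun x hx => (hf x hx).differentiableAt.differentiableWithinAt
    · exact fun x hx => (hf x hx).deriv ▸ hf' x hx
  refine ge_of_tendsto hl ?_
  filter_upwards [Ioo_mem_nhdsGT hs.1] with x hx
  exact hanti ⟨hx.1, hx.2.trans hs.2⟩ hs hx.2.le

/-- A solution of the soliton equation on `[0, b)`, with `v = w'` and `a = w''`. -/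
structure IsProfile (m b : ℝ) (w v a : ℝ → ℝ) : Prop where
  cw : ContinuousOn w (Ico 0 b)
  cv : ContinuousOn v (Ico 0 b)
  dw0 : HasDerivWithinAt w (v 0) (Ici 0) 0
  dw : ∀ s ∈ Ioo 0 b, HasDerivAt w (v s) s
  dv : ∀ s ∈ Ioo 0 b, HasDerivAt v (a s) s
  ode : ∀ s ∈ Ioo 0 b, 4 * s ^ 2 * w s * a s =
    2 * m * w s * (w s - 1) + s * v s * (2 * s * v s - s - 2 * m)
  w0 : w 0 = 1
  v0 : v 0 < 0

/-- The a priori lower bound of a solution with `w'(0) = v₀`. -/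
def profileBound (m v₀ : ℝ) : ℝ := 1 / (1 - 2 * v₀ - 2 * m * v₀) ^ 2

theorem profileBound_pos {m v₀ : ℝ} (hm : 0 ≤ m) (hv : v₀ < 0) : 0 < profileBound m v₀ := by
  have : 0 < 1 - 2 * v₀ - 2 * m * v₀ := by nlinarith
  unfold profileBound
  positivity

namespace IsProfile

variable {m b c : ℝ} {w v a : ℝ → ℝ}

theorem mono (h : IsProfile m b w v a) (hc : c ≤ b) : IsProfile m c w v a where
  cw := h.cw.mono (Ico_subset_Ico_right hc)
  cv := h.cv.mono (Ico_subset_Ico_right hc)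
  dw0 := h.dw0
  dw s hs := h.dw s ⟨hs.1, hs.2.trans_le hc⟩
  dv s hs := h.dv s ⟨hs.1, hs.2.trans_le hc⟩
  ode s hs := h.ode s ⟨hs.1, hs.2.trans_le hc⟩
  w0 := h.w0
  v0 := h.v0

theorem lt_one_of_neg (h : IsProfile m b w v a) (hneg : ∀ s ∈ Ico 0 b, v s < 0) :
    ∀ s ∈ Ioo 0 b, w s < 1 := by
  intro s hs
  rw [← h.w0]
  have : StrictAntiOn w (Ico 0 b) := by
    refine strictAntiOn_of_deriv_neg (convex_Ico _ _) h.cw ?_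
    rw [interior_Ico]
    exact fun x hx => (h.dw x hx).deriv ▸ hneg x ⟨hx.1.le, hx.2⟩
  exact this ⟨le_rfl, hs.1.trans hs.2⟩ ⟨hs.1.le, hs.2⟩ hs.1

/-- The quantity is `s (κ - p)`, with derivative `s w''`. Where it is negative, `-s w' > 1 - w > 0`
makes the right side of the equation positive, so it has no negative minimum. -/
theorem tangential_ge_radial (hm : 0 ≤ m) (h : IsProfile m b w v a)
    (hpos : ∀ s ∈ Ico 0 b, 0 < w s) (hneg : ∀ s ∈ Ico 0 b, v s < 0) :
    ∀ s ∈ Ico 0 b, 0 ≤ 1 - w s + s * v s := by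
  intro s hs
  have hsub : Icc 0 s ⊆ Ico 0 b := Icc_subset_Ico_right hs.2
  refine nonneg_of_hasDerivAt_pos_of_neg (f := fun s => 1 - w s + s * v s) (a := 0) (b := s) ?_ ?_
    ?_ s ⟨hs.1, le_rfl⟩
  · exact (((continuousOn_const.sub h.cw).add (continuousOn_id.mul h.cv))).mono hsub
  · simp [h.w0]
  · intro t ht hlt
    have htb : t ∈ Ioo 0 b := ⟨ht.1, ht.2.trans_lt hs.2⟩
    have hd : HasDerivAt (fun s => 1 - w s + s * v s) (0 - v t + (1 * v t + t * a t)) t :=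
      ((hasDerivAt_const t 1).sub (h.dw t htb)).add ((hasDerivAt_id t).mul (h.dv t htb))
    refine ⟨_, hd, ?_⟩
    have hode := h.ode t htb
    have hw := hpos t ⟨htb.1.le, htb.2⟩
    have hv := hneg t ⟨htb.1.le, htb.2⟩
    have hw1 := h.lt_one_of_neg hneg t htb
    have ht0 := htb.1
    have hq : 0 < -(t * v t) := by nlinarith
    have key : 0 < 4 * t ^ 2 * w t * a t := by
      rw [hode]
      -- Here `-t w' > 1 - w ≥ w (1 - w)`, because `0 < w < 1`.
      have h1 : 0 ≤ 2 * m * ((-(t * v t)) - w t * (1 - w t)) := by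
        apply mul_nonneg (by positivity)
        nlinarith
      nlinarith [mul_pos hq hq, mul_pos hq ht0]
    have ha : 0 < a t := by
      by_contra! hle
      have : 4 * t ^ 2 * w t * a t ≤ 0 := mul_nonpos_of_nonneg_of_nonpos (by positivity) hle
      linarith
    have := mul_pos ht0 ha
    linarith

theorem tendsto_tangential (h : IsProfile m b w v a) :
    Tendsto (fun s => (1 - w s) / s) (𝓝[>] 0) (𝓝 (-v 0)) := by
  have := hasDerivWithinAt_iff_tendsto_slope.mp h.dw0
  have h2 : Tendsto (slope w 0) (𝓝[>] 0) (𝓝 (v 0)) :=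
    this.mono_left (nhdsWithin_mono _ fun x (hx : 0 < x) => ⟨hx.le, ne_of_gt hx⟩)
  refine h2.neg.congr fun s => ?_
  rw [slope_def_field, h.w0, sub_zero, ← neg_div, neg_sub]

theorem hasDerivAt_tangential (h : IsProfile m b w v a) {s : ℝ} (hs : s ∈ Ioo 0 b) :
    HasDerivAt (fun s => (1 - w s) / s) (-(1 - w s + s * v s) / s ^ 2) s := by
  have := ((hasDerivAt_const s (1 : ℝ)).sub (h.dw s hs)).div (hasDerivAt_id s) hs.1.ne'
  refine this.congr_deriv ?_
  simp only [id, Pi.sub_apply]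
  ring

/-- Since `κ' = -(κ - p) / s ≤ 0`, the function `κ` stays below its limit `-w'(0)` at zero. -/
theorem tangential_le (hm : 0 ≤ m) (h : IsProfile m b w v a)
    (hpos : ∀ s ∈ Ico 0 b, 0 < w s) (hneg : ∀ s ∈ Ico 0 b, v s < 0) :
    ∀ s ∈ Ioo 0 b, (1 - w s) / s ≤ -v 0 := by
  refine le_of_tendsto_of_deriv_nonpos (fun s hs => h.hasDerivAt_tangential hs) ?_
    h.tendsto_tangential
  intro s hs
  exact div_nonpos_of_nonpos_of_nonneg
    (neg_nonpos.mpr (h.tangential_ge_radial hm hpos hneg s ⟨hs.1.le, hs.2⟩)) (sq_nonneg s)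

theorem hasDerivAt_phi (h : IsProfile m b w v a) {s : ℝ} (hs : s ∈ Ioo 0 b) :
    HasDerivAt (fun s => 1 - 2 * v s + 2 * m * ((1 - w s) / s))
      (-2 * a s + 2 * m * (-(1 - w s + s * v s) / s ^ 2)) s := by
  have := ((hasDerivAt_const s (1 : ℝ)).sub ((h.dv s hs).const_mul 2)).add
    ((h.hasDerivAt_tangential hs).const_mul (2 * m))
  refine this.congr_deriv ?_
  ring

/-- With `Φ = 1 - 2 w' + 2 m κ`, the equation gives `(Φ² / w)' = -2 m Φ (1 - w + s w') / (s² w) ≤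
0`. Hence `1 / w ≤ Φ² / w` is at most the limit at zero, whose inverse is `profileBound`. -/
theorem lower_bound (hm : 0 ≤ m) (hb : 0 < b) (h : IsProfile m b w v a)
    (hpos : ∀ s ∈ Ico 0 b, 0 < w s) (hneg : ∀ s ∈ Ico 0 b, v s < 0) :
    ∀ s ∈ Ioo 0 b, profileBound m (v 0) ≤ w s := by
  intro s hs
  have hl : Tendsto (fun s => (1 - 2 * v s + 2 * m * ((1 - w s) / s)) ^ 2 / w s) (𝓝[>] 0)
      (𝓝 ((1 - 2 * v 0 + 2 * m * (-v 0)) ^ 2 / 1)) := by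
    have hsub : 𝓝[>] (0 : ℝ) ≤ 𝓝[Ico 0 b] 0 := by
      rw [nhdsWithin_Ico_eq_nhdsGE hb]
      exact nhdsWithin_mono _ fun x (hx : 0 < x) => hx.le
    have hv : Tendsto v (𝓝[>] 0) (𝓝 (v 0)) := (h.cv 0 ⟨le_rfl, hb⟩).mono_left hsub
    have hw : Tendsto w (𝓝[>] 0) (𝓝 1) := by
      have := (h.cw 0 ⟨le_rfl, hb⟩).mono_left hsub
      rwa [h.w0] at this
    exact (((tendsto_const_nhds.sub (hv.const_mul 2)).add
      (h.tendsto_tangential.const_mul (2 * m))).pow 2).div hw one_ne_zero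
  have key := le_of_tendsto_of_deriv_nonpos
    (f' := fun s => 2 * m * (1 - 2 * v s + 2 * m * ((1 - w s) / s)) *
      (-(1 - w s + s * v s)) / (s ^ 2 * w s)) (c := b) ?_ ?_ hl s hs
  · have hΦ : 1 ≤ 1 - 2 * v s + 2 * m * ((1 - w s) / s) := by
      have h1 := h.lt_one_of_neg hneg s hs
      have h2 : 0 ≤ (1 - w s) / s := div_nonneg (by linarith) hs.1.le
      have h3 := hneg s ⟨hs.1.le, hs.2⟩
      nlinarith [mul_nonneg hm h2]
    have hw := hpos s ⟨hs.1.le, hs.2⟩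
    have h4 : 1 / w s ≤ (1 - 2 * v 0 + 2 * m * (-v 0)) ^ 2 / 1 := by
      refine le_trans ?_ key
      gcongr
      nlinarith
    have h0 : 0 < 1 - 2 * v 0 - 2 * m * v 0 := by nlinarith [h.v0]
    unfold profileBound
    rw [div_one, div_le_iff₀ hw] at h4
    rw [div_le_iff₀ (by positivity)]
    calc (1 : ℝ) ≤ _ := h4
      _ = _ := by ring
  · intro t ht
    have hw := hpos t ⟨ht.1.le, ht.2⟩
    have := ((h.hasDerivAt_phi ht).pow 2).div (h.dw t ht) hw.ne'
    refine this.congr_deriv ?_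
    have hode := h.ode t ht
    have ha : a t = (2 * m * w t * (w t - 1) + t * v t * (2 * t * v t - t - 2 * m)) /
        (4 * t ^ 2 * w t) := by
      rw [eq_div_iff (by have := ht.1; positivity)]
      linarith
    have ht0 := ht.1.ne'
    simp only [Pi.pow_apply, ha, Nat.cast_ofNat, Nat.add_one_sub_one, pow_one]
    field_simp
    ring
  · intro t ht
    have hw := hpos t ⟨ht.1.le, ht.2⟩
    have h1 := h.lt_one_of_neg hneg t ht
    have h2 : 0 ≤ (1 - w t) / t := div_nonneg (by linarith) ht.1.le
    have h3 := hneg t ⟨ht.1.le, ht.2⟩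
    refine div_nonpos_of_nonpos_of_nonneg ?_ (by positivity)
    refine mul_nonpos_of_nonneg_of_nonpos ?_
      (neg_nonpos.mpr (h.tangential_ge_radial hm hpos hneg t ⟨ht.1.le, ht.2⟩))
    have := mul_nonneg hm h2
    exact mul_nonneg (by positivity) (by linarith)

/-- Positivity of `w` and negativity of `w'` persist up to the endpoint. -/
theorem persists (hm : 0 ≤ m) (hc : 0 < c) (hcb : c < b) (h : IsProfile m b w v a)
    (hpos : ∀ s ∈ Ico 0 c, 0 < w s) (hneg : ∀ s ∈ Ico 0 c, v s < 0) :
    0 < w c ∧ v c < 0 := by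
  have h' := h.mono hcb.le
  set δ := profileBound m (v 0)
  have hδ : 0 < δ := profileBound_pos hm h.v0
  have hlow := h'.lower_bound hm hc hpos hneg
  have hlt : 𝓝[<] c ≤ 𝓝[Ico 0 b] c := by
    rw [← nhdsWithin_Ioo_eq_nhdsLT hc]
    exact nhdsWithin_mono _ fun x hx => ⟨hx.1.le, hx.2.trans hcb⟩
  constructor
  · refine hδ.trans_le (ge_of_tendsto ((h.cw c ⟨hc.le, hcb⟩).mono_left hlt) ?_)
    filter_upwards [Ioo_mem_nhdsLT hc] with s hs using hlow s hs
  -- Chosen so that `v' ≤ -B v` on `[c / 2, c]`; then `-v exp (B s)` is nondecreasing there and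
  -- cannot drop to zero at `c`. The numerator bounds `2 (-s v) + s + 2 m`, and `2 c δ` bounds `4 s
  -- w` from below.
  · set B : ℝ := (2 * c * (-v 0) + c + 2 * m) / (2 * c * δ) with hB
    have hmono : MonotoneOn (fun s => -v s * Real.exp (B * s)) (Icc (c / 2) c) := by
      have hsub : Icc (c / 2) c ⊆ Ico 0 b := fun x hx => ⟨by linarith [hx.1], by linarith [hx.2]⟩
      have hd : ∀ s ∈ Ioo (c / 2) c, HasDerivAt (fun s => -v s * Real.exp (B * s))
          (-a s * Real.exp (B * s) + -v s * (Real.exp (B * s) * (B * 1))) s := fun s hs =>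
        (h.dv s ⟨by linarith [hs.1], by linarith [hs.2]⟩).neg.mul
          ((hasDerivAt_id s).const_mul B).exp
      refine monotoneOn_of_deriv_nonneg (convex_Icc _ _) ?_ ?_ ?_
      · exact (h.cv.mono hsub).neg.mul (by fun_prop)
      · rw [interior_Icc]
        exact fun s hs => (hd s hs).differentiableAt.differentiableWithinAt
      · rw [interior_Icc]
        intro s hs
        rw [(hd s hs).deriv]
        have hs' : s ∈ Ioo 0 c := ⟨by linarith [hs.1], hs.2⟩
        have hw := hlow s hs'
        have hw1 := h'.lt_one_of_neg hneg s hs'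
        have hv := hneg s ⟨hs'.1.le, hs'.2⟩
        have hD := h'.tangential_ge_radial hm hpos hneg s ⟨hs'.1.le, hs'.2⟩
        have hκ := h'.tangential_le hm hpos hneg s hs'
        rw [div_le_iff₀ hs'.1] at hκ
        have hode := h.ode s ⟨hs'.1, hs'.2.trans hcb⟩
        suffices hsuff : 0 ≤ -a s + -v s * B by
          have : 0 < Real.exp (B * s) := Real.exp_pos _
          nlinarith [mul_nonneg this.le hsuff]
        have hwp : 0 < w s := hδ.trans_le hw
        have hs0 := hs'.1
        have h4 : 0 < 4 * s ^ 2 * w s := by positivity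
        have hBδ : 2 * c * (-v 0) + c + 2 * m ≤ B * (4 * s * w s) := by
          have : 2 * c * (-v 0) + c + 2 * m = B * (2 * c * δ) := by
            rw [hB]; field_simp
          rw [this]
          have hB0 : 0 ≤ B := by
            have := h.v0
            rw [hB]
            apply div_nonneg _ (by positivity)
            nlinarith
          apply mul_le_mul_of_nonneg_left _ hB0
          nlinarith [hs.1, mul_pos hs0 hδ]
        have hsv : -(s * v s) ≤ c * (-v 0) := by
          have : -v 0 * s ≤ c * (-v 0) := by nlinarith [h.v0, hs'.2]
          linarith
        have : 0 ≤ 4 * s ^ 2 * w s * (-a s + -v s * B) := by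
          have e : 4 * s ^ 2 * w s * (-a s + -v s * B) =
              2 * m * w s * (1 - w s) +
              s * (-v s) * (B * (4 * s * w s) - (2 * (-(s * v s)) + s + 2 * m)) := by
            linear_combination -hode
          rw [e]
          have e1 : 0 ≤ 2 * m * w s * (1 - w s) := mul_nonneg (by positivity) (by linarith)
          have e2 : 0 ≤ B * (4 * s * w s) - (2 * (-(s * v s)) + s + 2 * m) := by
            linarith [hs.2]
          have e3 : 0 ≤ s * (-v s) := mul_nonneg hs0.le (by linarith)
          exact add_nonneg e1 (mul_nonneg e3 e2)
        exact nonneg_of_mul_nonneg_right this h4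
    have h1 := hmono ⟨le_rfl, by linarith⟩ ⟨by linarith, le_rfl⟩ (by linarith : c / 2 ≤ c)
    have h2 : 0 < -v (c / 2) * Real.exp (B * (c / 2)) :=
      mul_pos (by linarith [hneg (c / 2) ⟨by linarith, by linarith⟩]) (Real.exp_pos _)
    have h3 : 0 < -v c * Real.exp (B * c) := h2.trans_le h1
    linarith [(pos_iff_pos_of_mul_pos h3).mpr (Real.exp_pos _)]

/-- At the first point `c` where a sign fails, both signs hold on `[0, c)`, and `persists` carries
them to `c`. -/
theorem pos_and_neg (hm : 0 ≤ m) (h : IsProfile m b w v a) :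
    ∀ s ∈ Ico 0 b, 0 < w s ∧ v s < 0 := by
  by_contra! hbad
  obtain ⟨t, ht, hbt⟩ := hbad
  have hb : 0 < b := ht.1.trans_lt ht.2
  set S := {s ∈ Icc 0 t | w s ≤ 0} ∪ {s ∈ Icc 0 t | 0 ≤ v s} with hS
  have hsub : Icc 0 t ⊆ Ico 0 b := Icc_subset_Ico_right ht.2
  have hSc : IsCompact S := by
    have hA : IsClosed {s ∈ Icc 0 t | w s ≤ 0} :=
      isClosed_Icc.isClosed_le (h.cw.mono hsub) continuousOn_const
    have hB : IsClosed {s ∈ Icc 0 t | 0 ≤ v s} :=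
      isClosed_Icc.isClosed_le continuousOn_const (h.cv.mono hsub)
    exact isCompact_Icc.of_isClosed_subset (hA.union hB) (by
      rintro s (hs | hs) <;> exact hs.1)
  have hne : S.Nonempty := ⟨t, by
    by_cases hw : w t ≤ 0
    · exact Or.inl ⟨⟨ht.1, le_rfl⟩, hw⟩
    · exact Or.inr ⟨⟨ht.1, le_rfl⟩, hbt (not_le.mp hw)⟩⟩
  obtain ⟨c, hcS, hcmin⟩ := hSc.exists_isLeast hne
  have hcI : c ∈ Icc 0 t := by rcases hcS with hs | hs <;> exact hs.1
  have hc0 : 0 < c := by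
    refine lt_of_le_of_ne hcI.1 ?_
    rintro rfl
    rcases hcS with hs | hs
    · have := hs.2; rw [h.w0] at this; linarith
    · exact absurd hs.2 (not_le.mpr h.v0)
  have hgood : ∀ s ∈ Ico 0 c, 0 < w s ∧ v s < 0 := by
    intro s hs
    by_contra hcon
    have : s ∈ S := by
      have hsI : s ∈ Icc 0 t := ⟨hs.1, hs.2.le.trans hcI.2⟩
      by_cases hw : w s ≤ 0
      · exact Or.inl ⟨hsI, hw⟩
      · exact Or.inr ⟨hsI, not_lt.mp fun hv => hcon ⟨not_le.mp hw, hv⟩⟩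
    exact absurd (hcmin this) (not_le.mpr hs.2)
  obtain ⟨h1, h2⟩ := h.persists hm hc0 (hcI.2.trans_lt ht.2) (fun s hs => (hgood s hs).1)
    fun s hs => (hgood s hs).2
  rcases hcS with hs | hs
  · exact absurd hs.2 (not_le.mpr h1)
  · exact absurd hs.2 (not_le.mpr h2)

/-- The a priori estimates. -/
theorem estimates (hm : 0 ≤ m) (h : IsProfile m b w v a) {s : ℝ} (hs : s ∈ Ioo 0 b) :
    profileBound m (v 0) ≤ w s ∧ w s < 1 ∧ v 0 ≤ v s ∧ v s < 0 ∧ 0 ≤ 1 - w s + s * v s := by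
  have hpos := fun s hs => (h.pos_and_neg hm s hs).1
  have hneg := fun s hs => (h.pos_and_neg hm s hs).2
  have h1 := h.tangential_le hm hpos hneg s hs
  have h2 := h.tangential_ge_radial hm hpos hneg s ⟨hs.1.le, hs.2⟩
  refine ⟨h.lower_bound hm (hs.1.trans hs.2) hpos hneg s hs, h.lt_one_of_neg hneg s hs, ?_,
    hneg s ⟨hs.1.le, hs.2⟩, h2⟩
  -- The lower bound for `v` comes from `-s v ≤ 1 - w ≤ -s v(0)`.
  rw [div_le_iff₀ hs.1] at h1
  by_contra! hlt
  nlinarith [mul_lt_mul_of_pos_left hlt hs.1]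

end IsProfile

/-! ### Global existence -/

/-- For a field bounded by `L` a solution moves at most `L (N + 1)` in time `N + 1`, so
Picard–Lindelöf applies on intervals of any length. Uniqueness glues the solutions. -/
theorem exists_hasDerivAt_of_lipschitz_of_bounded {E : Type*} [NormedAddCommGroup E]
    [NormedSpace ℝ E] [CompleteSpace E] {F : ℝ → E → E} {K L : ℝ≥0}
    (hK : ∀ t, LipschitzWith K (F t)) (hL : ∀ t x, ‖F t x‖ ≤ L)
    (hc : ∀ x, Continuous fun t => F t x) (t₀ : ℝ) (x₀ : E) :
    ∃ α : ℝ → E, α t₀ = x₀ ∧ ∀ t, HasDerivAt α (F t (α t)) t := by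
  have hloc : ∀ N : ℕ, ∃ α : ℝ → E, α t₀ = x₀ ∧
      ∀ t ∈ Ioo (t₀ - (N + 1)) (t₀ + (N + 1)), HasDerivAt α (F t (α t)) t := by
    intro N
    have hN : (0 : ℝ) < N + 1 := by positivity
    have hpl : IsPicardLindelof F (tmin := t₀ - (N + 1)) (tmax := t₀ + (N + 1))
        ⟨t₀, by constructor <;> linarith⟩ x₀ (L * (N + 1)) 0 L K :=
      { lipschitzOnWith := fun t _ => (hK t).lipschitzOnWith
        continuousOn := fun x _ => (hc x).continuousOn
        norm_le := fun t _ x _ => hL t x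
        mul_max_le := by simp }
    obtain ⟨α, h0, h1⟩ := hpl.exists_eq_forall_mem_Icc_hasDerivWithinAt₀
    exact ⟨α, h0, fun t ht => (h1 t ⟨ht.1.le, ht.2.le⟩).hasDerivAt (Icc_mem_nhds ht.1 ht.2)⟩
  choose β hβ0 hβ using hloc
  have huniq : ∀ N N' : ℕ, N ≤ N' → EqOn (β N) (β N') (Ioo (t₀ - (N + 1)) (t₀ + (N + 1))) := by
    intro N N' hNN
    have hcast : (N : ℝ) ≤ N' := by exact_mod_cast hNN
    have hN : (0 : ℝ) < N + 1 := by positivity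
    refine ODE_solution_unique_of_mem_Ioo (v := F) (s := fun _ => univ) (K := K) (t₀ := t₀)
      (fun t _ => (hK t).lipschitzOnWith) ⟨by linarith, by linarith⟩
      (fun t ht => ⟨hβ N t ht, trivial⟩) (fun t ht => ⟨hβ N' t ?_, trivial⟩) ?_
    · exact ⟨by linarith [ht.1], by linarith [ht.2]⟩
    · rw [hβ0, hβ0]
  have hmem : ∀ (t : ℝ) (N : ℕ), |t - t₀| ≤ N → t ∈ Ioo (t₀ - (N + 1)) (t₀ + (N + 1)) := by
    intro t N h
    have := abs_le.mp h
    exact ⟨by linarith [this.1], by linarith [this.2]⟩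
  refine ⟨fun t => β ⌈|t - t₀|⌉₊ t, hβ0 _, fun t => ?_⟩
  -- The extra `1` lets a single `N` serve the whole unit ball around `t`.
  set N := ⌈|t - t₀| + 1⌉₊
  have hN : |t - t₀| + 1 ≤ N := Nat.le_ceil _
  have heq : ∀ s, |s - t₀| ≤ N → β ⌈|s - t₀|⌉₊ s = β N s := fun s hs =>
    huniq _ _ (Nat.ceil_le.mpr hs) (hmem s _ (Nat.le_ceil _))
  have ht := heq t (by linarith)
  have hev : (fun t => β ⌈|t - t₀|⌉₊ t) =ᶠ[𝓝 t] β N := by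
    filter_upwards [Metric.ball_mem_nhds t one_pos] with s hs
    rw [Metric.mem_ball, Real.dist_eq] at hs
    apply heq
    calc |s - t₀| = |(s - t) + (t - t₀)| := by ring_nf
      _ ≤ |s - t| + |t - t₀| := abs_add_le _ _
      _ ≤ N := by linarith
  simp only [ht]
  exact (hβ N t (hmem t N (by linarith))).congr_of_eventuallyEq hev

theorem uniqueDiffOn_solDomain {M : EReal} (hM : 0 < M) : UniqueDiffOn ℝ (solDomain M) := by
  refine uniqueDiffOn_convex ?_ ?_
  · refine Set.OrdConnected.convex ⟨?_⟩
    rintro x hx y hy z hz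
    exact ⟨hx.1.trans hz.1, lt_of_le_of_lt (EReal.coe_le_coe_iff.mpr hz.2) hy.2⟩
  · obtain ⟨b, hb0, hb⟩ := EReal.lt_iff_exists_real_btwn.mp hM
    have hb0' : 0 < b := by exact_mod_cast hb0
    refine ⟨b / 2, mem_interior.mpr ⟨Ioo 0 b, fun x hx => ⟨hx.1.le, ?_⟩, isOpen_Ioo, ?_⟩⟩
    · exact lt_trans (by exact_mod_cast hx.2) hb
    · constructor <;> linarith

theorem solDomain_mem_nhds {M : EReal} {s : ℝ} (h0 : 0 < s) (hs : (s : EReal) < M) :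
    solDomain M ∈ 𝓝 s := by
  obtain ⟨b, hb0, hb⟩ := EReal.lt_iff_exists_real_btwn.mp hs
  have hb0' : s < b := by exact_mod_cast hb0
  filter_upwards [Ioo_mem_nhds h0 hb0'] with x hx
  exact ⟨hx.1.le, lt_trans (by exact_mod_cast hx.2) hb⟩

theorem solDomain_mem_nhdsGE {M : EReal} {s : ℝ} (hs : (s : EReal) < M) :
    solDomain M ∈ 𝓝[Ici 0] s := by
  obtain ⟨b, hb0, hb⟩ := EReal.lt_iff_exists_real_btwn.mp hs
  have hb0' : s < b := by exact_mod_cast hb0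
  filter_upwards [mem_nhdsWithin_of_mem_nhds (Iio_mem_nhds hb0'), self_mem_nhdsWithin] with x hx h0
  exact ⟨h0, lt_trans (by exact_mod_cast hx) hb⟩

theorem solDomain_top : solDomain ⊤ = Ici 0 := by
  ext s
  simp [solDomain]

namespace IsBryantSolution

variable {n : ℕ} {M : EReal} {w : ℝ → ℝ}

theorem isProfile (hM : 0 < M) (h : IsBryantSolution n M w) {b : ℝ} (hb : (b : EReal) ≤ M) :
    IsProfile ((n : ℝ) - 2) b w (derivWithin w (solDomain M))
      (iteratedDerivWithin 2 w (solDomain M)) := by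
  have hu := uniqueDiffOn_solDomain hM
  have h1 : ContDiffOn ℝ 1 (derivWithin w (solDomain M)) (solDomain M) :=
    h.contDiffOn.derivWithin hu (by norm_num)
  have hsub : ∀ s ∈ Ico 0 b, s ∈ solDomain M := fun s hs =>
    ⟨hs.1, lt_of_lt_of_le (by exact_mod_cast hs.2) hb⟩
  have hnhds : ∀ s ∈ Ioo 0 b, solDomain M ∈ 𝓝 s := fun s hs =>
    solDomain_mem_nhds hs.1 (lt_of_lt_of_le (by exact_mod_cast hs.2) hb)
  have h2 : iteratedDerivWithin 2 w (solDomain M) =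
      derivWithin (derivWithin w (solDomain M)) (solDomain M) := by
    ext s
    rw [iteratedDerivWithin_succ, iteratedDerivWithin_one]
  have h0 : (0 : ℝ) ∈ solDomain M := ⟨le_rfl, hM⟩
  refine ⟨h.contDiffOn.continuousOn.mono hsub, h1.continuousOn.mono hsub, ?_, ?_, ?_, ?_,
    h.init, h.init_deriv⟩
  · exact ((h.contDiffOn.differentiableOn (by norm_num)) 0 h0).hasDerivWithinAt.mono_of_mem_nhdsWithin
      (solDomain_mem_nhdsGE hM)
  · intro s hs
    exact ((h.contDiffOn.differentiableOn (by norm_num)) s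
      (hsub s ⟨hs.1.le, hs.2⟩)).hasDerivWithinAt.hasDerivAt (hnhds s hs)
  · intro s hs
    rw [h2]
    exact ((h1.differentiableOn (by norm_num)) s
      (hsub s ⟨hs.1.le, hs.2⟩)).hasDerivWithinAt.hasDerivAt (hnhds s hs)
  · exact fun s hs => h.ode s (hsub s ⟨hs.1.le, hs.2⟩)

end IsBryantSolution

/-- At `s = 0` both sides of the equation vanish because `w(0) = 1`, so the regularity at `0` has to
be a separate hypothesis. -/
theorem isBryantSolution_top_of_isProfile {n : ℕ} {w v a : ℝ → ℝ}
    (h : ∀ b, 0 < b → IsProfile ((n : ℝ) - 2) b w v a)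
    (h0 : ContDiffWithinAt ℝ 2 w (Ici 0) 0) (ha : ContinuousOn a (Ioi 0)) :
    IsBryantSolution n ⊤ w := by
  have hw : ∀ s, 0 < s → HasDerivAt w (v s) s := fun s hs =>
    (h (s + 1) (by linarith)).dw s ⟨hs, by linarith⟩
  have hv : ∀ s, 0 < s → HasDerivAt v (a s) s := fun s hs =>
    (h (s + 1) (by linarith)).dv s ⟨hs, by linarith⟩
  have hIoi : ContDiffOn ℝ 2 w (Ioi 0) := by
    have e : (2 : WithTop ℕ∞) = 1 + 1 := by norm_num
    rw [e, contDiffOn_succ_iff_deriv_of_isOpen isOpen_Ioi]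
    refine ⟨fun s hs => (hw s hs).differentiableAt.differentiableWithinAt, by simp, ?_⟩
    have e1 : ContDiffOn ℝ 1 v (Ioi 0) := by
      rw [show (1 : WithTop ℕ∞) = 0 + 1 by norm_num,
        contDiffOn_succ_iff_deriv_of_isOpen isOpen_Ioi]
      refine ⟨fun s hs => (hv s hs).differentiableAt.differentiableWithinAt, by simp, ?_⟩
      rw [contDiffOn_zero]
      exact ha.congr fun s hs => (hv s hs).deriv
    exact e1.congr fun s hs => (hw s hs).deriv
  have hd0 : derivWithin w (Ici 0) 0 = v 0 :=
    (h 1 one_pos).dw0.derivWithin (uniqueDiffOn_Ici 0 0 self_mem_Ici)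
  have hd : ∀ s, 0 < s → derivWithin w (Ici 0) s = v s := fun s hs => by
    rw [derivWithin_of_mem_nhds (Ici_mem_nhds hs), (hw s hs).deriv]
  refine ⟨?_, ?_, (h 1 one_pos).w0, ?_⟩ <;> rw [solDomain_top]
  · intro s hs
    rcases (mem_Ici.mp hs).eq_or_lt with rfl | hs
    · exact h0
    · exact (hIoi.contDiffAt (Ioi_mem_nhds hs)).contDiffWithinAt
  · intro s hs
    rcases (mem_Ici.mp hs).eq_or_lt with rfl | hs
    · simp [(h 1 one_pos).w0]
    · have h2 : iteratedDerivWithin 2 w (Ici 0) s = a s := by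
        rw [iteratedDerivWithin_succ, iteratedDerivWithin_one,
          derivWithin_of_mem_nhds (Ici_mem_nhds hs)]
        refine ((hv s hs).congr_of_eventuallyEq ?_).deriv
        filter_upwards [Ioi_mem_nhds hs] with t ht using hd t ht
      rw [h2, hd s hs]
      exact (h (s + 1) (by linarith)).ode s ⟨hs, by linarith⟩
  · rw [hd0]
    exact (h 1 one_pos).v0

/-- The second derivative of a solution, expressed through `w = x` and `w' = y`. -/
def profileField (m t x y : ℝ) : ℝ :=
  m / 2 * t⁻¹ ^ 2 * (x - 1) + y * (2 * y - 1 - 2 * m * t⁻¹) / (4 * x)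

theorem profileField_eq_iff {m t x y a : ℝ} (ht : 0 < t) (hx : 0 < x) :
    4 * t ^ 2 * x * a = 2 * m * x * (x - 1) + t * y * (2 * t * y - t - 2 * m) ↔
      a = profileField m t x y := by
  have : profileField m t x y =
      (2 * m * x * (x - 1) + t * y * (2 * t * y - t - 2 * m)) / (4 * t ^ 2 * x) := by
    unfold profileField
    field_simp
    ring
  rw [this, eq_div_iff (by positivity), mul_comm a]

/-- A globally Lipschitz, bounded vector field that agrees with the soliton equation in a box. -/
theorem exists_lipschitz_field (m : ℝ) {δ P s₁ : ℝ} (hδ : 0 < δ) (hδ2 : δ ≤ 2) (hP : 0 < P)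
    (hs₁ : 0 < s₁) :
    ∃ (F : ℝ → ℝ × ℝ → ℝ × ℝ) (K L : ℝ≥0), (∀ t, LipschitzWith K (F t)) ∧
      (∀ t x, ‖F t x‖ ≤ L) ∧ (∀ x, Continuous fun t => F t x) ∧
      ∀ t, s₁ ≤ t → ∀ x ∈ Icc δ 2, ∀ y ∈ Icc (-P) P, F t (x, y) = (y, profileField m t x y) := by
  -- The first variable is `t⁻¹`: the unbounded range `t ≥ s₁` becomes part of a compact interval,
  -- and one Lipschitz constant serves for all times.
  set G : ℝ × ℝ × ℝ → ℝ × ℝ := fun z => (z.2.2,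
    m / 2 * z.1 ^ 2 * (z.2.1 - 1) + z.2.2 * (2 * z.2.2 - 1 - 2 * m * z.1) / (4 * z.2.1)) with hG
  set B : Set (ℝ × ℝ × ℝ) := Icc 0 s₁⁻¹ ×ˢ Icc δ 2 ×ˢ Icc (-P) P with hB
  have hBc : IsCompact B := isCompact_Icc.prod (isCompact_Icc.prod isCompact_Icc)
  have hGd : ContDiffOn ℝ 1 G B := by
    intro z hz
    have hz0 : (4 * z.2.1) ≠ 0 := by
      have : 0 < z.2.1 := hδ.trans_le hz.2.1.1
      positivity
    apply ContDiffAt.contDiffWithinAt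
    apply ContDiffAt.prodMk (by fun_prop)
    apply ContDiffAt.add (by fun_prop)
    exact ContDiffAt.div (by fun_prop) (by fun_prop) hz0
  obtain ⟨K, hK⟩ := hGd.exists_lipschitzOnWith one_ne_zero
    ((convex_Icc _ _).prod ((convex_Icc _ _).prod (convex_Icc _ _))) hBc
  obtain ⟨C, hC⟩ := hBc.exists_bound_of_continuousOn hGd.continuousOn
  -- Clamping to the box is `1`-Lipschitz in the state and does not move states already in the box.
  set cl : ℝ → ℝ × ℝ → ℝ × ℝ × ℝ := fun t z =>
    ((max s₁ t)⁻¹, max δ (min z.1 2), max (-P) (min z.2 P)) with hcl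
  have hmem : ∀ t z, cl t z ∈ B := by
    intro t z
    have h1 : 0 < max s₁ t := hs₁.trans_le (le_max_left _ _)
    refine ⟨⟨by positivity, ?_⟩, ⟨le_max_left _ _, max_le hδ2 (min_le_right _ _)⟩,
      ⟨le_max_left _ _, max_le (by linarith) (min_le_right _ _)⟩⟩
    exact inv_anti₀ hs₁ (le_max_left _ _)
  refine ⟨fun t z => G (cl t z), K, C.toNNReal, ?_, ?_, ?_, ?_⟩
  · intro t
    have hcl1 : LipschitzWith 1 (cl t) := by
      have h1 : LipschitzWith 1 fun z : ℝ × ℝ => max δ (min z.1 2) :=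
        (LipschitzWith.prod_fst.min_const 2).const_max δ
      have h2 : LipschitzWith 1 fun z : ℝ × ℝ => max (-P) (min z.2 P) :=
        (LipschitzWith.prod_snd.min_const P).const_max (-P)
      have := (LipschitzWith.const' (α := ℝ × ℝ) (K := 1) (max s₁ t)⁻¹).prodMk (h1.prodMk h2)
      simpa using this
    have := (hK.comp (hcl1.lipschitzOnWith (s := univ)) fun z _ => hmem t z)
    rw [mul_one, lipschitzOnWith_univ] at this
    exact this
  · intro t z
    exact (hC _ (hmem t z)).trans (Real.le_coe_toNNReal C)
  · intro z
    have h0 : ∀ t, max s₁ t ≠ 0 := fun t => (hs₁.trans_le (le_max_left _ _)).ne'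
    have : Continuous fun t => cl t z :=
      ((continuous_const.max continuous_id).inv₀ h0).prodMk continuous_const
    exact hGd.continuousOn.comp_continuous this fun t => hmem t z
  · intro t ht x hx y hy
    have e : cl t (x, y) = (t⁻¹, x, y) := by
      simp [hcl, max_eq_right ht, min_eq_left hx.2, min_eq_left hy.2, max_eq_right hx.1,
        max_eq_right hy.1]
    simp only [e, hG, profileField]

/-- The truncated system is solved for all times from a point `s₁` of the given interval. Up to a
first exit from the open box its solution solves the true equation, so the a priori estimates
confine it to a closed set inside the box, also at the exit time; hence there is no exit. -/
theorem IsBryantSolution.exists_extension {n : ℕ} (hn : 2 ≤ n) {M : EReal} (hM : 0 < M)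
    {w₀ : ℝ → ℝ} (h : IsBryantSolution n M w₀) :
    ∃ w, IsBryantSolution n ⊤ w ∧ EqOn w w₀ (solDomain M) := by
  have hm : (0 : ℝ) ≤ (n : ℝ) - 2 := by
    have : (2 : ℝ) ≤ n := by exact_mod_cast hn
    linarith
  set m : ℝ := (n : ℝ) - 2
  set v₀ := derivWithin w₀ (solDomain M)
  set a₀ := iteratedDerivWithin 2 w₀ (solDomain M)
  have hprof : ∀ b : ℝ, (b : EReal) ≤ M → IsProfile m b w₀ v₀ a₀ := fun b hb => h.isProfile hM hb
  obtain ⟨b₀, hb₀, hb₀M⟩ := EReal.lt_iff_exists_real_btwn.mp hM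
  have hb₀' : 0 < b₀ := by exact_mod_cast hb₀
  have hv0 : v₀ 0 < 0 := h.init_deriv
  set δ := profileBound m (v₀ 0)
  have hδ : 0 < δ := profileBound_pos hm hv0
  have hest : ∀ s : ℝ, 0 < s → (s : EReal) < M → δ ≤ w₀ s ∧ w₀ s < 1 ∧ v₀ 0 ≤ v₀ s ∧ v₀ s < 0 := by
    intro s hs hsM
    obtain ⟨b, hb, hbM⟩ := EReal.lt_iff_exists_real_btwn.mp hsM
    have hb' : s < b := by exact_mod_cast hb
    obtain ⟨h1, h2, h3, h4, -⟩ := (hprof b hbM.le).estimates hm ⟨hs, hb'⟩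
    exact ⟨h1, h2, h3, h4⟩
  set s₁ := b₀ / 2
  have hs₁ : 0 < s₁ := by positivity
  have hs₁b : s₁ < b₀ := by simp only [s₁]; linarith
  have hs₁M : (s₁ : EReal) < M := lt_trans (by exact_mod_cast hs₁b) hb₀M
  have hδ1 : δ < 1 := (hest s₁ hs₁ hs₁M).1.trans_lt (hest s₁ hs₁ hs₁M).2.1
  -- The box `(δ / 2, 2) × (-P, P)` contains the a priori region `[δ, 1] × [v₀ 0, 0]` with room to
  -- spare.
  set P := 1 - v₀ 0 with hPdef
  have hP : 0 < P := by simp only [P]; linarith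
  obtain ⟨F, K, L, hFK, hFL, hFc, hF⟩ := exists_lipschitz_field m (half_pos hδ)
    (by linarith : δ / 2 ≤ 2) hP hs₁
  obtain ⟨α, hα1, hα⟩ :=
    exists_hasDerivAt_of_lipschitz_of_bounded hFK hFL hFc s₁ (w₀ s₁, v₀ s₁)
  have hagree : ∀ t, s₁ ≤ t → (t : EReal) < M → α t = (w₀ t, v₀ t) := by
    intro t ht htM
    have hM' : ∀ s ∈ Icc s₁ t, 0 < s ∧ (s : EReal) < M := fun s hs =>
      ⟨hs₁.trans_le hs.1, lt_of_le_of_lt (by exact_mod_cast hs.2) htM⟩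
    obtain ⟨b, hb, hbM⟩ := EReal.lt_iff_exists_real_btwn.mp htM
    have hb' : t < b := by exact_mod_cast hb
    have hder : ∀ s ∈ Icc s₁ t,
        HasDerivAt (fun s => (w₀ s, v₀ s)) (F s (w₀ s, v₀ s)) s := by
      intro s hs
      have hsb : s ∈ Ioo 0 b := ⟨(hM' s hs).1, hs.2.trans_lt hb'⟩
      obtain ⟨e1, e2, e3, e4⟩ := hest s (hM' s hs).1 (hM' s hs).2
      have hp := hprof b hbM.le
      rw [hF s hs.1 _ ⟨by linarith, by linarith⟩ _ ⟨by linarith, by linarith⟩,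
        ← (profileField_eq_iff hsb.1 (hδ.trans_le e1)).mp (hp.ode s hsb)]
      exact (hp.dw s hsb).prodMk (hp.dv s hsb)
    refine ODE_solution_unique (g := fun s => (w₀ s, v₀ s)) hFK (a := s₁) (b := t) ?_ ?_ ?_ ?_ hα1 ⟨ht, le_rfl⟩
    · exact fun s _ => (hα s).continuousAt.continuousWithinAt
    · exact fun s _ => (hα s).hasDerivWithinAt
    · exact fun s hs => (hder s hs).continuousAt.continuousWithinAt
    · exact fun s hs => (hder s ⟨hs.1, hs.2.le⟩).hasDerivWithinAt
  set w : ℝ → ℝ := fun s => if s ≤ s₁ then w₀ s else (α s).1 with hw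
  set v : ℝ → ℝ := fun s => if s ≤ s₁ then v₀ s else (α s).2 with hv
  set a : ℝ → ℝ := fun s => if s ≤ s₁ then a₀ s else (F s (α s)).2 with ha
  have hwM : ∀ s : ℝ, (s : EReal) < M → w s = w₀ s := by
    intro s hs
    by_cases hle : s ≤ s₁
    · simp [hw, hle]
    · simp [hw, hle, hagree s (not_le.mp hle).le hs]
  have hvM : ∀ s : ℝ, (s : EReal) < M → v s = v₀ s := by
    intro s hs
    by_cases hle : s ≤ s₁
    · simp [hv, hle]
    · simp [hv, hle, hagree s (not_le.mp hle).le hs]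
  have hαd1 : ∀ s, HasDerivAt (fun s => (α s).1) (F s (α s)).1 s := fun s =>
    (hasFDerivAt_fst.comp_hasDerivAt s (hα s) :)
  have hαd2 : ∀ s, HasDerivAt (fun s => (α s).2) (F s (α s)).2 s := fun s =>
    (hasFDerivAt_snd.comp_hasDerivAt s (hα s) :)
  have hlt0 : ∀ s : ℝ, s < b₀ → (s : EReal) < M := fun s hs =>
    lt_trans (by exact_mod_cast hs) hb₀M
  have hev : ∀ s : ℝ, s < b₀ → (∀ᶠ t : ℝ in 𝓝 s, (t : EReal) < M) := fun s hs => by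
    filter_upwards [Iio_mem_nhds hs] with t ht using hlt0 t ht
  have hP0 := hprof b₀ hb₀M.le
  have hwa : ∀ s, s₁ < s → w =ᶠ[𝓝 s] fun s => (α s).1 := fun s hs => by
    filter_upwards [Ioi_mem_nhds hs] with t ht
    simp [hw, not_le.mpr (mem_Ioi.mp ht)]
  have hva : ∀ s, s₁ < s → v =ᶠ[𝓝 s] fun s => (α s).2 := fun s hs => by
    filter_upwards [Ioi_mem_nhds hs] with t ht
    simp [hv, not_le.mpr (mem_Ioi.mp ht)]
  have hv00 : v 0 = v₀ 0 := hvM 0 hM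
  have hprofile : ∀ c, (∀ s, s₁ ≤ s → s < c → (α s).1 ∈ Icc (δ / 2) 2 ∧ (α s).2 ∈ Icc (-P) P) →
      IsProfile m c w v a := by
    intro c hc
    have hdw : ∀ s ∈ Ioo 0 c, HasDerivAt w (v s) s := by
      intro s hs
      by_cases hsb : s ≤ s₁
      · have hlt := hsb.trans_lt hs₁b
        rw [hvM s (hlt0 s hlt)]
        refine (hP0.dw s ⟨hs.1, hlt⟩).congr_of_eventuallyEq ?_
        filter_upwards [hev s hlt] with t ht using hwM t ht
      · have hlt := not_le.mp hsb
        obtain ⟨h1, h2⟩ := hc s hlt.le hs.2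
        refine HasDerivAt.congr_of_eventuallyEq ?_ (hwa s hlt)
        refine (hαd1 s).congr_deriv ?_
        have := hF s hlt.le _ h1 _ h2
        simp only [Prod.mk.eta] at this
        rw [this]
        simp [hv, hsb]
    have hdv : ∀ s ∈ Ioo 0 c, HasDerivAt v (a s) s := by
      intro s hs
      by_cases hsb : s ≤ s₁
      · have hlt := hsb.trans_lt hs₁b
        rw [show a s = a₀ s by simp [ha, hsb]]
        refine (hP0.dv s ⟨hs.1, hlt⟩).congr_of_eventuallyEq ?_
        filter_upwards [hev s hlt] with t ht using hvM t ht
      · have hlt := not_le.mp hsb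
        refine HasDerivAt.congr_of_eventuallyEq ?_ (hva s hlt)
        refine (hαd2 s).congr_deriv ?_
        simp [ha, hsb]
    have h0Ico : ∀ᶠ t : ℝ in 𝓝[Ico 0 c] (0 : ℝ), (t : EReal) < M :=
      nhdsWithin_le_nhds (hev 0 hb₀')
    refine ⟨?_, ?_, ?_, hdw, hdv, ?_, ?_, ?_⟩
    · intro s hs
      rcases hs.1.eq_or_lt with rfl | hs0
      · refine ContinuousWithinAt.congr_of_eventuallyEq (f := w₀) ?_ ?_ (hwM 0 hM)
        · exact hP0.dw0.continuousWithinAt.mono fun x hx => hx.1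
        · filter_upwards [h0Ico] with t ht using hwM t ht
      · exact (hdw s ⟨hs0, hs.2⟩).continuousAt.continuousWithinAt
    · intro s hs
      rcases hs.1.eq_or_lt with rfl | hs0
      · refine ContinuousWithinAt.congr_of_eventuallyEq (f := v₀) ?_ ?_ (hvM 0 hM)
        · have := hP0.cv 0 ⟨le_rfl, hb₀'⟩
          unfold ContinuousWithinAt at this ⊢
          rw [nhdsWithin_Ico_eq_nhdsGE hb₀'] at this
          exact this.mono_left (nhdsWithin_mono _ fun x hx => hx.1)
        · filter_upwards [h0Ico] with t ht using hvM t ht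
      · exact (hdv s ⟨hs0, hs.2⟩).continuousAt.continuousWithinAt
    · rw [hv00]
      refine hP0.dw0.congr_of_eventuallyEq ?_ (hwM 0 hM)
      filter_upwards [nhdsWithin_le_nhds (hev 0 hb₀')] with t ht using hwM t ht
    · intro s hs
      by_cases hsb : s ≤ s₁
      · have := hP0.ode s ⟨hs.1, hsb.trans_lt hs₁b⟩
        simpa [hw, hv, ha, hsb] using this
      · have hlt := not_le.mp hsb
        obtain ⟨h1, h2⟩ := hc s hlt.le hs.2
        have := hF s hlt.le _ h1 _ h2
        simp only [Prod.mk.eta] at this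
        simp only [hw, hv, ha, hsb, if_false]
        rw [profileField_eq_iff hs.1 ((half_pos hδ).trans_le h1.1), this]
    · rw [hwM 0 hM, h.init]
    · rw [hv00]; exact hv0
  have hαc : Continuous α := continuous_iff_continuousAt.mpr fun s => (hα s).continuousAt
  have hbox : ∀ s, s₁ ≤ s → (α s).1 ∈ Ioo (δ / 2) 2 ∧ (α s).2 ∈ Ioo (-P) P := by
    by_contra! hbad
    obtain ⟨t, ht, hbt⟩ := hbad
    have hU : IsOpen {s | (α s).1 ∈ Ioo (δ / 2) 2 ∧ (α s).2 ∈ Ioo (-P) P} :=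
      (isOpen_Ioo.preimage (continuous_fst.comp hαc)).inter
        (isOpen_Ioo.preimage (continuous_snd.comp hαc))
    set S := Icc s₁ t ∩ {s | (α s).1 ∈ Ioo (δ / 2) 2 ∧ (α s).2 ∈ Ioo (-P) P}ᶜ
    have hSc : IsCompact S := isCompact_Icc.inter_right hU.isClosed_compl
    obtain ⟨c, hcS, hcmin⟩ := hSc.exists_isLeast
      ⟨t, ⟨ht, le_rfl⟩, fun hcon => hbt hcon.1 hcon.2⟩
    obtain ⟨e1, e2, e3, e4⟩ := hest s₁ hs₁ hs₁M
    have hc1 : s₁ < c := by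
      refine lt_of_le_of_ne hcS.1.1 fun heq => hcS.2 ?_
      rw [← heq, mem_ofPred_eq, hα1]
      exact ⟨⟨by simp only; linarith, by simp only; linarith⟩,
        ⟨by simp only; linarith, by simp only; linarith⟩⟩
    have hgood : ∀ s, s₁ ≤ s → s < c → (α s).1 ∈ Ioo (δ / 2) 2 ∧ (α s).2 ∈ Ioo (-P) P := by
      intro s hs hsc
      by_contra hcon
      exact absurd (hcmin ⟨⟨hs, hsc.le.trans hcS.1.2⟩, hcon⟩) (not_le.mpr hsc)
    have hpc := hprofile c fun s hs hsc =>
      ⟨Ioo_subset_Icc_self (hgood s hs hsc).1, Ioo_subset_Icc_self (hgood s hs hsc).2⟩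
    have hev2 : ∀ᶠ s in 𝓝[<] c, (α s).1 ∈ Icc δ 1 ∧ (α s).2 ∈ Icc (v₀ 0) 0 := by
      filter_upwards [Ioo_mem_nhdsLT hc1] with s hs
      obtain ⟨f1, f2, f3, f4, -⟩ := hpc.estimates hm ⟨hs₁.trans hs.1, hs.2⟩
      rw [hv00] at f1 f3
      simp only [hw, hv, not_le.mpr hs.1, if_false] at f1 f2 f3 f4
      exact ⟨⟨f1, f2.le⟩, ⟨f3, f4.le⟩⟩
    have hcl : IsClosed {s | (α s).1 ∈ Icc δ 1 ∧ (α s).2 ∈ Icc (v₀ 0) 0} :=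
      (isClosed_Icc.preimage (continuous_fst.comp hαc)).inter
        (isClosed_Icc.preimage (continuous_snd.comp hαc))
    have hcmem : (α c).1 ∈ Icc δ 1 ∧ (α c).2 ∈ Icc (v₀ 0) 0 :=
      hcl.mem_of_frequently_of_tendsto hev2.frequently
        (tendsto_id.mono_left nhdsWithin_le_nhds)
    obtain ⟨⟨g1, g2⟩, g3, g4⟩ := hcmem
    exact hcS.2 ⟨⟨by linarith, by linarith⟩, ⟨by linarith, by linarith⟩⟩
  have hall : ∀ c, 0 < c → IsProfile m c w v a := fun c _ => hprofile c fun s hs _ =>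
    ⟨Ioo_subset_Icc_self (hbox s hs).1, Ioo_subset_Icc_self (hbox s hs).2⟩
  refine ⟨w, isBryantSolution_top_of_isProfile hall ?_ ?_, fun s hs => hwM s hs.2⟩
  · have h0 : ContDiffWithinAt ℝ 2 w₀ (Ici 0) 0 :=
      (h.contDiffOn 0 ⟨le_rfl, hM⟩).mono_of_mem_nhdsWithin (solDomain_mem_nhdsGE hM)
    refine h0.congr_of_eventuallyEq ?_ (hwM 0 hM)
    filter_upwards [nhdsWithin_le_nhds (hev 0 hb₀')] with t ht using hwM t ht
  -- Continuity of the second derivative is read off the equation, which also covers the junction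
  -- `s₁`.
  · have hform : EqOn a (fun s => profileField m s (w s) (v s)) (Ioi 0) := by
      intro s hs
      have hp := hall (s + 1) (by have := mem_Ioi.mp hs; linarith)
      have hsI : s ∈ Ioo 0 (s + 1) := ⟨hs, by linarith⟩
      exact (profileField_eq_iff hs (hp.pos_and_neg hm s ⟨hsI.1.le, hsI.2⟩).1).mp (hp.ode s hsI)
    refine ContinuousOn.congr (fun s hs => ?_) hform
    have hp := hall (s + 1) (by have := mem_Ioi.mp hs; linarith)
    have hsI : s ∈ Ioo 0 (s + 1) := ⟨hs, by linarith⟩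
    have h1 := (hp.dw s hsI).continuousAt
    have h2 := (hp.dv s hsI).continuousAt
    have h3 : 4 * w s ≠ 0 := by
      have := (hp.pos_and_neg hm s ⟨hsI.1.le, hsI.2⟩).1
      positivity
    have h4 : ContinuousAt (fun s : ℝ => s⁻¹) s := continuousAt_inv₀ (ne_of_gt hs)
    apply ContinuousAt.continuousWithinAt
    unfold profileField
    exact ((continuousAt_const.mul (h4.pow 2)).mul (h1.sub continuousAt_const)).add
      ((h2.mul (((continuousAt_const.mul h2).sub continuousAt_const).sub
        (continuousAt_const.mul h4))).div (continuousAt_const.mul h1) h3)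

/-! ### Smoothness up to the singular point -/

/-- The weighted radial average `∫₀¹ σᵏ H(s σ²) dσ`. -/
def radialAverage (k : ℕ) (H : ℝ → ℝ) (s : ℝ) : ℝ := ∫ σ in (0 : ℝ)..1, σ ^ k * H (s * σ ^ 2)

theorem radialAverage_congr (k : ℕ) {H G : ℝ → ℝ} (h : EqOn H G (Ici 0)) :
    EqOn (radialAverage k H) (radialAverage k G) (Ici 0) := by
  intro s hs
  refine intervalIntegral.integral_congr fun σ _ => ?_
  have : s * σ ^ 2 ∈ Ici (0 : ℝ) := mul_nonneg hs (sq_nonneg σ)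
  simp only [h this]

theorem continuous_radialAverage (k : ℕ) {H : ℝ → ℝ} (hH : Continuous H) :
    Continuous (radialAverage k H) := by
  unfold radialAverage
  apply intervalIntegral.continuous_parametric_intervalIntegral_of_continuous'
  fun_prop

theorem hasDerivAt_radialAverage (k : ℕ) {H H' : ℝ → ℝ} (hH : ∀ s, HasDerivAt H (H' s) s)
    (hH' : Continuous H') (s : ℝ) :
    HasDerivAt (radialAverage k H) (radialAverage (k + 2) H' s) s := by
  have hHc : Continuous H := continuous_iff_continuousAt.mpr fun s => (hH s).continuousAt
  obtain ⟨C, hC⟩ := (isCompact_Icc (a := -(|s| + 1)) (b := |s| + 1)).exists_bound_of_continuousOn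
    hH'.continuousOn
  refine (intervalIntegral.hasDerivAt_integral_of_dominated_loc_of_deriv_le
    (F := fun s σ => σ ^ k * H (s * σ ^ 2)) (F' := fun s σ => σ ^ (k + 2) * H' (s * σ ^ 2))
    (bound := fun _ => C) (Metric.ball_mem_nhds s one_pos) ?_ ?_ ?_ ?_ ?_ ?_).2
  · exact Eventually.of_forall fun x => (by fun_prop : Continuous fun σ : ℝ =>
      σ ^ k * H (x * σ ^ 2)).aestronglyMeasurable
  · exact (by fun_prop : Continuous fun σ : ℝ => σ ^ k * H (s * σ ^ 2)).intervalIntegrable _ _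
  · exact (by fun_prop : Continuous fun σ : ℝ =>
      σ ^ (k + 2) * H' (s * σ ^ 2)).aestronglyMeasurable
  · refine Eventually.of_forall fun σ hσ x hx => ?_
    rw [uIoc_of_le zero_le_one] at hσ
    have h1 : |σ ^ (k + 2)| ≤ 1 := by
      rw [abs_of_nonneg (pow_nonneg hσ.1.le _)]
      exact pow_le_one₀ hσ.1.le hσ.2
    have h2 : |x * σ ^ 2| ≤ |s| + 1 := by
      rw [abs_mul, abs_of_nonneg (sq_nonneg σ)]
      have h3 : |x| ≤ |s| + 1 := by
        rw [Metric.mem_ball, Real.dist_eq] at hx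
        have := abs_sub_abs_le_abs_sub x s
        linarith
      have h4 : σ ^ 2 ≤ 1 := pow_le_one₀ hσ.1.le hσ.2
      nlinarith [abs_nonneg x, sq_nonneg σ]
    have h5 := hC _ (abs_le.mp h2)
    rw [norm_mul]
    calc ‖σ ^ (k + 2)‖ * ‖H' (x * σ ^ 2)‖ ≤ 1 * ‖H' (x * σ ^ 2)‖ :=
          mul_le_mul_of_nonneg_right h1 (norm_nonneg _)
      _ ≤ C := by rw [one_mul]; exact h5
  · exact continuous_const.intervalIntegrable _ _
  · refine Eventually.of_forall fun σ _ x _ => ?_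
    have h1 : HasDerivAt (fun x => x * σ ^ 2) (σ ^ 2) x := by
      simpa using (hasDerivAt_id x).mul_const (σ ^ 2)
    have := ((hH (x * σ ^ 2)).comp x h1).const_mul (σ ^ k)
    refine this.congr_deriv ?_
    ring

theorem continuousOn_radialAverage (k : ℕ) {H : ℝ → ℝ} (hH : ContinuousOn H (Ici 0)) :
    ContinuousOn (radialAverage k H) (Ici 0) := by
  have hc : Continuous fun s => H (max s 0) :=
    hH.comp_continuous (by fun_prop) fun s => mem_Ici.mpr (le_max_right _ _)
  refine (continuous_radialAverage k hc).continuousOn.congr (radialAverage_congr k ?_)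
  intro s hs
  simp [max_eq_left (mem_Ici.mp hs)]

/-- Differentiation under the integral needs two-sided derivatives. So `H` is replaced by the `C¹`
extension `G` with constant slope on the left of `0`; averages at `s ≥ 0` do not see the change. -/
theorem hasDerivWithinAt_radialAverage (k : ℕ) {H H' : ℝ → ℝ}
    (hH : ∀ s ∈ Ici (0 : ℝ), HasDerivWithinAt H (H' s) (Ici 0) s) (hH' : ContinuousOn H' (Ici 0)) :
    ∀ s ∈ Ici (0 : ℝ), HasDerivWithinAt (radialAverage k H) (radialAverage (k + 2) H' s)
      (Ici 0) s := by
  have hc : Continuous fun s => H' (max s 0) :=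
    hH'.comp_continuous (by fun_prop) fun s => mem_Ici.mpr (le_max_right _ _)
  set G : ℝ → ℝ := fun s => H 0 + ∫ t in (0 : ℝ)..s, H' (max t 0) with hG
  have hGd : ∀ s, HasDerivAt G (H' (max s 0)) s := fun s =>
    (intervalIntegral.integral_hasDerivAt_right (hc.intervalIntegrable _ _)
      (hc.stronglyMeasurableAtFilter _ _) hc.continuousAt).const_add _
  have hHG : EqOn H G (Ici 0) := by
    intro s hs
    have hs' : 0 ≤ s := hs
    have : ∫ t in (0 : ℝ)..s, H' (max t 0) = H s - H 0 := by
      refine intervalIntegral.integral_eq_sub_of_hasDerivAt_of_le hs' ?_ ?_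
        (hc.intervalIntegrable _ _)
      · exact fun t ht => ((hH t ht.1).continuousWithinAt).mono fun x hx => hx.1
      · intro t ht
        simp only [max_eq_left ht.1.le]
        exact (hH t ht.1.le).hasDerivAt (Ici_mem_nhds ht.1)
    simp only [hG, this]
    ring
  intro s hs
  have h1 := (hasDerivAt_radialAverage k hGd hc s).hasDerivWithinAt (s := Ici 0)
  have h2 : radialAverage (k + 2) (fun s => H' (max s 0)) s = radialAverage (k + 2) H' s :=
    radialAverage_congr _ (fun t ht => by simp [max_eq_left (mem_Ici.mp ht)]) hs
  rw [h2] at h1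
  exact h1.congr (radialAverage_congr k hHG) (radialAverage_congr k hHG hs)

/-- Differentiating replaces `H` by `H'` and raises the weight by two, which is why the induction
runs over all `k` at once. -/
theorem contDiffOn_radialAverage (j : ℕ) : ∀ (k : ℕ) {H : ℝ → ℝ}, ContDiffOn ℝ j H (Ici 0) →
    ContDiffOn ℝ j (radialAverage k H) (Ici 0) := by
  have hu : UniqueDiffOn ℝ (Ici (0 : ℝ)) := uniqueDiffOn_Ici 0
  induction j with
  | zero =>
    intro k H hH
    simp only [Nat.cast_zero, contDiffOn_zero] at hH ⊢
    exact continuousOn_radialAverage k hH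
  | succ j ih =>
    intro k H hH
    have hd := hasDerivWithinAt_radialAverage k (H := H) (H' := derivWithin H (Ici 0))
      (fun s hs => (hH.differentiableOn (by simp) s hs).hasDerivWithinAt)
      (hH.continuousOn_derivWithin hu (by simp))
    push_cast at hH ⊢
    rw [contDiffOn_succ_iff_derivWithin hu] at hH ⊢
    refine ⟨fun s hs => (hd s hs).differentiableWithinAt, by simp, ?_⟩
    exact (ih (k + 2) hH.2.2).congr fun s hs => (hd s hs).derivWithin (hu s hs)

/-- A smooth solution on `[0, ∞)`, with the radial curvature `p = -w'`, its derivative `q`, and the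
tangential curvature `κ = (1 - w) / s`. -/
structure IsSmoothProfile (m : ℝ) (w p q κ : ℝ → ℝ) : Prop where
  smooth_w : ContDiffOn ℝ ∞ w (Ici 0)
  smooth_p : ContDiffOn ℝ ∞ p (Ici 0)
  smooth_κ : ContDiffOn ℝ ∞ κ (Ici 0)
  deriv_w : ∀ s, 0 ≤ s → HasDerivWithinAt w (-p s) (Ici 0) s
  deriv_p : ∀ s, 0 ≤ s → HasDerivWithinAt p (q s) (Ici 0) s
  eq_κ : ∀ s, 0 ≤ s → 1 - w s = s * κ s
  ode : ∀ s, 0 ≤ s → 4 * s * w s * q s = 2 * m * w s * κ s - p s * (2 * s * p s + s + 2 * m)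
  w_pos : ∀ s, 0 ≤ s → 0 < w s
  p_pos : ∀ s, 0 ≤ s → 0 < p s
  κ_pos : ∀ s, 0 ≤ s → 0 < κ s
  lower : ∃ δ > 0, ∀ s, 0 < s → δ ≤ w s

namespace IsBryantSolution

variable {k : ℕ} {w : ℝ → ℝ}

/-- The right-hand side of the regularized equation `w'' = H - m ∫₀¹ σᵐ⁺³ H(s σ²) dσ`. -/
def regularized (m : ℝ) (w v u : ℝ → ℝ) (s : ℝ) : ℝ :=
  v s * (2 * m * u s + 2 * v s - 1) / (4 * w s)

/-- With `D = 1 - w + s w'` the equation reads `w'' = H - (k / 2) D / s²`, where `H` is regular at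
`0`. As `D' = s w''`, this is a linear equation for `D`; solving it turns `D / s²` into an average
of `H`, and the singular term disappears. -/
theorem exists_isSmoothProfile (h : IsBryantSolution (k + 2) ⊤ w) :
    ∃ p q κ, IsSmoothProfile (k : ℝ) w p q κ := by
  have hu : UniqueDiffOn ℝ (Ici (0 : ℝ)) := uniqueDiffOn_Ici 0
  have hm : (0 : ℝ) ≤ k := Nat.cast_nonneg k
  have hprof : ∀ b : ℝ, IsProfile k b w (derivWithin w (Ici 0)) (iteratedDerivWithin 2 w (Ici 0)) := by
    intro b
    have := h.isProfile (b := b) (by simp) le_top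
    rw [solDomain_top] at this
    convert this using 1
    push_cast
    ring
  have hC2 : ContDiffOn ℝ 2 w (Ici 0) := solDomain_top ▸ h.contDiffOn
  have hw0 : w 0 = 1 := h.init
  set v := derivWithin w (Ici 0) with hv
  set a := iteratedDerivWithin 2 w (Ici 0)
  have hv1 : ContDiffOn ℝ 1 v (Ici 0) := hC2.derivWithin hu (by norm_num)
  have hwd : ∀ s ∈ Ici (0 : ℝ), HasDerivWithinAt w (v s) (Ici 0) s := fun s hs =>
    (hC2.differentiableOn (by norm_num) s hs).hasDerivWithinAt
  have hwd' : ∀ s, 0 < s → HasDerivAt w (v s) s := fun s hs =>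
    (hprof (s + 1)).dw s ⟨hs, by linarith⟩
  have hvd' : ∀ s, 0 < s → HasDerivAt v (a s) s := fun s hs =>
    (hprof (s + 1)).dv s ⟨hs, by linarith⟩
  have hode : ∀ s : ℝ, 0 < s → _ := fun s hs => (hprof (s + 1)).ode s ⟨hs, by linarith⟩
  have hwpos : ∀ s, 0 ≤ s → 0 < w s := fun s hs =>
    ((hprof (s + 1)).pos_and_neg hm s ⟨hs, by linarith⟩).1
  have hvneg : ∀ s, 0 ≤ s → v s < 0 := fun s hs =>
    ((hprof (s + 1)).pos_and_neg hm s ⟨hs, by linarith⟩).2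
  -- This is `(w - 1) / s`, in a form that is regular at `0`.
  set u : ℝ → ℝ := fun s => 2 * radialAverage 1 v s with hudef
  have hwu : ∀ s, 0 ≤ s → w s = 1 + s * u s := by
    intro s hs
    have hc : ContinuousOn (fun σ : ℝ => 2 * s * (σ ^ 1 * v (s * σ ^ 2))) (Icc 0 1) := by
      refine continuousOn_const.mul ((continuousOn_id.pow 1).mul
        (hv1.continuousOn.comp (by fun_prop) fun σ _ => mul_nonneg hs (sq_nonneg σ)))
    have key : ∫ σ in (0 : ℝ)..1, 2 * s * (σ ^ 1 * v (s * σ ^ 2)) =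
        w (s * 1 ^ 2) - w (s * 0 ^ 2) := by
      rcases hs.eq_or_lt with rfl | hs0
      · simp
      refine intervalIntegral.integral_eq_sub_of_hasDerivAt_of_le (f := fun σ => w (s * σ ^ 2))
        zero_le_one ?_ ?_ ?_
      · exact hC2.continuousOn.comp (by fun_prop) fun σ _ => mul_nonneg hs (sq_nonneg σ)
      · intro σ hσ
        have h1 : HasDerivAt (fun σ => s * σ ^ 2) (s * (2 * σ)) σ := by
          simpa using (hasDerivAt_pow 2 σ).const_mul s
        refine ((hwd' _ (mul_pos hs0 (pow_pos hσ.1 2))).comp σ h1).congr_deriv ?_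
        ring
      · exact hc.intervalIntegrable_of_Icc zero_le_one
    rw [intervalIntegral.integral_const_mul] at key
    simp only [one_pow, mul_one, ne_eq, OfNat.ofNat_ne_zero, not_false_eq_true, zero_pow,
      mul_zero, hw0] at key
    simp only [hudef, radialAverage]
    linarith
  set H := regularized k w v u with hHdef
  have hreg : ∀ j : ℕ, ContDiffOn ℝ j v (Ici 0) → ContDiffOn ℝ (j + 1 : ℕ) w (Ici 0) ∧
      ContDiffOn ℝ j u (Ici 0) ∧ ContDiffOn ℝ j H (Ici 0) := by
    intro j hj
    have h1 : ContDiffOn ℝ (j + 1 : ℕ) w (Ici 0) := by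
      push_cast
      rw [contDiffOn_succ_iff_derivWithin hu]
      exact ⟨fun s hs => (hwd s hs).differentiableWithinAt, by simp, hj⟩
    have h2 : ContDiffOn ℝ j u (Ici 0) := contDiffOn_const.mul (contDiffOn_radialAverage j 1 hj)
    refine ⟨h1, h2, ?_⟩
    refine (hj.mul (((contDiffOn_const.mul h2).add (contDiffOn_const.mul hj)).sub
      contDiffOn_const)).div (contDiffOn_const.mul (h1.of_le (by simp))) ?_
    intro s hs
    have := hwpos s hs
    positivity
  have hHc : ContinuousOn H (Ici 0) := (hreg 1 (by simpa using hv1)).2.2.continuousOn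
  have haH : ∀ s, 0 < s → H s = a s + k / 2 * ((1 - w s + s * v s) / s ^ 2) := by
    intro s hs
    have h1 := (hode s hs)
    have hw := hwpos s hs.le
    have hus : u s = (w s - 1) / s := by
      rw [hwu s hs.le]; field_simp; ring
    simp only [hHdef, regularized, hus]
    have ha : a s = (2 * k * w s * (w s - 1) + s * v s * (2 * s * v s - s - 2 * k)) /
        (4 * s ^ 2 * w s) := by
      rw [eq_div_iff (by positivity)]
      linarith
    rw [ha]
    field_simp
    ring
  have hD : ∀ s, 0 < s → (1 - w s + s * v s) / s ^ 2 = 2 * radialAverage (k + 3) H s := by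
    intro s hs
    have hmaps : MapsTo (fun σ : ℝ => s * σ ^ 2) (Icc 0 1) (Ici 0) := fun σ _ =>
      mul_nonneg hs.le (sq_nonneg σ)
    have hHs : ContinuousOn (fun σ => H (s * σ ^ 2)) (Icc 0 1) :=
      hHc.comp (by fun_prop) hmaps
    have hws : ContinuousOn (fun σ => w (s * σ ^ 2)) (Icc 0 1) :=
      hC2.continuousOn.comp (by fun_prop) hmaps
    have hvs : ContinuousOn (fun σ => v (s * σ ^ 2)) (Icc 0 1) :=
      hv1.continuousOn.comp (by fun_prop) hmaps
    -- The integrating factor is `σ ^ k`: from `D'(t) = t H - (k / 2) D / t` at `t = s σ²`, the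
    -- derivative of `σ ^ k D(s σ²)` is `2 s² σ ^ (k + 3) H(s σ²)`. The boundary term at `σ = 0`
    -- vanishes even for `k = 0`, because `D(0) = 0`.
    have key : ∫ σ in (0 : ℝ)..1, 2 * s ^ 2 * (σ ^ (k + 3) * H (s * σ ^ 2)) =
        1 ^ k * (1 - w (s * 1 ^ 2) + s * 1 ^ 2 * v (s * 1 ^ 2)) -
        0 ^ k * (1 - w (s * 0 ^ 2) + s * 0 ^ 2 * v (s * 0 ^ 2)) := by
      refine intervalIntegral.integral_eq_sub_of_hasDerivAt_of_le
        (f := fun σ => σ ^ k * (1 - w (s * σ ^ 2) + s * σ ^ 2 * v (s * σ ^ 2)))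
        zero_le_one ?_ ?_ ?_
      · exact (continuousOn_id.pow k).mul ((continuousOn_const.sub hws).add
          ((continuousOn_const.mul (continuousOn_id.pow 2)).mul hvs))
      · intro σ hσ
        have hσ0 : 0 < σ := hσ.1
        have ht : 0 < s * σ ^ 2 := by positivity
        have h1 : HasDerivAt (fun σ => s * σ ^ 2) (s * (2 * σ)) σ := by
          simpa using (hasDerivAt_pow 2 σ).const_mul s
        have h2 := (hwd' _ ht).comp σ h1
        have h3 := (hvd' _ ht).comp σ h1
        have h4 := (hasDerivAt_pow k σ).mul (((hasDerivAt_const σ (1 : ℝ)).sub h2).add (h1.mul h3))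
        refine h4.congr_deriv ?_
        simp only [haH _ ht, Function.comp, Pi.add_apply, Pi.sub_apply, Pi.mul_apply]
        -- For `k = 0` the subtraction in the exponent truncates, but the factor `k` kills the term.
        have hpow : (k : ℝ) * σ ^ (k - 1) = k * σ ^ k / σ := by
          rcases k with _ | k
          · simp
          · rw [pow_succ, Nat.add_sub_cancel]; field_simp
        rw [hpow]
        field_simp
        ring
      · exact (continuousOn_const.mul ((continuousOn_id.pow _).mul
          hHs)).intervalIntegrable_of_Icc zero_le_one
    rw [intervalIntegral.integral_const_mul] at key
    simp only [one_pow, mul_one, ne_eq, OfNat.ofNat_ne_zero, not_false_eq_true, zero_pow,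
      mul_zero, hw0, one_mul, zero_mul, sub_self, add_zero, sub_zero] at key
    rw [← key]
    simp only [radialAverage]
    field_simp
  have hvd : ∀ s ∈ Ici (0 : ℝ), HasDerivWithinAt v (H s - k * radialAverage (k + 3) H s) (Ici 0) s := by
    have hvw : ∀ s ∈ Ici (0 : ℝ), HasDerivWithinAt v (derivWithin v (Ici 0) s) (Ici 0) s :=
      fun s hs => (hv1.differentiableOn (by norm_num) s hs).hasDerivWithinAt
    have heq : EqOn (derivWithin v (Ici 0)) (fun s => H s - k * radialAverage (k + 3) H s)
        (Ici 0) := by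
      have hpos : EqOn (derivWithin v (Ici 0)) (fun s => H s - k * radialAverage (k + 3) H s)
          (Ioi 0) := by
        intro s hs
        have hs' : 0 < s := hs
        rw [derivWithin_of_mem_nhds (Ici_mem_nhds hs'), (hvd' s hs').deriv]
        have := hD s hs'
        simp only [haH s hs', this]
        ring
      refine hpos.of_subset_closure (hv1.continuousOn_derivWithin hu (by norm_num))
        (hHc.sub (continuousOn_const.mul (continuousOn_radialAverage _ hHc)))
        Ioi_subset_Ici_self ?_
      rw [closure_Ioi]
    intro s hs
    have := hvw s hs
    rwa [heq hs] at this
  -- Bootstrap: `H` and its averages are as regular as `v`, and `v'` is built from them.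
  have hvj : ∀ j : ℕ, ContDiffOn ℝ j v (Ici 0) := by
    intro j
    induction j with
    | zero => exact hv1.of_le (by simp)
    | succ j ih =>
      push_cast
      rw [contDiffOn_succ_iff_derivWithin hu]
      refine ⟨fun s hs => (hvd s hs).differentiableWithinAt, by simp, ?_⟩
      have hHj := (hreg j ih).2.2
      exact (hHj.sub (contDiffOn_const.mul (contDiffOn_radialAverage j (k + 3) hHj))).congr
        fun s hs => (hvd s hs).derivWithin (hu s hs)
  have hκpos : ∀ s, 0 ≤ s → 0 < -u s := by
    intro s hs
    rcases hs.eq_or_lt with rfl | hs0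
    · have : u 0 = v 0 := by
        simp [hudef, radialAverage]
      rw [this]
      linarith [hvneg 0 le_rfl]
    · have h1 := ((hprof (s + 1)).estimates hm (s := s) ⟨hs0, by linarith⟩).2.1
      have h2 := hwu s hs
      by_contra! hle
      nlinarith
  refine ⟨fun s => -v s, fun s => -(H s - k * radialAverage (k + 3) H s), fun s => -u s,
    ?_, ?_, ?_, ?_, ?_, ?_, ?_, hwpos, fun s hs => neg_pos.mpr (hvneg s hs), hκpos, ?_⟩
  · exact contDiffOn_infty.mpr fun j => (hreg j (hvj j)).1.of_le (by simp)
  · exact (contDiffOn_infty.mpr fun j => hvj j).neg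
  · exact (contDiffOn_infty.mpr fun j => (hreg j (hvj j)).2.1).neg
  · intro s hs
    simpa using hwd s hs
  · exact fun s hs => (hvd s hs).neg
  · intro s hs
    rw [hwu s hs]; ring
  · intro s hs
    rcases hs.eq_or_lt with rfl | hs0
    · have : u 0 = v 0 := by
        simp [hudef, radialAverage]
      simp [this, hw0]
      ring
    · have h1 := hode s hs0
      have h2 : H s - k * radialAverage (k + 3) H s = a s := by
        have := hD s hs0
        rw [haH s hs0, this]; ring
      rw [h2]
      have h3 := hwu s hs
      have : s * (4 * s * w s * -a s) =
          s * (2 * k * w s * -u s - -v s * (2 * s * -v s + s + 2 * k)) := by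
        have h4 : s * u s = w s - 1 := by linarith
        linear_combination (-1 : ℝ) * h1 + 2 * k * w s * h4
      exact mul_left_cancel₀ hs0.ne' this
  · exact ⟨profileBound k (v 0), profileBound_pos hm (hvneg 0 le_rfl), fun s hs =>
      ((hprof (s + 1)).estimates hm (s := s) ⟨hs, by linarith⟩).1⟩

end IsBryantSolution

/-! ### Partial derivatives -/

variable {n : ℕ}

/-- `f` is differentiable at `x` with partial derivatives `d`. -/
def HasPDeriv (f : E n → ℝ) (d : Fin n → ℝ) (x : E n) : Prop :=
  DifferentiableAt ℝ f x ∧ ∀ i, pderiv i f x = d i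

namespace HasPDeriv

variable {f g : E n → ℝ} {d e : Fin n → ℝ} {x : E n}

theorem congr_deriv (hf : HasPDeriv f d x) (h : ∀ i, d i = e i) : HasPDeriv f e x :=
  ⟨hf.1, fun i => (hf.2 i).trans (h i)⟩

theorem congr_of_eventuallyEq (hf : HasPDeriv f d x) (h : g =ᶠ[𝓝 x] f) : HasPDeriv g d x :=
  ⟨hf.1.congr_of_eventuallyEq h, fun i => by rw [← hf.2 i, pderiv, pderiv, h.fderiv_eq]⟩

theorem const (c : ℝ) (x : E n) : HasPDeriv (fun _ => c) (fun _ => 0) x :=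
  ⟨differentiableAt_const c, fun i => by simp [pderiv]⟩

theorem add (hf : HasPDeriv f d x) (hg : HasPDeriv g e x) :
    HasPDeriv (fun y => f y + g y) (fun i => d i + e i) x :=
  ⟨hf.1.add hg.1, fun i => by
    rw [pderiv, fderiv_fun_add hf.1 hg.1]
    simp [← hf.2, ← hg.2, pderiv]⟩

theorem mul (hf : HasPDeriv f d x) (hg : HasPDeriv g e x) :
    HasPDeriv (fun y => f y * g y) (fun i => d i * g x + f x * e i) x :=
  ⟨hf.1.mul hg.1, fun i => by
    rw [pderiv, fderiv_fun_mul hf.1 hg.1]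
    simp [← hf.2, ← hg.2, pderiv]
    ring⟩

theorem const_mul (c : ℝ) (hf : HasPDeriv f d x) :
    HasPDeriv (fun y => c * f y) (fun i => c * d i) x :=
  ((const c x).mul hf).congr_deriv fun i => by ring

theorem coord (k : Fin n) (x : E n) :
    HasPDeriv (fun y => y k) (fun i => if i = k then 1 else 0) x := by
  have h : HasFDerivAt (fun y : E n => y k) (EuclideanSpace.proj k : E n →L[ℝ] ℝ) x :=
    (EuclideanSpace.proj k : E n →L[ℝ] ℝ).hasFDerivAt
  refine ⟨h.differentiableAt, fun i => ?_⟩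
  rw [pderiv, h.fderiv]
  simp [PiLp.single_apply, eq_comm]

theorem sum {ι : Type*} (s : Finset ι) {f : ι → E n → ℝ} {d : ι → Fin n → ℝ}
    (h : ∀ a ∈ s, HasPDeriv (f a) (d a) x) :
    HasPDeriv (fun y => ∑ a ∈ s, f a y) (fun i => ∑ a ∈ s, d a i) x := by
  classical
  induction s using Finset.induction_on with
  | empty => simpa using const 0 x
  | insert a s ha ih =>
    simp only [Finset.sum_insert ha]
    exact (h a (Finset.mem_insert_self a s)).add (ih fun b hb => h b (Finset.mem_insert_of_mem hb))

/-- The chain rule for functions of `|x|²`; one-sided derivatives at `0` are enough. -/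
theorem radial {φ : ℝ → ℝ} {φ' : ℝ} (h : HasDerivWithinAt φ φ' (Ici 0) (‖x‖ ^ 2)) :
    HasPDeriv (fun y => φ (‖y‖ ^ 2)) (fun i => 2 * x i * φ') x := by
  have h1 : HasFDerivAt (fun y : E n => ‖y‖ ^ 2) (2 • innerSL ℝ x) x :=
    (hasStrictFDerivAt_norm_sq x).hasFDerivAt
  have h2 := h.comp_hasFDerivWithinAt (s := univ) x h1.hasFDerivWithinAt
    fun y _ => mem_Ici.mpr (sq_nonneg ‖y‖)
  rw [hasFDerivWithinAt_univ] at h2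
  refine ⟨h2.differentiableAt, fun i => ?_⟩
  have : fderiv ℝ (fun y : E n => φ (‖y‖ ^ 2)) x = φ' • 2 • innerSL ℝ x := h2.fderiv
  rw [pderiv, this]
  simp [EuclideanSpace.inner_single_right]
  ring

end HasPDeriv

theorem sum_mul_self (x : E n) : ∑ i, x i * x i = ‖x‖ ^ 2 := by
  rw [EuclideanSpace.norm_sq_eq]
  exact Finset.sum_congr rfl fun i _ => by rw [Real.norm_eq_abs, sq_abs, sq]

/-! ### Rotationally symmetric metrics -/

/-- The metric `|dx|² + φ(|x|²) (x · dx)²`. -/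
def radialMetric (φ : ℝ → ℝ) (x : E n) : Matrix (Fin n) (Fin n) ℝ :=
  Matrix.of fun i j => (if i = j then 1 else 0) + φ (‖x‖ ^ 2) * (x i * x j)

/-- Inversion of a rank-one perturbation of the identity; `hκ` is the scalar condition it needs. The
factor `c` is there for the conical metrics. -/
theorem inv_radialMetric {φ : ℝ → ℝ} {x : E n} {c κ : ℝ} (hc : c ≠ 0)
    (hκ : κ * (1 + ‖x‖ ^ 2 * φ (‖x‖ ^ 2)) = φ (‖x‖ ^ 2)) :
    (c • radialMetric φ x)⁻¹ =
      c⁻¹ • Matrix.of fun i j => (if i = j then 1 else 0) - κ * (x i * x j) := by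
  refine Matrix.inv_eq_right_inv ?_
  rw [Matrix.smul_mul, Matrix.mul_smul, smul_smul, mul_inv_cancel₀ hc, one_smul]
  ext i j
  have h1 : ∀ k, ((if i = k then 1 else 0) + φ (‖x‖ ^ 2) * (x i * x k)) *
      ((if k = j then 1 else 0) - κ * (x k * x j)) =
      (if i = k then (if k = j then 1 else 0) - κ * (x k * x j) else 0) +
      (if k = j then φ (‖x‖ ^ 2) * (x i * x k) else 0) -
      φ (‖x‖ ^ 2) * κ * x i * x j * (x k * x k) := by
    intro k
    split_ifs <;> ring
  simp only [Matrix.mul_apply, radialMetric, Matrix.of_apply, h1, Finset.sum_sub_distrib,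
    Finset.sum_add_distrib, Finset.sum_ite_eq, Finset.sum_ite_eq', Finset.mem_univ, if_true,
    ← Finset.mul_sum, sum_mul_self, Matrix.one_apply]
  linear_combination (-(x i * x j)) * hκ

theorem HasPDeriv.radialMetric {φ : ℝ → ℝ} {φ' : ℝ} {x : E n}
    (h : HasDerivWithinAt φ φ' (Ici 0) (‖x‖ ^ 2)) (i j : Fin n) :
    HasPDeriv (fun y => radialMetric φ y i j) (fun l => 2 * φ' * (x l * x i * x j) +
      φ (‖x‖ ^ 2) * ((if l = i then 1 else 0) * x j + x i * (if l = j then 1 else 0))) x :=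
  ((HasPDeriv.const _ x).add ((HasPDeriv.radial h).mul
    ((HasPDeriv.coord i x).mul (HasPDeriv.coord j x)))).congr_deriv fun l => by ring

/-- Serves both the soliton metric (`c = 1`) and the cone (`c = 1 - α`). Equality is only asked near
`x`, as the cone has this form only off the origin. -/
theorem christoffel_of_eventuallyEq {g : E n → Matrix (Fin n) (Fin n) ℝ} {φ : ℝ → ℝ}
    {x : E n} {c κ φ' : ℝ} (hc : c ≠ 0) (hg : g =ᶠ[𝓝 x] fun y => c • radialMetric φ y)
    (hκ : κ * (1 + ‖x‖ ^ 2 * φ (‖x‖ ^ 2)) = φ (‖x‖ ^ 2))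
    (h : HasDerivWithinAt φ φ' (Ici 0) (‖x‖ ^ 2)) (k i j : Fin n) :
    christoffel g x k i j = x k * (κ * (if i = j then 1 else 0) +
      (1 - ‖x‖ ^ 2 * κ) * φ' * (x i * x j)) := by
  have hd : ∀ i j, HasPDeriv (fun y => g y i j) (fun l => c * (2 * φ' * (x l * x i * x j) +
      φ (‖x‖ ^ 2) * ((if l = i then 1 else 0) * x j + x i * (if l = j then 1 else 0)))) x := by
    intro i j
    refine ((HasPDeriv.radialMetric h i j).const_mul c).congr_of_eventuallyEq ?_
    filter_upwards [hg] with y hy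
    rw [hy]; rfl
  have h1 : ∀ l, c * (2 * φ' * (x i * x j * x l) +
      φ (‖x‖ ^ 2) * ((if i = j then 1 else 0) * x l + x j * (if i = l then 1 else 0))) +
      c * (2 * φ' * (x j * x i * x l) +
      φ (‖x‖ ^ 2) * ((if j = i then 1 else 0) * x l + x i * (if j = l then 1 else 0))) -
      c * (2 * φ' * (x l * x i * x j) +
      φ (‖x‖ ^ 2) * ((if l = i then 1 else 0) * x j + x i * (if l = j then 1 else 0))) =
      2 * c * x l * (φ' * (x i * x j) + φ (‖x‖ ^ 2) * (if i = j then 1 else 0)) := by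
    intro l
    rw [if_congr (eq_comm (a := j) (b := i)) rfl rfl, if_congr (eq_comm (a := l) (b := i)) rfl rfl,
      if_congr (eq_comm (a := l) (b := j)) rfl rfl]
    ring
  have h2 : ∀ l, c⁻¹ * ((if k = l then 1 else 0) - κ * (x k * x l)) *
      (2 * c * x l * (φ' * (x i * x j) + φ (‖x‖ ^ 2) * (if i = j then 1 else 0))) =
      2 * (φ' * (x i * x j) + φ (‖x‖ ^ 2) * (if i = j then 1 else 0)) *
        (if k = l then x l else 0) -
      2 * (φ' * (x i * x j) + φ (‖x‖ ^ 2) * (if i = j then 1 else 0)) * κ * x k * (x l * x l) := by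
    intro l
    have : ∀ t : ℝ, c⁻¹ * t * (2 * c * x l * (φ' * (x i * x j) +
        φ (‖x‖ ^ 2) * (if i = j then 1 else 0))) = 2 * t * x l * (φ' * (x i * x j) +
        φ (‖x‖ ^ 2) * (if i = j then 1 else 0)) := fun t => by field_simp
    rw [this]
    split_ifs <;> ring
  unfold christoffel
  simp only [(hd _ _).2, h1]
  rw [hg.eq_of_nhds, inv_radialMetric hc hκ]
  simp only [Matrix.smul_apply, Matrix.of_apply, smul_eq_mul, h2, Finset.sum_sub_distrib,
    ← Finset.mul_sum, sum_mul_self, Finset.sum_ite_eq, Finset.mem_univ, if_true]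
  linear_combination (-(x k * (if i = j then 1 else 0))) * hκ

/-! ### Curvature of the soliton metric -/

namespace IsSmoothProfile

variable {m : ℝ} {w p q κ : ℝ → ℝ}

/-- The derivative of the tangential curvature. -/
theorem deriv_κ (h : IsSmoothProfile m w p q κ) {s : ℝ} (hs : 0 ≤ s) :
    HasDerivWithinAt κ (derivWithin κ (Ici 0) s) (Ici 0) s :=
  (h.smooth_κ.differentiableOn (by simp) s hs).hasDerivWithinAt

theorem radial_eq (h : IsSmoothProfile m w p q κ) {s : ℝ} (hs : 0 ≤ s) :
    p s = κ s + s * derivWithin κ (Ici 0) s := by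
  have h1 : HasDerivWithinAt (fun s => 1 - w s) (p s) (Ici 0) s := by
    simpa using (h.deriv_w s hs).const_sub 1
  have h2 : HasDerivWithinAt (fun s => 1 - w s) (1 * κ s + s * derivWithin κ (Ici 0) s)
      (Ici 0) s :=
    ((hasDerivWithinAt_id s _).mul (h.deriv_κ hs)).congr (fun t ht => h.eq_κ t ht) (h.eq_κ s hs)
  have := (uniqueDiffOn_Ici 0 s hs).eq_deriv _ h1 h2
  rw [this, one_mul]

/-- The coefficient of `x_i x_j` is `1 / (s w) - 1 / s = κ / w`, which has no singularity at the
origin. -/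
theorem warpedMetric_eq (h : IsSmoothProfile m w p q κ) :
    warpedMetric w = radialMetric (n := n) fun s => κ s / w s := by
  ext x i j
  have hs := sq_nonneg ‖x‖
  have hw := h.w_pos _ hs
  have he := h.eq_κ _ hs
  simp only [warpedMetric, sphereForm, radialForm, radialMetric, Matrix.add_apply,
    Matrix.smul_apply, Matrix.sub_apply, Matrix.of_apply, Matrix.one_apply, smul_eq_mul]
  rcases eq_or_ne x 0 with rfl | hx
  · simp
  · have hx' : ‖x‖ ≠ 0 := norm_ne_zero_iff.mpr hx
    field_simp
    linear_combination (x i * x j) * he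

/-- For `φ = κ / w` one has `1 + s φ = 1 / w`, so the coefficient in the inverse metric is `κ`
itself. -/
theorem inverse_identity (h : IsSmoothProfile m w p q κ) {s : ℝ} (hs : 0 ≤ s) :
    κ s * (1 + s * (κ s / w s)) = κ s / w s := by
  have hw := (h.w_pos s hs).ne'
  have he := h.eq_κ s hs
  field_simp
  linear_combination (-κ s) * he

theorem deriv_φ (h : IsSmoothProfile m w p q κ) {s : ℝ} (hs : 0 ≤ s) :
    HasDerivWithinAt (fun s => κ s / w s) ((derivWithin κ (Ici 0) s + κ s ^ 2) / w s ^ 2)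
      (Ici 0) s := by
  refine ((h.deriv_κ hs).div (h.deriv_w s hs) (h.w_pos s hs).ne').congr_deriv ?_
  have hw := (h.w_pos s hs).ne'
  have he := h.eq_κ s hs
  have hr := h.radial_eq hs
  rw [hr]
  field_simp
  linear_combination (-derivWithin κ (Ici 0) s) * he

/-- The coefficient of `x_k x_i x_j` in the Christoffel symbols. -/
def mu (w κ : ℝ → ℝ) (s : ℝ) : ℝ := (derivWithin κ (Ici 0) s + κ s ^ 2) / w s

theorem christoffel_warpedMetric (h : IsSmoothProfile m w p q κ) (x : E n) (k i j : Fin n) :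
    christoffel (warpedMetric w) x k i j = x k * (κ (‖x‖ ^ 2) * (if i = j then 1 else 0) +
      mu w κ (‖x‖ ^ 2) * (x i * x j)) := by
  have hs := sq_nonneg ‖x‖
  rw [christoffel_of_eventuallyEq (c := 1) (φ := fun s => κ s / w s) one_ne_zero ?_
    (h.inverse_identity hs) (h.deriv_φ hs)]
  · have he := h.eq_κ _ hs
    have hw := (h.w_pos _ hs).ne'
    rw [← he, sub_sub_cancel, mu]
    field_simp
  · rw [h.warpedMetric_eq]
    simp

theorem smooth_dκ (h : IsSmoothProfile m w p q κ) :
    ContDiffOn ℝ ∞ (derivWithin κ (Ici 0)) (Ici 0) :=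
  ((contDiffOn_infty_iff_derivWithin (uniqueDiffOn_Ici 0)).mp h.smooth_κ).2

theorem smooth_mu (h : IsSmoothProfile m w p q κ) : ContDiffOn ℝ ∞ (mu w κ) (Ici 0) :=
  (h.smooth_dκ.add (h.smooth_κ.pow 2)).div h.smooth_w fun s hs => (h.w_pos s hs).ne'

theorem riemann_warpedMetric (h : IsSmoothProfile m w p q κ) (x : E n) (l i j k : Fin n) :
    riemann (warpedMetric w) x l i j k =
      κ (‖x‖ ^ 2) * ((if i = l then 1 else 0) * (if j = k then 1 else 0) -
        (if j = l then 1 else 0) * (if i = k then 1 else 0)) +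
      mu w κ (‖x‖ ^ 2) * x k * ((if i = l then 1 else 0) * x j - (if j = l then 1 else 0) * x i) +
      derivWithin κ (Ici 0) (‖x‖ ^ 2) * x l *
        (x i * (if j = k then 1 else 0) - x j * (if i = k then 1 else 0)) := by
  have hs := sq_nonneg ‖x‖
  have hκ := h.deriv_κ hs
  have hμ := (h.smooth_mu.differentiableOn (by simp) _ hs).hasDerivWithinAt
  set s := ‖x‖ ^ 2 with hsdef
  set κ1 := derivWithin κ (Ici 0) s
  set μ1 := derivWithin (mu w κ) (Ici 0) s
  set μ := mu w κ s with hμdef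
  have hd : ∀ l j k, HasPDeriv (fun y => christoffel (warpedMetric w) y l j k)
      (fun i => (if i = l then 1 else 0) * (κ s * (if j = k then 1 else 0) + μ * (x j * x k)) +
        x l * (2 * x i * κ1 * (if j = k then 1 else 0) + (2 * x i * μ1 * (x j * x k) +
          μ * ((if i = j then 1 else 0) * x k + x j * (if i = k then 1 else 0))))) x := by
    intro l j k
    simp only [h.christoffel_warpedMetric]
    exact ((HasPDeriv.coord l x).mul (((HasPDeriv.radial hκ).mul (HasPDeriv.const _ x)).add
      ((HasPDeriv.radial hμ).mul ((HasPDeriv.coord j x).mul (HasPDeriv.coord k x))))).congr_deriv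
      fun i => by ring
  have hsum : ∀ m, x l * (κ s * (if i = m then 1 else 0) + μ * (x i * x m)) *
      (x m * (κ s * (if j = k then 1 else 0) + μ * (x j * x k))) -
      x l * (κ s * (if j = m then 1 else 0) + μ * (x j * x m)) *
      (x m * (κ s * (if i = k then 1 else 0) + μ * (x i * x k))) =
      x l * (κ s * (if j = k then 1 else 0) + μ * (x j * x k)) * κ s *
        (if i = m then x m else 0) +
      x l * (κ s * (if j = k then 1 else 0) + μ * (x j * x k)) * μ * x i * (x m * x m) -
      x l * (κ s * (if i = k then 1 else 0) + μ * (x i * x k)) * κ s *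
        (if j = m then x m else 0) -
      x l * (κ s * (if i = k then 1 else 0) + μ * (x i * x k)) * μ * x j * (x m * x m) := by
    intro m
    split_ifs <;> ring
  -- From `μ w = κ' + κ²` and `w = 1 - s κ`. The terms with `μ'` are symmetric in `i`, `j` and
  -- cancel in the curvature.
  have hrel : 2 * κ1 - μ + κ s ^ 2 + κ s * μ * s = κ1 := by
    have he := h.eq_κ s hs
    have hw := (h.w_pos s hs).ne'
    have hμw : μ * w s = κ1 + κ s ^ 2 := by
      rw [hμdef, mu, div_mul_cancel₀ _ hw]
    linear_combination (-μ) * he - hμw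
  unfold riemann
  simp only [(hd _ _ _).2]
  simp only [h.christoffel_warpedMetric, hsum, Finset.sum_sub_distrib,
    Finset.sum_add_distrib, ← Finset.mul_sum, sum_mul_self, Finset.sum_ite_eq, Finset.mem_univ,
    if_true, ← hsdef, ← hμdef]
  rw [if_congr (eq_comm (a := j) (b := i)) rfl rfl]
  linear_combination x l * (x i * (if j = k then 1 else 0) - x j * (if i = k then 1 else 0)) * hrel

theorem ricci_warpedMetric (h : IsSmoothProfile m w p q κ) (x : E n) (j k : Fin n) :
    ricci (warpedMetric w) x j k =
      ((n : ℝ) - 1) * (κ (‖x‖ ^ 2) * (if j = k then 1 else 0) + mu w κ (‖x‖ ^ 2) * (x j * x k)) +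
      derivWithin κ (Ici 0) (‖x‖ ^ 2) *
        (‖x‖ ^ 2 * (if j = k then 1 else 0) - x j * x k) := by
  have h1 : ∀ i, riemann (warpedMetric w) x i i j k =
      κ (‖x‖ ^ 2) * (if j = k then 1 else 0) + mu w κ (‖x‖ ^ 2) * (x j * x k) -
      (if j = i then κ (‖x‖ ^ 2) * (if i = k then 1 else 0) + mu w κ (‖x‖ ^ 2) * (x i * x k) else 0) +
      derivWithin κ (Ici 0) (‖x‖ ^ 2) * (if j = k then 1 else 0) * (x i * x i) -
      (if i = k then derivWithin κ (Ici 0) (‖x‖ ^ 2) * x j * x i else 0) := by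
    intro i
    rw [h.riemann_warpedMetric]
    simp only [if_true]
    split_ifs <;> ring
  unfold ricci
  simp only [h1, Finset.sum_sub_distrib, Finset.sum_add_distrib, ← Finset.mul_sum, sum_mul_self,
    Finset.sum_ite_eq, Finset.sum_ite_eq', Finset.mem_univ, if_true, Finset.sum_const,
    Finset.card_univ, Fintype.card_fin, nsmul_eq_mul]
  ring

theorem inv_warpedMetric (h : IsSmoothProfile m w p q κ) (x : E n) :
    (warpedMetric w x)⁻¹ =
      Matrix.of fun i j => (if i = j then 1 else 0) - κ (‖x‖ ^ 2) * (x i * x j) := by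
  have := inv_radialMetric (c := 1) (φ := fun s => κ s / w s) (x := x) one_ne_zero
    (h.inverse_identity (sq_nonneg ‖x‖))
  rw [h.warpedMetric_eq]
  simpa using this

/-- Twice the sum of the sectional curvatures of a frame adapted to the radial direction: `n - 1`
planes of curvature `p`, all others of curvature `κ`. -/
theorem scalarCurvature_warpedMetric (h : IsSmoothProfile m w p q κ) (x : E n) :
    scalarCurvature (warpedMetric w) x =
      ((n : ℝ) - 1) * (((n : ℝ) - 2) * κ (‖x‖ ^ 2) + 2 * p (‖x‖ ^ 2)) := by
  have hs := sq_nonneg ‖x‖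
  set s := ‖x‖ ^ 2 with hsdef
  set κ1 := derivWithin κ (Ici 0) s with hκ1
  set μ := mu w κ s with hμdef
  have h1 : ∀ j, ∑ k, (warpedMetric w x)⁻¹ j k * ricci (warpedMetric w) x j k =
      ((n : ℝ) - 1) * κ s + κ1 * s +
      (((n : ℝ) - 1) * μ - κ1 - κ s * (((n : ℝ) - 1) * κ s + κ1 * s) -
      κ s * s * (((n : ℝ) - 1) * μ - κ1)) * (x j * x j) := by
    intro j
    rw [h.inv_warpedMetric]
    simp only [h.ricci_warpedMetric, ← hsdef, ← hκ1, ← hμdef, Matrix.of_apply]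
    have h2 : ∀ k, ((if j = k then 1 else 0) - κ s * (x j * x k)) *
        (((n : ℝ) - 1) * (κ s * (if j = k then 1 else 0) + μ * (x j * x k)) +
          κ1 * (s * (if j = k then 1 else 0) - x j * x k)) =
        (if j = k then ((n : ℝ) - 1) * κ s + κ1 * s + (((n : ℝ) - 1) * μ - κ1) * (x j * x k) -
          κ s * (x j * x k) * (((n : ℝ) - 1) * κ s + κ1 * s) else 0) -
        κ s * (((n : ℝ) - 1) * μ - κ1) * (x j * x j) * (x k * x k) := by
      intro k
      split_ifs <;> ring
    simp only [h2, Finset.sum_sub_distrib, ← Finset.mul_sum, sum_mul_self, Finset.sum_ite_eq,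
      Finset.mem_univ, if_true, ← hsdef]
    ring
  unfold scalarCurvature
  simp only [h1, Finset.sum_add_distrib, ← Finset.mul_sum, sum_mul_self, Finset.sum_const,
    Finset.card_univ, Fintype.card_fin, nsmul_eq_mul, ← hsdef]
  have he := h.eq_κ s hs
  have hr := h.radial_eq hs
  have hw := (h.w_pos s hs).ne'
  have hμw : μ * w s = κ1 + κ s ^ 2 := by
    rw [hμdef, mu, div_mul_cancel₀ _ hw]
  rw [hr]
  linear_combination ((n : ℝ) - 1) * s * μ * he + ((n : ℝ) - 1) * s * hμw

end IsSmoothProfile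

/-! ### Contractions and Gram determinants -/

theorem sum_mul_eq_inner (u v : E n) : ∑ i, u i * v i = inner ℝ u v := by
  simp [PiLp.inner_apply, mul_comm]

theorem sum_radialMetric_mul (φ : ℝ → ℝ) (x u : E n) (l : Fin n) :
    ∑ k, radialMetric φ x l k * u k = u l + φ (‖x‖ ^ 2) * inner ℝ x u * x l := by
  have h : ∀ k, ((if l = k then 1 else 0) + φ (‖x‖ ^ 2) * (x l * x k)) * u k =
      (if l = k then u k else 0) + φ (‖x‖ ^ 2) * x l * (x k * u k) := by
    intro k
    split_ifs <;> ring
  simp only [radialMetric, Matrix.of_apply, h, Finset.sum_add_distrib, ← Finset.mul_sum,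
    sum_mul_eq_inner, Finset.sum_ite_eq, Finset.mem_univ, if_true]
  ring

theorem metricInner_radialMetric (φ : ℝ → ℝ) (x u v : E n) :
    metricInner (radialMetric φ) x u v =
      inner ℝ u v + φ (‖x‖ ^ 2) * (inner ℝ x u * inner ℝ x v) := by
  have h : ∀ i, ∑ j, radialMetric φ x i j * u i * v j =
      u i * v i + φ (‖x‖ ^ 2) * inner ℝ x v * (x i * u i) := by
    intro i
    calc ∑ j, radialMetric φ x i j * u i * v j = u i * ∑ j, radialMetric φ x i j * v j := by
          rw [Finset.mul_sum]; exact Finset.sum_congr rfl fun j _ => by ring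
      _ = _ := by rw [sum_radialMetric_mul]; ring
  simp only [metricInner, h, Finset.sum_add_distrib, ← Finset.mul_sum, sum_mul_eq_inner]
  ring

theorem contDiff_comp_normSq {φ : ℝ → ℝ} (h : ContDiffOn ℝ ∞ φ (Ici 0)) :
    ContDiff ℝ ∞ fun x : E n => φ (‖x‖ ^ 2) :=
  contDiffOn_univ.mp (h.comp (contDiff_norm_sq ℝ).contDiffOn fun x _ => sq_nonneg ‖x‖)

theorem contDiff_coord (i : Fin n) : ContDiff ℝ ∞ fun x : E n => x i :=
  (EuclideanSpace.proj i : E n →L[ℝ] ℝ).contDiff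

section Gram

variable (x u v : E n)

/-- The Gram determinant `|u|² |v|² - (u · v)²`. -/
def gram (u v : E n) : ℝ := inner ℝ u u * inner ℝ v v - inner ℝ u v ^ 2

/-- The quantity `|(x · v) u - (x · u) v|²`. -/
def radialPart (x u v : E n) : ℝ :=
  inner ℝ x v ^ 2 * inner ℝ u u - 2 * inner ℝ x u * inner ℝ x v * inner ℝ u v +
    inner ℝ x u ^ 2 * inner ℝ v v

theorem radialPart_nonneg : 0 ≤ radialPart x u v := by
  have h := real_inner_self_nonneg (x := inner ℝ x v • u - (inner ℝ x u : ℝ) • v)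
  simp only [inner_sub_left, inner_sub_right, real_inner_smul_left, real_inner_smul_right] at h
  rw [real_inner_comm u v] at h
  unfold radialPart
  linarith

variable {u v}

theorem gram_pos (h : LinearIndependent ℝ ![u, v]) : 0 < gram u v := by
  rw [LinearIndependent.pair_iff] at h
  have hv : 0 < (inner ℝ v v : ℝ) := by
    rw [real_inner_self_pos]
    rintro rfl
    simpa using h 0 1 (by simp)
  have hz : 0 < (inner ℝ ((inner ℝ v v : ℝ) • u + (-inner ℝ u v : ℝ) • v)
      ((inner ℝ v v : ℝ) • u + (-inner ℝ u v : ℝ) • v) : ℝ) := by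
    rw [real_inner_self_pos]
    intro h0
    exact hv.ne' (h _ _ h0).1
  simp only [inner_add_left, inner_add_right, real_inner_smul_left, real_inner_smul_right] at hz
  rw [real_inner_comm u v] at hz
  have : 0 < inner ℝ v v * gram u v := by
    unfold gram
    linarith
  exact (pos_iff_pos_of_mul_pos this).mp hv

/-- Up to a factor `gram u v`, the difference of the two sides is the squared norm of `gram u v`
times the component of `x` orthogonal to the plane of `u` and `v`. -/
theorem radialPart_le (h : 0 < gram u v) : radialPart x u v ≤ ‖x‖ ^ 2 * gram u v := by
  have hz := real_inner_self_nonneg (x := gram u v • x +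
    (inner ℝ x v * inner ℝ u v - inner ℝ x u * inner ℝ v v : ℝ) • u +
    (inner ℝ x u * inner ℝ u v - inner ℝ x v * inner ℝ u u : ℝ) • v)
  simp only [inner_add_left, inner_add_right, real_inner_smul_left, real_inner_smul_right] at hz
  rw [real_inner_comm u v, real_inner_comm x v, real_inner_comm x u,
    real_inner_self_eq_norm_sq x] at hz
  have : 0 ≤ gram u v * (‖x‖ ^ 2 * gram u v - radialPart x u v) := by
    refine hz.trans_eq ?_
    unfold radialPart gram
    ring
  linarith [nonneg_of_mul_nonneg_right this h]

end Gram

/-! ### Positive sectional curvature, smoothness and definiteness of the metric -/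

namespace IsSmoothProfile

variable {m : ℝ} {w p q κ : ℝ → ℝ}

theorem φ_nonneg (h : IsSmoothProfile m w p q κ) {s : ℝ} (hs : 0 ≤ s) : 0 ≤ κ s / w s :=
  div_nonneg (h.κ_pos s hs).le (h.w_pos s hs).le

theorem mu_mul (h : IsSmoothProfile m w p q κ) {s : ℝ} (hs : 0 ≤ s) :
    mu w κ s * w s = derivWithin κ (Ici 0) s + κ s ^ 2 := by
  rw [mu, div_mul_cancel₀ _ (h.w_pos s hs).ne']

theorem sectional_numerator (h : IsSmoothProfile m w p q κ) (x u v : E n) :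
    ∑ i, ∑ j, ∑ k, ∑ l, ∑ m, riemann (warpedMetric w) x l i j k * warpedMetric w x l m *
      u i * v j * v k * u m =
    κ (‖x‖ ^ 2) * gram u v + mu w κ (‖x‖ ^ 2) * radialPart x u v := by
  have hs := sq_nonneg ‖x‖
  set s := ‖x‖ ^ 2 with hsdef
  set κ1 := derivWithin κ (Ici 0) s with hκ1
  set μ := mu w κ s with hμdef
  set φ := κ s / w s with hφ
  set X : ℝ := inner ℝ x u with hX
  set Y : ℝ := inner ℝ x v with hY
  -- The covector metrically dual to `u`. With it the five sums are contracted one index at a time.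
  set U : Fin n → ℝ := fun l => u l + φ * X * x l with hU
  have h1 : ∀ i j k l, ∑ m, riemann (warpedMetric w) x l i j k * warpedMetric w x l m *
      u i * v j * v k * u m = riemann (warpedMetric w) x l i j k * u i * v j * v k * U l := by
    intro i j k l
    calc _ = ∑ m, riemann (warpedMetric w) x l i j k * u i * v j * v k *
          (warpedMetric w x l m * u m) := Finset.sum_congr rfl fun m _ => by ring
      _ = _ := by rw [← Finset.mul_sum, h.warpedMetric_eq, sum_radialMetric_mul]
  have hxU : ∑ l, x l * U l = X * (1 + φ * s) := by
    have : ∀ l, x l * U l = x l * u l + φ * X * (x l * x l) := fun l => by simp only [hU]; ring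
    simp only [this, Finset.sum_add_distrib, ← Finset.mul_sum, sum_mul_eq_inner,
      real_inner_self_eq_norm_sq]
    ring
  have hUv : ∑ l, U l * v l = inner ℝ u v + φ * X * Y := by
    have : ∀ l, U l * v l = u l * v l + φ * X * (x l * v l) := fun l => by simp only [hU]; ring
    simp only [this, Finset.sum_add_distrib, ← Finset.mul_sum, sum_mul_eq_inner]
    rfl
  have hUu : ∑ l, U l * u l = inner ℝ u u + φ * X * X := by
    have : ∀ l, U l * u l = u l * u l + φ * X * (x l * u l) := fun l => by simp only [hU]; ring
    simp only [this, Finset.sum_add_distrib, ← Finset.mul_sum, sum_mul_eq_inner]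
    rfl
  have h2 : ∀ i j k, ∑ l, riemann (warpedMetric w) x l i j k * u i * v j * v k * U l =
      u i * v j * v k * (κ s * (U i * (if j = k then 1 else 0) - U j * (if i = k then 1 else 0)) +
        μ * x k * (U i * x j - U j * x i) + κ1 * (X * (1 + φ * s)) *
          (x i * (if j = k then 1 else 0) - x j * (if i = k then 1 else 0))) := by
    intro i j k
    have : ∀ l, riemann (warpedMetric w) x l i j k * u i * v j * v k * U l =
        u i * v j * v k * ((if i = l then
          U l * (κ s * (if j = k then 1 else 0) + μ * x k * x j) else 0) -
        (if j = l then U l * (κ s * (if i = k then 1 else 0) + μ * x k * x i) else 0) +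
        κ1 * (x i * (if j = k then 1 else 0) - x j * (if i = k then 1 else 0)) *
          (x l * U l)) := by
      intro l
      rw [h.riemann_warpedMetric]
      simp only [← hsdef, ← hκ1, ← hμdef]
      generalize (if j = k then (1 : ℝ) else 0) = a
      generalize (if i = k then (1 : ℝ) else 0) = b
      split_ifs <;> ring
    simp only [this, Finset.sum_add_distrib, Finset.sum_sub_distrib, ← Finset.mul_sum, hxU,
      Finset.sum_ite_eq, Finset.mem_univ, if_true]
    ring
  have h3 : ∀ i j, ∑ k, u i * v j * v k *
      (κ s * (U i * (if j = k then 1 else 0) - U j * (if i = k then 1 else 0)) +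
        μ * x k * (U i * x j - U j * x i) + κ1 * (X * (1 + φ * s)) *
          (x i * (if j = k then 1 else 0) - x j * (if i = k then 1 else 0))) =
      u i * v j * (κ s * (U i * v j - U j * v i) + μ * Y * (U i * x j - U j * x i) +
        κ1 * (X * (1 + φ * s)) * (x i * v j - x j * v i)) := by
    intro i j
    have : ∀ k, u i * v j * v k *
      (κ s * (U i * (if j = k then 1 else 0) - U j * (if i = k then 1 else 0)) +
        μ * x k * (U i * x j - U j * x i) + κ1 * (X * (1 + φ * s)) *
          (x i * (if j = k then 1 else 0) - x j * (if i = k then 1 else 0))) =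
      u i * v j * ((κ s * U i + κ1 * (X * (1 + φ * s)) * x i) * (if j = k then v k else 0) -
        (κ s * U j + κ1 * (X * (1 + φ * s)) * x j) * (if i = k then v k else 0) +
        μ * (U i * x j - U j * x i) * (x k * v k)) := by
      intro k
      split_ifs <;> ring
    simp only [this, Finset.sum_add_distrib, Finset.sum_sub_distrib, ← Finset.mul_sum,
      sum_mul_eq_inner, Finset.sum_ite_eq, Finset.mem_univ, if_true]
    ring
  have h4 : ∀ i, ∑ j, u i * v j * (κ s * (U i * v j - U j * v i) +
      μ * Y * (U i * x j - U j * x i) + κ1 * (X * (1 + φ * s)) * (x i * v j - x j * v i)) =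
      u i * (κ s * (U i * inner ℝ v v - (inner ℝ u v + φ * X * Y) * v i) +
        μ * Y * (U i * Y - (inner ℝ u v + φ * X * Y) * x i) +
        κ1 * (X * (1 + φ * s)) * (x i * inner ℝ v v - Y * v i)) := by
    intro i
    have : ∀ j, u i * v j * (κ s * (U i * v j - U j * v i) +
      μ * Y * (U i * x j - U j * x i) + κ1 * (X * (1 + φ * s)) * (x i * v j - x j * v i)) =
      u i * ((κ s * U i + κ1 * (X * (1 + φ * s)) * x i) * (v j * v j) +
        (μ * Y * U i - κ1 * (X * (1 + φ * s)) * v i) * (x j * v j) -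
        (κ s * v i + μ * Y * x i) * (U j * v j)) := fun j => by ring
    simp only [this, Finset.sum_add_distrib, Finset.sum_sub_distrib, ← Finset.mul_sum,
      sum_mul_eq_inner, hUv]
    ring
  have h5 : ∀ i, u i * (κ s * (U i * inner ℝ v v - (inner ℝ u v + φ * X * Y) * v i) +
        μ * Y * (U i * Y - (inner ℝ u v + φ * X * Y) * x i) +
        κ1 * (X * (1 + φ * s)) * (x i * inner ℝ v v - Y * v i)) =
      (κ s * inner ℝ v v + μ * Y * Y) * (U i * u i) +
      (κ1 * (X * (1 + φ * s)) * inner ℝ v v - μ * Y * (inner ℝ u v + φ * X * Y)) * (x i * u i) -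
      (κ s * (inner ℝ u v + φ * X * Y) + κ1 * (X * (1 + φ * s)) * Y) * (u i * v i) := fun i => by
    ring
  simp only [h1, h2, h3, h4]
  simp only [h5, Finset.sum_add_distrib, Finset.sum_sub_distrib, ← Finset.mul_sum,
    sum_mul_eq_inner, hUu]
  have hμ : κ s * φ + κ1 * (1 + φ * s) = μ := by
    have he := h.eq_κ s hs
    have hw := (h.w_pos s hs).ne'
    rw [hμdef, mu, hφ]
    field_simp
    linear_combination (-derivWithin κ (Ici 0) s) * he
  unfold gram radialPart
  rw [← hX, ← hY]
  linear_combination (X * X * inner ℝ v v - X * Y * inner ℝ u v) * hμ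

/-- The numerator is affine in `radialPart`, which ranges over `[0, |x|² gram u v]`. At the two ends
it equals `κ gram u v` and `(κ + |x|² μ) gram u v = (p / w) gram u v`, both positive; at the origin
only the first case remains. -/
theorem hasPositiveSectionalCurvature (h : IsSmoothProfile m w p q κ) :
    HasPositiveSectionalCurvature (n := n) (warpedMetric w) := by
  intro x u v hlin
  have hs := sq_nonneg ‖x‖
  have hG := gram_pos hlin
  have hL := radialPart_nonneg x u v
  have hLs := radialPart_le x hG
  have hκ := h.κ_pos _ hs
  unfold sectionalCurvature
  rw [h.sectional_numerator]
  apply div_pos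
  · rcases hs.eq_or_lt with h0 | h0
    · rw [← h0, zero_mul] at hLs
      rw [le_antisymm hLs hL, mul_zero, add_zero]
      exact mul_pos hκ hG
    · have hw := h.w_pos _ hs
      have h1 : (κ (‖x‖ ^ 2) + mu w κ (‖x‖ ^ 2) * ‖x‖ ^ 2) * w (‖x‖ ^ 2) = p (‖x‖ ^ 2) := by
        linear_combination ‖x‖ ^ 2 * h.mu_mul hs - h.radial_eq hs - κ (‖x‖ ^ 2) * h.eq_κ _ hs
      have h2 : 0 < κ (‖x‖ ^ 2) + mu w κ (‖x‖ ^ 2) * ‖x‖ ^ 2 :=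
        pos_of_mul_pos_left (h1 ▸ h.p_pos _ hs) hw.le
      have h3 : ‖x‖ ^ 2 * (κ (‖x‖ ^ 2) * gram u v + mu w κ (‖x‖ ^ 2) * radialPart x u v) =
          κ (‖x‖ ^ 2) * (‖x‖ ^ 2 * gram u v - radialPart x u v) +
          (κ (‖x‖ ^ 2) + mu w κ (‖x‖ ^ 2) * ‖x‖ ^ 2) * radialPart x u v := by ring
      have h4 : 0 < κ (‖x‖ ^ 2) * (‖x‖ ^ 2 * gram u v - radialPart x u v) +
          (κ (‖x‖ ^ 2) + mu w κ (‖x‖ ^ 2) * ‖x‖ ^ 2) * radialPart x u v := by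
        rcases hL.eq_or_lt with h5 | h5
        · rw [← h5, sub_zero, mul_zero, add_zero]
          positivity
        · exact add_pos_of_nonneg_of_pos (mul_nonneg hκ.le (by linarith)) (mul_pos h2 h5)
      exact pos_of_mul_pos_right (h3 ▸ h4) h0.le
  · rw [h.warpedMetric_eq]
    simp only [metricInner_radialMetric]
    have h1 := mul_nonneg (h.φ_nonneg hs) hL
    unfold gram at hG
    unfold radialPart at h1
    nlinarith

theorem contDiff_warpedMetric (h : IsSmoothProfile m w p q κ) (i j : Fin n) :
    ContDiff ℝ ∞ fun x : E n => warpedMetric w x i j := by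
  rw [h.warpedMetric_eq]
  exact contDiff_const.add ((contDiff_comp_normSq (h.smooth_κ.div h.smooth_w
    fun s hs => (h.w_pos s hs).ne')).mul ((contDiff_coord i).mul (contDiff_coord j)))

theorem posDef_warpedMetric (h : IsSmoothProfile m w p q κ) (x : E n) :
    (warpedMetric w x).PosDef := by
  rw [h.warpedMetric_eq]
  refine Matrix.PosDef.of_dotProduct_mulVec_pos ?_ ?_
  · ext i j
    simp only [Matrix.conjTranspose_apply, radialMetric, Matrix.of_apply, star_trivial]
    rw [if_congr (eq_comm (a := j) (b := i)) rfl rfl, mul_comm (x j)]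
  · intro v hv
    have hpos : 0 < metricInner (radialMetric fun s => κ s / w s) x (WithLp.toLp 2 v)
        (WithLp.toLp 2 v) := by
      rw [metricInner_radialMetric]
      refine add_pos_of_pos_of_nonneg ?_ (mul_nonneg (h.φ_nonneg (sq_nonneg _))
        (mul_self_nonneg _))
      rw [real_inner_self_pos]
      simpa using hv
    refine hpos.trans_eq ?_
    simp only [metricInner, dotProduct, Matrix.mulVec, star_trivial, Finset.mul_sum]
    exact Finset.sum_congr rfl fun i _ => Finset.sum_congr rfl fun j _ => by ring

end IsSmoothProfile

/-! ### The soliton potential -/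

/-- `Φ = 1 + 2 p + 2 m κ`; the gradient of the potential is `(Φ / 2) x`. -/
def gradientFactor (m : ℝ) (p κ : ℝ → ℝ) (s : ℝ) : ℝ := 1 + 2 * p s + 2 * m * κ s

/-- The scalar curvature as a function of `s = |x|²`. -/
def scalarProfile (m : ℝ) (p κ : ℝ → ℝ) (s : ℝ) : ℝ := (m + 1) * (m * κ s + 2 * p s)

/-- The potential as a function of `s = |x|²`. -/
def potential (m : ℝ) (w p κ : ℝ → ℝ) (s : ℝ) : ℝ :=
  s * gradientFactor m p κ s ^ 2 / (4 * w s) + scalarProfile m p κ s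

namespace IsSmoothProfile

variable {m : ℝ} {w p q κ : ℝ → ℝ}

theorem smooth_gradientFactor (h : IsSmoothProfile m w p q κ) :
    ContDiffOn ℝ ∞ (gradientFactor m p κ) (Ici 0) :=
  (contDiffOn_const.add (contDiffOn_const.mul h.smooth_p)).add (contDiffOn_const.mul h.smooth_κ)

theorem smooth_scalarProfile (h : IsSmoothProfile m w p q κ) :
    ContDiffOn ℝ ∞ (scalarProfile m p κ) (Ici 0) :=
  contDiffOn_const.mul ((contDiffOn_const.mul h.smooth_κ).add (contDiffOn_const.mul h.smooth_p))

theorem smooth_potential (h : IsSmoothProfile m w p q κ) :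
    ContDiffOn ℝ ∞ (potential m w p κ) (Ici 0) := by
  refine ContDiffOn.add ?_ h.smooth_scalarProfile
  refine (contDiffOn_id.mul (h.smooth_gradientFactor.pow 2)).div
    (contDiffOn_const.mul h.smooth_w) fun s hs => ?_
  have := h.w_pos s hs
  positivity

theorem deriv_gradientFactor (h : IsSmoothProfile m w p q κ) {s : ℝ} (hs : 0 ≤ s) :
    HasDerivWithinAt (gradientFactor m p κ) (2 * q s + 2 * m * derivWithin κ (Ici 0) s)
      (Ici 0) s :=
  (((h.deriv_p s hs).const_mul 2).const_add 1).add ((h.deriv_κ hs).const_mul (2 * m))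

theorem q_eq (h : IsSmoothProfile m w p q κ) {s : ℝ} (hs : 0 < s) :
    q s = (2 * m * w s * κ s - p s * (2 * s * p s + s + 2 * m)) / (4 * s * w s) := by
  have hw := h.w_pos s hs.le
  rw [eq_div_iff (by positivity)]
  linarith [h.ode s hs.le]

theorem κ_eq (h : IsSmoothProfile m w p q κ) {s : ℝ} (hs : 0 < s) : κ s = (1 - w s) / s := by
  rw [eq_div_iff hs.ne', h.eq_κ s hs.le, mul_comm]

theorem dκ_eq (h : IsSmoothProfile m w p q κ) {s : ℝ} (hs : 0 < s) :
    derivWithin κ (Ici 0) s = (p s - (1 - w s) / s) / s := by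
  rw [eq_div_iff hs.ne', h.radial_eq hs.le, h.κ_eq hs]
  ring

/-- For `s > 0` this is the equation for `w`, after elimination of `q`, `κ` and `κ'`; the value at
`0` follows by continuity. -/
theorem deriv_potential (h : IsSmoothProfile m w p q κ) {s : ℝ} (hs : 0 ≤ s) :
    HasDerivWithinAt (potential m w p κ) (gradientFactor m p κ s / (4 * w s)) (Ici 0) s := by
  have hu : UniqueDiffOn ℝ (Ici (0 : ℝ)) := uniqueDiffOn_Ici 0
  have heq : EqOn (derivWithin (potential m w p κ) (Ici 0))
      (fun s => gradientFactor m p κ s / (4 * w s)) (Ici 0) := by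
    have hpos : EqOn (derivWithin (potential m w p κ) (Ici 0))
        (fun s => gradientFactor m p κ s / (4 * w s)) (Ioi 0) := by
      intro s hs
      have hs' : 0 < s := hs
      have hw := h.w_pos s hs'.le
      have h1 : HasDerivWithinAt (potential m w p κ) _ (Ici 0) s :=
        (((hasDerivWithinAt_id s _).mul ((h.deriv_gradientFactor hs'.le).pow 2)).div
          ((h.deriv_w s hs'.le).const_mul 4) (by positivity)).add
          ((((h.deriv_κ hs'.le).const_mul m).add ((h.deriv_p s hs'.le).const_mul 2)).const_mul
            (m + 1))
      rw [h1.derivWithin (hu s hs'.le)]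
      simp only [gradientFactor, h.q_eq hs', h.dκ_eq hs', h.κ_eq hs', id, Pi.mul_apply,
        Pi.pow_apply, Nat.cast_ofNat, Nat.add_one_sub_one, pow_one]
      field_simp
      ring
    refine hpos.of_subset_closure (h.smooth_potential.continuousOn_derivWithin hu (by simp)) ?_
      Ioi_subset_Ici_self (by rw [closure_Ioi])
    refine h.smooth_gradientFactor.continuousOn.div
      (continuousOn_const.mul h.smooth_w.continuousOn) fun s hs => ?_
    have := h.w_pos s hs
    positivity
  have := (h.smooth_potential.differentiableOn (by simp) s hs).hasDerivWithinAt
  rwa [heq hs] at this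

/-- The inverse metric multiplies `x` by `1 - s κ = w`, which cancels the denominator in the
derivative of the potential. -/
theorem grad_potential (h : IsSmoothProfile m w p q κ) (x : E n) :
    grad (warpedMetric w) (fun y => potential m w p κ (‖y‖ ^ 2)) x =
      (gradientFactor m p κ (‖x‖ ^ 2) / 2) • x := by
  have hs := sq_nonneg ‖x‖
  have hw := (h.w_pos _ hs).ne'
  have hd := (HasPDeriv.radial (h.deriv_potential hs)).2
  ext k
  simp only [grad, PiLp.smul_apply, smul_eq_mul]
  simp only [hd, h.inv_warpedMetric, Matrix.of_apply]
  set s := ‖x‖ ^ 2 with hsdef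
  set Φ := gradientFactor m p κ s
  have h1 : ∀ j, ((if k = j then 1 else 0) - κ s * (x k * x j)) * (2 * x j * (Φ / (4 * w s))) =
      2 * (Φ / (4 * w s)) * (if k = j then x j else 0) -
      2 * (Φ / (4 * w s)) * κ s * x k * (x j * x j) := by
    intro j
    split_ifs <;> ring
  simp only [h1, Finset.sum_sub_distrib, ← Finset.mul_sum, sum_mul_self, Finset.sum_ite_eq,
    Finset.mem_univ, if_true, ← hsdef]
  have he := h.eq_κ s hs
  field_simp
  linear_combination 4 * Φ * x k * he

/-- The `δ_ij` part holds by the definition of `Φ` and `p = κ + s κ'`. The `x_i x_j` part is the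
equation for `w`; at the origin it is void. -/
theorem soliton_equation (h : IsSmoothProfile m w p q κ) (hn : (n : ℝ) = m + 2) (x : E n)
    (i j : Fin n) :
    2 * ricci (warpedMetric w) x i j + warpedMetric w x i j =
      lieDerivative (grad (warpedMetric w) fun y => potential m w p κ (‖y‖ ^ 2))
        (warpedMetric w) x i j := by
  have hs := sq_nonneg ‖x‖
  have hX : grad (warpedMetric w) (fun y : E n => potential m w p κ (‖y‖ ^ 2)) =
      fun y => (gradientFactor m p κ (‖y‖ ^ 2) / 2) • y := funext fun y => h.grad_potential y
  have hXd : ∀ k, HasPDeriv (fun y : E n => ((gradientFactor m p κ (‖y‖ ^ 2) / 2) • y) k)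
      (fun i => 2 * x i * (q (‖x‖ ^ 2) + m * derivWithin κ (Ici 0) (‖x‖ ^ 2)) * x k +
        gradientFactor m p κ (‖x‖ ^ 2) / 2 * (if i = k then 1 else 0)) x := fun k =>
    ((HasPDeriv.radial ((h.deriv_gradientFactor hs).div_const 2)).mul
      (HasPDeriv.coord k x)).congr_deriv fun i => by ring
  have hgd := fun i j => (HasPDeriv.radialMetric (h.deriv_φ hs) i j).2
  rw [hX, h.ricci_warpedMetric]
  unfold lieDerivative
  simp only [(hXd _).2]
  rw [h.warpedMetric_eq]
  simp only [hgd]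
  set s := ‖x‖ ^ 2 with hsdef
  set κ1 := derivWithin κ (Ici 0) s with hκ1
  set Φ := gradientFactor m p κ s with hΦ
  set φ := κ s / w s with hφ
  set φ1 := (κ1 + κ s ^ 2) / w s ^ 2 with hφ1
  set h1 := q s + m * κ1 with hh1
  have hsum : ∀ k, ((Φ / 2) • x) k * (2 * φ1 * (x k * x i * x j) +
      φ * ((if k = i then 1 else 0) * x j + x i * (if k = j then 1 else 0))) +
      radialMetric (fun s => κ s / w s) x k j *
        (2 * x i * h1 * x k + Φ / 2 * (if i = k then 1 else 0)) +
      radialMetric (fun s => κ s / w s) x i k *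
        (2 * x j * h1 * x k + Φ / 2 * (if j = k then 1 else 0)) =
      (Φ * φ1 * x i * x j + 4 * φ * h1 * x i * x j) * (x k * x k) +
      (if k = i then Φ / 2 * φ * x k * x j + 2 * h1 * x j * x k +
        Φ / 2 * (if k = j then 1 else 0) + Φ / 2 * φ * x k * x j else 0) +
      (if k = j then Φ / 2 * φ * x k * x i + 2 * h1 * x i * x k +
        Φ / 2 * (if i = k then 1 else 0) + Φ / 2 * φ * x k * x i else 0) := by
    intro k
    simp only [radialMetric, Matrix.of_apply, ← hsdef, ← hφ, PiLp.smul_apply, smul_eq_mul]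
    rw [if_congr (eq_comm (a := i) (b := k)) rfl rfl, if_congr (eq_comm (a := j) (b := k)) rfl rfl]
    split_ifs <;> ring
  simp only [hsum]
  simp only [Finset.sum_add_distrib, ← Finset.mul_sum, sum_mul_self, Finset.sum_ite_eq',
    Finset.mem_univ, if_true, ← hsdef]
  simp only [radialMetric, Matrix.of_apply, ← hsdef, ← hφ]
  have hδ : 2 * (m + 1) * κ s + 2 * κ1 * s + 1 = Φ := by
    have := h.radial_eq hs
    rw [hΦ, gradientFactor, this]
    ring
  have hxx : (2 * ((m + 1) * mu w κ s - κ1) + φ) * (x i * x j) =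
      (Φ * φ1 * s + 4 * φ * h1 * s + 2 * Φ * φ + 4 * h1) * (x i * x j) := by
    rcases hs.eq_or_lt with h0 | h0
    · have : x = 0 := by
        rw [hsdef] at h0
        simpa using h0.symm
      simp [this]
    · congr 1
      have hw := h.w_pos s h0.le
      simp only [hφ, hφ1, hh1, hΦ, gradientFactor, mu, hκ1, h.q_eq h0, h.dκ_eq h0, h.κ_eq h0]
      field_simp
      ring
  rw [hn]
  linear_combination (if i = j then 1 else 0) * hδ + hxx

theorem isExpandingGradientSoliton (h : IsSmoothProfile m w p q κ) (hn : (n : ℝ) = m + 2) :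
    IsExpandingGradientSoliton (n := n) (warpedMetric w)
      fun x => potential m w p κ (‖x‖ ^ 2) where
  smooth_metric := h.contDiff_warpedMetric
  posDef := h.posDef_warpedMetric
  smooth_potential := contDiff_comp_normSq h.smooth_potential
  soliton := h.soliton_equation hn
  normalized x := by
    have hs := sq_nonneg ‖x‖
    have hw := (h.w_pos _ hs).ne'
    have he := h.eq_κ _ hs
    rw [h.grad_potential, h.scalarCurvature_warpedMetric, h.warpedMetric_eq,
      metricInner_radialMetric, hn]
    simp only [real_inner_smul_left, real_inner_smul_right]
    simp only [real_inner_self_eq_norm_sq, potential, scalarProfile]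
    field_simp
    linear_combination (-4 * ‖x‖ ^ 2 * gradientFactor m p κ (‖x‖ ^ 2) ^ 2) * he

theorem isRotationallySymmetric (h : IsSmoothProfile m w p q κ) (N : ℝ → ℝ) :
    IsRotationallySymmetric (n := n) (warpedMetric w) fun x => N (‖x‖ ^ 2) := by
  intro A
  refine ⟨fun x u v => ?_, fun x => by simp only [A.norm_map]⟩
  rw [h.warpedMetric_eq]
  simp only [metricInner_radialMetric, A.norm_map, A.inner_map_map]

end IsSmoothProfile

/-! ### Symbol classes -/

section Symbol

variable {X : Type*} [NormedAddCommGroup X] [NormedSpace ℝ X]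

/-- Functions `f` with `∂ᵃ f = O(ρ ^ (k - |a|))` along `l` for `|a| ≤ j`, where the derivatives are
taken in the directions `V`. -/
def IsSymbol (l : Filter X) (V : Set X) (ρ : X → ℝ) : ℕ → ℤ → (X → ℝ) → Prop
  | 0, k, f => f =O[l] fun x => ρ x ^ k
  | j + 1, k, f => (f =O[l] fun x => ρ x ^ k) ∧ (∀ᶠ x in l, DifferentiableAt ℝ f x) ∧
      ∀ v ∈ V, IsSymbol l V ρ j (k - 1) fun x => fderiv ℝ f x v

/-- The filter `l` describes an end on which `ρ` is bounded below by `1`. -/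
structure IsEnd (l : Filter X) (ρ : X → ℝ) : Prop where
  eventually_nhds : ∀ {P : X → Prop}, (∀ᶠ x in l, P x) → ∀ᶠ x in l, ∀ᶠ y in 𝓝 x, P y
  one_le : ∀ᶠ x in l, 1 ≤ ρ x

namespace IsSymbol

variable {l : Filter X} {V : Set X} {ρ : X → ℝ} {j : ℕ} {k k' : ℤ} {f g : X → ℝ}

theorem isBigO (h : IsSymbol l V ρ j k f) : f =O[l] fun x => ρ x ^ k := by
  cases j with
  | zero => exact h
  | succ j => exact h.1

/-- `IsEnd` makes eventual equality hold on neighbourhoods, so that it passes to derivatives. -/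
theorem congr' (hl : IsEnd l ρ) (h : IsSymbol l V ρ j k f) (hfg : f =ᶠ[l] g) :
    IsSymbol l V ρ j k g := by
  induction j generalizing k f g with
  | zero => exact IsBigO.congr' h hfg EventuallyEq.rfl
  | succ j ih =>
    have hev := hl.eventually_nhds hfg
    refine ⟨h.1.congr' hfg EventuallyEq.rfl, ?_, fun v hv => ih (h.2.2 v hv) ?_⟩
    · filter_upwards [hev, h.2.1] with x h1 h2
      exact h2.congr_of_eventuallyEq (EventuallyEq.symm h1)
    · filter_upwards [hev] with x h1
      rw [EventuallyEq.fderiv_eq h1]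

theorem pred (h : IsSymbol l V ρ (j + 1) k f) : IsSymbol l V ρ j k f := by
  induction j generalizing k f with
  | zero => exact h.1
  | succ j ih => exact ⟨h.1, h.2.1, fun v hv => ih (h.2.2 v hv)⟩

theorem weaken (hl : IsEnd l ρ) (h : IsSymbol l V ρ j k f) (hk : k ≤ k') :
    IsSymbol l V ρ j k' f := by
  have hO : ∀ {k k' : ℤ}, k ≤ k' → (fun x => ρ x ^ k) =O[l] fun x => ρ x ^ k' := by
    intro k k' hk
    refine IsBigO.of_bound 1 ?_
    filter_upwards [hl.one_le] with x hx
    have hx0 : 0 < ρ x := one_pos.trans_le hx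
    rw [Real.norm_of_nonneg (zpow_nonneg hx0.le _), Real.norm_of_nonneg (zpow_nonneg hx0.le _),
      one_mul]
    exact zpow_le_zpow_right₀ hx hk
  induction j generalizing k k' f with
  | zero => exact IsBigO.trans h (hO hk)
  | succ j ih => exact ⟨h.1.trans (hO hk), h.2.1, fun v hv => ih (h.2.2 v hv) (by omega)⟩

theorem zero (j : ℕ) (k : ℤ) : IsSymbol l V ρ j k fun _ => 0 := by
  induction j generalizing k with
  | zero => exact isBigO_zero _ _
  | succ j ih =>
    refine ⟨isBigO_zero _ _, Eventually.of_forall fun x => differentiableAt_const _,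
      fun v _ => ?_⟩
    simpa using ih (k - 1)

theorem const (c : ℝ) (j : ℕ) : IsSymbol l V ρ j 0 fun _ => c := by
  have h0 : (fun _ : X => c) =O[l] fun x => ρ x ^ (0 : ℤ) := by
    simpa using isBigO_const_const c (one_ne_zero (α := ℝ)) l
  cases j with
  | zero => exact h0
  | succ j =>
    refine ⟨h0, Eventually.of_forall fun x => differentiableAt_const _, fun v _ => ?_⟩
    simpa using zero (l := l) (V := V) (ρ := ρ) j (0 - 1)

theorem add (hl : IsEnd l ρ) (hf : IsSymbol l V ρ j k f) (hg : IsSymbol l V ρ j k g) :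
    IsSymbol l V ρ j k fun x => f x + g x := by
  induction j generalizing k f g with
  | zero => exact IsBigO.add hf hg
  | succ j ih =>
    refine ⟨hf.1.add hg.1, ?_, fun v hv => (ih (hf.2.2 v hv) (hg.2.2 v hv)).congr' hl ?_⟩
    · filter_upwards [hf.2.1, hg.2.1] with x h1 h2 using h1.add h2
    · filter_upwards [hf.2.1, hg.2.1] with x h1 h2
      rw [fderiv_fun_add h1 h2]; rfl

theorem mul (hl : IsEnd l ρ) (hf : IsSymbol l V ρ j k f) (hg : IsSymbol l V ρ j k' g) :
    IsSymbol l V ρ j (k + k') fun x => f x * g x := by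
  have hO : ∀ {k k' : ℤ} {f g : X → ℝ}, (f =O[l] fun x => ρ x ^ k) →
      (g =O[l] fun x => ρ x ^ k') → (fun x => f x * g x) =O[l] fun x => ρ x ^ (k + k') := by
    intro k k' f g hf hg
    refine (hf.mul hg).congr' EventuallyEq.rfl ?_
    filter_upwards [hl.one_le] with x hx
    rw [zpow_add₀ (one_pos.trans_le hx).ne']
  induction j generalizing k k' f g with
  | zero => exact hO hf hg
  | succ j ih =>
    refine ⟨hO hf.1 hg.1, ?_, fun v hv => ?_⟩
    · filter_upwards [hf.2.1, hg.2.1] with x h1 h2 using h1.mul h2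
    · have h1 := ih hf.pred (hg.2.2 v hv)
      have h2 := ih (hf.2.2 v hv) hg.pred
      rw [show k + (k' - 1) = k + k' - 1 by ring] at h1
      rw [show k - 1 + k' = k + k' - 1 by ring] at h2
      refine (h1.add hl h2).congr' hl ?_
      filter_upwards [hf.2.1, hg.2.1] with x h3 h4
      rw [fderiv_fun_mul h3 h4]
      simp
      ring

theorem const_mul (hl : IsEnd l ρ) (c : ℝ) (hf : IsSymbol l V ρ j k f) :
    IsSymbol l V ρ j k fun x => c * f x := by
  simpa using (const c j).mul hl hf

theorem neg (hl : IsEnd l ρ) (hf : IsSymbol l V ρ j k f) : IsSymbol l V ρ j k fun x => -f x := by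
  simpa using hf.const_mul hl (-1)

theorem sub (hl : IsEnd l ρ) (hf : IsSymbol l V ρ j k f) (hg : IsSymbol l V ρ j k g) :
    IsSymbol l V ρ j k fun x => f x - g x := by
  simpa [sub_eq_add_neg] using hf.add hl (hg.neg hl)

theorem sq (hl : IsEnd l ρ) (hf : IsSymbol l V ρ j 0 f) : IsSymbol l V ρ j 0 fun x => f x ^ 2 := by
  simpa [_root_.sq] using hf.mul hl hf

theorem sum (hl : IsEnd l ρ) {ι : Type*} (s : Finset ι) {f : ι → X → ℝ}
    (h : ∀ a ∈ s, IsSymbol l V ρ j k (f a)) : IsSymbol l V ρ j k fun x => ∑ a ∈ s, f a x := by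
  classical
  induction s using Finset.induction_on with
  | empty => simpa using zero (l := l) (V := V) (ρ := ρ) j k
  | insert a s ha ih =>
    simp only [Finset.sum_insert ha]
    exact (h a (Finset.mem_insert_self a s)).add hl
      (ih fun b hb => h b (Finset.mem_insert_of_mem hb))

theorem inv (hl : IsEnd l ρ) {c : ℝ} (hc : 0 < c) (hf : IsSymbol l V ρ j 0 f)
    (hlow : ∀ᶠ x in l, c ≤ f x) : IsSymbol l V ρ j 0 fun x => (f x)⁻¹ := by
  have hO : (fun x => (f x)⁻¹) =O[l] fun x => ρ x ^ (0 : ℤ) := by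
    simp only [zpow_zero]
    refine IsBigO.of_bound c⁻¹ ?_
    filter_upwards [hlow] with x hx
    have hx0 : 0 < f x := hc.trans_le hx
    rw [norm_inv, Real.norm_of_nonneg hx0.le, norm_one, mul_one]
    exact inv_anti₀ hc hx
  induction j with
  | zero => exact hO
  | succ j ih =>
    refine ⟨hO, ?_, fun v hv => ?_⟩
    · filter_upwards [hf.2.1, hlow] with x h1 h2 using h1.inv (hc.trans_le h2).ne'
    · have h1 := ih hf.pred
      have h2 := ((hf.2.2 v hv).mul hl (h1.sq hl)).neg hl
      rw [add_zero] at h2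
      refine h2.congr' hl ?_
      filter_upwards [hf.2.1, hlow] with x h3 h4
      have h5 := (hasDerivAt_inv (hc.trans_le h4).ne').comp_hasFDerivAt x h3.hasFDerivAt
      have h6 : fderiv ℝ (fun x => (f x)⁻¹) x = -(f x ^ 2)⁻¹ • fderiv ℝ f x := h5.fderiv
      rw [h6]
      simp
      ring

theorem div (hl : IsEnd l ρ) {c : ℝ} (hc : 0 < c) (hf : IsSymbol l V ρ j k f)
    (hg : IsSymbol l V ρ j 0 g) (hlow : ∀ᶠ x in l, c ≤ g x) :
    IsSymbol l V ρ j k fun x => f x / g x := by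
  simpa [div_eq_mul_inv] using hf.mul hl (hg.inv hl hc hlow)

/-- Composition with a function of one variable. -/
theorem comp (hl : IsEnd l ρ) {h : ℝ → ℝ} {σ : X → ℝ} {d : ℤ}
    (hh : IsSymbol atTop {1} id j k h) (hσ : IsSymbol l V ρ j d σ) (ht : Tendsto σ l atTop)
    (hΘ : σ =Θ[l] fun x => ρ x ^ d) : IsSymbol l V ρ j (k * d) fun x => h (σ x) := by
  have hO : ∀ {k : ℤ} {h : ℝ → ℝ}, (h =O[atTop] fun t => id t ^ k) →
      (fun x => h (σ x)) =O[l] fun x => ρ x ^ (k * d) := by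
    intro k h hh
    refine (hh.comp_tendsto ht).trans ?_
    -- Since `k` may be negative, an upper bound on `σ` would not suffice here.
    have := (hΘ.zpow k).isBigO
    refine this.congr_right fun x => ?_
    rw [← zpow_mul, mul_comm]
  induction j generalizing k h with
  | zero => exact hO hh
  | succ j ih =>
    refine ⟨hO hh.1, ?_, fun v hv => ?_⟩
    · filter_upwards [ht.eventually hh.2.1, hσ.2.1] with x h1 h2 using h1.comp x h2
    · have h1 := (ih (hh.2.2 1 rfl) hσ.pred).mul hl (hσ.2.2 v hv)
      rw [show (k - 1) * d + (d - 1) = k * d - 1 by ring] at h1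
      refine h1.congr' hl ?_
      filter_upwards [ht.eventually hh.2.1, hσ.2.1] with x h2 h3
      have h4 := h2.hasDerivAt.comp_hasFDerivAt x h3.hasFDerivAt
      have h5 : fderiv ℝ (fun x => h (σ x)) x = deriv h (σ x) • fderiv ℝ σ x := h4.fderiv
      rw [h5]
      simp

end IsSymbol

end Symbol

/-- Symbols of one real variable. -/
abbrev IsSymbolReal (j : ℕ) (k : ℤ) (h : ℝ → ℝ) : Prop := IsSymbol atTop {1} id j k h

theorem isEnd_atTop : IsEnd (X := ℝ) atTop id where
  eventually_nhds {P} h := by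
    obtain ⟨a, ha⟩ := eventually_atTop.mp h
    filter_upwards [eventually_gt_atTop a] with x hx
    filter_upwards [Ioi_mem_nhds hx] with y hy using ha y (le_of_lt hy)
  one_le := eventually_ge_atTop 1

namespace IsSymbolReal

variable {j : ℕ} {k : ℤ} {h h' : ℝ → ℝ}

theorem of_hasDerivAt (hd : ∀ᶠ t in atTop, HasDerivAt h (h' t) t)
    (hO : h =O[atTop] fun t => t ^ k) (hs : IsSymbolReal j (k - 1) h') :
    IsSymbolReal (j + 1) k h := by
  refine ⟨hO, hd.mono fun t ht => ht.differentiableAt, ?_⟩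
  rintro v rfl
  refine hs.congr' isEnd_atTop ?_
  filter_upwards [hd] with t ht
  rw [fderiv_apply_one_eq_deriv, ht.deriv]

theorem inv (j : ℕ) : IsSymbolReal j (-1) fun t => t⁻¹ := by
  induction j with
  | zero => simpa [IsSymbolReal, IsSymbol] using isBigO_refl (fun t : ℝ => t⁻¹) atTop
  | succ j ih =>
    refine of_hasDerivAt (h' := fun t => -(t⁻¹ * t⁻¹)) ?_ ?_ ?_
    · filter_upwards [eventually_ne_atTop 0] with t ht
      refine (hasDerivAt_inv ht).congr_deriv ?_
      rw [sq, mul_inv]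
    · simpa using isBigO_refl (fun t : ℝ => t⁻¹) atTop
    · exact (ih.mul isEnd_atTop ih).neg isEnd_atTop

end IsSymbolReal

/-! ### Barriers for damped linear equations -/

/-- A one-sided decay estimate for `y' ≤ -c y + C t⁻ᵏ`. -/
theorem eventually_le_zpow_of_deriv_le {y y' : ℝ → ℝ} {c C : ℝ} (hc : 0 < c) (hC : 0 ≤ C) (k : ℕ)
    (hd : ∀ᶠ t in atTop, HasDerivAt y (y' t) t)
    (hle : ∀ᶠ t in atTop, 0 ≤ y t → y' t ≤ -c * y t + C * t ^ (-(k : ℤ))) :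
    ∃ A, ∀ᶠ t in atTop, y t ≤ A * t ^ (-(k : ℤ)) := by
  obtain ⟨T, hT⟩ := eventually_atTop.mp
    ((hd.and hle).and (eventually_ge_atTop (max 1 (2 * k / c))))
  have hT1 : max 1 (2 * k / c) ≤ T := (hT T le_rfl).2
  have hT0 : 0 < T := one_pos.trans_le ((le_max_left _ _).trans hT1)
  -- The barrier `A t⁻ᵏ` lies above `y` at `T`. Half of the damping absorbs the forcing, as `A ≥ 2 C
  -- / c`; the other half absorbs the derivative of the barrier, as `T ≥ 2 k / c`.
  set A := max (y T * T ^ (k : ℤ)) (2 * C / c) with hA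
  have hA0 : 0 ≤ A := le_trans (by positivity) (le_max_right _ _)
  refine ⟨A, eventually_atTop.mpr ⟨T, fun b hb => ?_⟩⟩
  have hderiv : ∀ t, T ≤ t → HasDerivAt (fun t => A * t ^ (-(k : ℤ)) - y t)
      (A * (((-(k : ℤ) : ℤ) : ℝ) * t ^ (-(k : ℤ) - 1)) - y' t) t := fun t ht =>
    ((hasDerivAt_zpow _ t (Or.inl (hT0.trans_le ht).ne')).const_mul A).sub (hT t ht).1.1
  have := nonneg_of_hasDerivAt_pos_of_neg (f := fun t => A * t ^ (-(k : ℤ)) - y t) (a := T)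
    (b := b) (fun t ht => (hderiv t ht.1).continuousAt.continuousWithinAt) ?_ ?_ b ⟨hb, le_rfl⟩
  · linarith
  · have h1 : y T * T ^ (k : ℤ) ≤ A := le_max_left _ _
    have h2 : y T = y T * T ^ (k : ℤ) * T ^ (-(k : ℤ)) := by
      rw [mul_assoc, ← zpow_add₀ hT0.ne']; simp
    have h3 : 0 < T ^ (-(k : ℤ)) := zpow_pos hT0 _
    nlinarith
  · intro t ht hneg
    refine ⟨_, hderiv t ht.1.le, ?_⟩
    have ht0 : 0 < t := hT0.trans ht.1
    have hz : 0 < t ^ (-(k : ℤ)) := zpow_pos ht0 _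
    have hy0 : 0 ≤ y t := by nlinarith
    have h1 := (hT t ht.1.le).1.2 hy0
    have h2 : 2 * C / c ≤ A := le_max_right _ _
    rw [div_le_iff₀ hc] at h2
    have h3 : 2 * k / c ≤ t := (le_max_right _ _).trans (hT1.trans ht.1.le)
    rw [div_le_iff₀ hc] at h3
    have h4 : t ^ (-(k : ℤ) - 1) = t ^ (-(k : ℤ)) / t := by
      rw [zpow_sub_one₀ ht0.ne', div_eq_mul_inv]
    have h5 : (k : ℝ) * (t ^ (-(k : ℤ)) / t) ≤ c / 2 * t ^ (-(k : ℤ)) := by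
      rw [mul_div_assoc', div_le_iff₀ ht0]
      nlinarith
    rw [h4]
    push_cast
    have h6 : A * (k * (t ^ (-(k : ℤ)) / t)) ≤ A * (c / 2 * t ^ (-(k : ℤ))) :=
      mul_le_mul_of_nonneg_left h5 hA0
    have h7 : c * (A * t ^ (-(k : ℤ))) < c * y t := mul_lt_mul_of_pos_left (by linarith) hc
    nlinarith [mul_le_mul_of_nonneg_right h2 hz.le]

theorem isBigO_zpow_of_deriv_eq {y y' B e : ℝ → ℝ} {c : ℝ} (hc : 0 < c) (k : ℕ)
    (hd : ∀ᶠ t in atTop, HasDerivAt y (y' t) t)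
    (hy' : ∀ᶠ t in atTop, y' t = -B t * y t + e t) (hB : ∀ᶠ t in atTop, c ≤ B t)
    (he : e =O[atTop] fun t => t ^ (-(k : ℤ))) : y =O[atTop] fun t => t ^ (-(k : ℤ)) := by
  obtain ⟨C, hC0, hC⟩ := he.exists_nonneg
  have hCb := hC.bound
  have hz : ∀ᶠ t : ℝ in atTop, ‖t ^ (-(k : ℤ))‖ = t ^ (-(k : ℤ)) := by
    filter_upwards [eventually_gt_atTop 0] with t ht
    exact Real.norm_of_nonneg (zpow_nonneg ht.le _)
  obtain ⟨A₁, h1⟩ := eventually_le_zpow_of_deriv_le hc hC0 k hd (by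
    filter_upwards [hy', hB, hCb, hz] with t h1 h2 h3 h4 h5
    rw [h4] at h3
    have := (abs_le.mp h3).2
    nlinarith)
  obtain ⟨A₂, h2⟩ := eventually_le_zpow_of_deriv_le (y := fun t => -y t) (y' := fun t => -y' t)
    hc hC0 k (hd.mono fun t ht => ht.neg) (by
    filter_upwards [hy', hB, hCb, hz] with t h1 h2 h3 h4 h5
    rw [h4] at h3
    have := (abs_le.mp h3).1
    nlinarith)
  refine IsBigO.of_bound (max A₁ A₂) ?_
  filter_upwards [h1, h2, hz, eventually_gt_atTop 0] with t h1 h2 h3 ht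
  rw [h3, Real.norm_eq_abs]
  have h4 : 0 ≤ t ^ (-(k : ℤ)) := zpow_nonneg ht.le _
  refine abs_le'.mpr ⟨h1.trans ?_, h2.trans ?_⟩
  · exact mul_le_mul_of_nonneg_right (le_max_left _ _) h4
  · exact mul_le_mul_of_nonneg_right (le_max_right _ _) h4

/-! ### Decay of the curvatures -/

/-- The damping coefficient of the equation `p' = (m / 2) κ / s - B p`. -/
def damping (m : ℝ) (w p : ℝ → ℝ) (s : ℝ) : ℝ := (2 * p s + (1 + 2 * m * s⁻¹)) / (4 * w s)

/-- The ratio `4 f / |x|²` of the potential. -/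
def potentialRatio (m : ℝ) (w p κ : ℝ → ℝ) (s : ℝ) : ℝ :=
  gradientFactor m p κ s ^ 2 / w s + 4 * scalarProfile m p κ s * s⁻¹

namespace IsSmoothProfile

variable {m : ℝ} {w p q κ : ℝ → ℝ}

theorem hasDerivAt_w (h : IsSmoothProfile m w p q κ) {s : ℝ} (hs : 0 < s) :
    HasDerivAt w (-p s) s :=
  (h.deriv_w s hs.le).hasDerivAt (Ici_mem_nhds hs)

theorem hasDerivAt_p (h : IsSmoothProfile m w p q κ) {s : ℝ} (hs : 0 < s) :
    HasDerivAt p (q s) s :=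
  (h.deriv_p s hs.le).hasDerivAt (Ici_mem_nhds hs)

theorem w_lt_one (h : IsSmoothProfile m w p q κ) {s : ℝ} (hs : 0 < s) : w s < 1 := by
  have := mul_pos hs (h.κ_pos s hs.le)
  linarith [h.eq_κ s hs.le]

/-- As `0 < w < 1`, the equation implies `p' ≤ -p / 4 + (m / 2) s⁻²`, and the barrier applies. -/
theorem isBigO_p (hm : 0 ≤ m) (h : IsSmoothProfile m w p q κ) :
    p =O[atTop] fun t => t ^ (-2 : ℤ) := by
  obtain ⟨A, hA⟩ := eventually_le_zpow_of_deriv_le (y := p) (y' := q) (c := 1 / 4) (C := m / 2)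
    (by norm_num) (by positivity) 2
    (by filter_upwards [eventually_gt_atTop 0] with s hs using h.hasDerivAt_p hs)
    (by
      filter_upwards [eventually_gt_atTop 0] with s hs _
      have hw := h.w_pos s hs.le
      have hp := h.p_pos s hs.le
      have hw1 := h.w_lt_one hs
      have h4 : 0 < 4 * s ^ 2 * w s := by positivity
      refine le_of_mul_le_mul_left ?_ h4
      have e1 : (s : ℝ) ^ (-((2 : ℕ) : ℤ)) = 1 / s ^ 2 := by
        rw [zpow_neg, zpow_natCast, one_div]
      rw [e1]
      have e2 : 4 * s ^ 2 * w s * (-(1 / 4) * p s + m / 2 * (1 / s ^ 2)) =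
          -(s ^ 2 * w s * p s) + 2 * m * w s := by
        field_simp
        ring
      have e3 : 4 * s ^ 2 * w s * q s =
          2 * m * w s * (1 - w s) - s * p s * (2 * s * p s + s + 2 * m) := by
        linear_combination s * h.ode s hs.le - 2 * m * w s * h.eq_κ s hs.le
      rw [e2, e3]
      have e4 : 0 ≤ m * w s * w s := by positivity
      have e5 : 0 ≤ s * p s * (2 * s * p s + 2 * m) := by positivity
      have e6 : 0 ≤ s ^ 2 * p s * (1 - w s) := mul_nonneg (by positivity) (by linarith)
      nlinarith)
  refine IsBigO.of_bound A ?_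
  filter_upwards [hA, eventually_gt_atTop 0] with s h1 hs
  rw [Real.norm_of_nonneg (h.p_pos s hs.le).le, Real.norm_of_nonneg (zpow_nonneg hs.le _)]
  exact h1

/-- A decreasing function bounded below by a positive constant has a positive limit. The rate
follows from `p ≤ A / s²`, which makes `w - A / s` increasing, hence at most `W`. -/
theorem exists_limit (hm : 0 ≤ m) (h : IsSmoothProfile m w p q κ) :
    ∃ W, 0 < W ∧ W ≤ 1 ∧ (∀ s, 0 < s → W ≤ w s) ∧ Tendsto w atTop (𝓝 W) ∧
      (fun s => w s - W) =O[atTop] fun t => t ^ (-1 : ℤ) := by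
  obtain ⟨δ, hδ, hlow⟩ := h.lower
  have hanti : AntitoneOn w (Ioi 0) := by
    refine antitoneOn_of_deriv_nonpos (convex_Ioi 0)
      (fun x hx => (h.hasDerivAt_w hx).continuousAt.continuousWithinAt) ?_ ?_ <;> rw [interior_Ioi]
    · exact fun x hx => (h.hasDerivAt_w hx).differentiableAt.differentiableWithinAt
    · intro x hx
      rw [(h.hasDerivAt_w hx).deriv]
      linarith [h.p_pos x (le_of_lt hx)]
  have hpos : ∀ t : ℝ, 0 < max t 1 := fun t => one_pos.trans_le (le_max_right _ _)
  have hanti' : Antitone fun t => w (max t 1) := fun a b hab =>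
    hanti (hpos a) (hpos b) (max_le_max_right 1 hab)
  have hbdd : BddBelow (range fun t => w (max t 1)) :=
    ⟨δ, by rintro _ ⟨t, rfl⟩; exact hlow _ (hpos t)⟩
  set W := ⨅ t, w (max t 1)
  have hlim : Tendsto w atTop (𝓝 W) := by
    refine (tendsto_atTop_ciInf hanti' hbdd).congr' ?_
    filter_upwards [eventually_ge_atTop 1] with t ht
    rw [max_eq_left ht]
  have hle : ∀ s, 0 < s → W ≤ w s := by
    intro s hs
    refine le_of_tendsto hlim ?_
    filter_upwards [eventually_ge_atTop s] with t ht using hanti hs (hs.trans_le ht) ht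
  have hδW : δ ≤ W := le_ciInf fun t => hlow _ (hpos t)
  refine ⟨W, hδ.trans_le hδW, (hle 1 one_pos).trans (h.w_lt_one one_pos).le, hle, hlim, ?_⟩
  obtain ⟨A, hA0, hA⟩ := (h.isBigO_p hm).exists_nonneg
  obtain ⟨T, hT⟩ := eventually_atTop.mp (hA.bound.and (eventually_gt_atTop 0))
  have hT0 : 0 < T := (hT T le_rfl).2
  have hmono : MonotoneOn (fun s => w s - A * s⁻¹) (Ici T) := by
    have hd : ∀ s, T ≤ s → HasDerivAt (fun s => w s - A * s⁻¹) (-p s - A * -(s ^ 2)⁻¹) s :=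
      fun s hs => (h.hasDerivAt_w (hT0.trans_le hs)).sub
        ((hasDerivAt_inv (hT0.trans_le hs).ne').const_mul A)
    refine monotoneOn_of_deriv_nonneg (convex_Ici T)
      (fun x hx => (hd x hx).continuousAt.continuousWithinAt) ?_ ?_ <;> rw [interior_Ici]
    · exact fun x hx => (hd x (le_of_lt hx)).differentiableAt.differentiableWithinAt
    · intro x hx
      have hx' : T ≤ x := le_of_lt hx
      have hx0 := hT0.trans_le hx'
      rw [(hd x hx').deriv]
      have h1 := (hT x hx').1
      rw [Real.norm_of_nonneg (h.p_pos x hx0.le).le, Real.norm_of_nonneg (zpow_nonneg hx0.le _),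
        zpow_neg] at h1
      have h2 : (x ^ (2 : ℤ))⁻¹ = (x ^ 2)⁻¹ := by norm_cast
      rw [h2] at h1
      linarith
  refine IsBigO.of_bound A ?_
  filter_upwards [eventually_ge_atTop T] with s hs
  have hs0 := hT0.trans_le hs
  rw [Real.norm_of_nonneg (sub_nonneg.mpr (hle s hs0)), Real.norm_of_nonneg (zpow_nonneg hs0.le _),
    zpow_neg_one]
  have hlim2 : Tendsto (fun s => w s - A * s⁻¹) atTop (𝓝 (W - A * 0)) :=
    hlim.sub (tendsto_inv_atTop_zero.const_mul A)
  rw [mul_zero, sub_zero] at hlim2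
  have : w s - A * s⁻¹ ≤ W := by
    refine ge_of_tendsto hlim2 ?_
    filter_upwards [eventually_ge_atTop s] with t ht
    exact hmono hs (le_trans hs ht) ht
  linarith

theorem q_eq_damping (h : IsSmoothProfile m w p q κ) {s : ℝ} (hs : 0 < s) :
    q s = m / 2 * ((1 - w s) * s⁻¹ * s⁻¹) - p s * damping m w p s := by
  have hw := (h.w_pos s hs.le).ne'
  rw [h.q_eq hs, h.κ_eq hs, damping]
  field_simp
  ring

theorem damping_ge (hm : 0 ≤ m) (h : IsSmoothProfile m w p q κ) {s : ℝ} (hs : 0 < s) :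
    1 / 4 ≤ damping m w p s := by
  have hw := h.w_pos s hs.le
  have hw1 := h.w_lt_one hs
  have hp := h.p_pos s hs.le
  have : 0 ≤ 2 * m * s⁻¹ := by positivity
  rw [damping, le_div_iff₀ (by positivity)]
  linarith

theorem symbol_w_of (h : IsSmoothProfile m w p q κ) {j : ℕ} (hp : IsSymbolReal j (-1) p) :
    IsSymbolReal (j + 1) 0 w := by
  refine IsSymbolReal.of_hasDerivAt (h' := fun s => -p s) ?_ ?_ (hp.neg isEnd_atTop)
  · filter_upwards [eventually_gt_atTop 0] with s hs using h.hasDerivAt_w hs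
  · refine IsBigO.of_bound 1 ?_
    filter_upwards [eventually_gt_atTop 0] with s hs
    rw [Real.norm_of_nonneg (h.w_pos s hs.le).le]
    simpa using (h.w_lt_one hs).le

theorem eventually_w_ge (h : IsSmoothProfile m w p q κ) : ∃ δ > 0, ∀ᶠ s in atTop, δ ≤ w s := by
  obtain ⟨δ, hδ, hlow⟩ := h.lower
  exact ⟨δ, hδ, by filter_upwards [eventually_gt_atTop 0] with s hs using hlow s hs⟩

theorem symbol_damping (h : IsSmoothProfile m w p q κ) {j : ℕ} (hp : IsSymbolReal j (-1) p) :
    IsSymbolReal j 0 (damping m w p) := by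
  obtain ⟨δ, hδ, hlow⟩ := h.eventually_w_ge
  have hl := isEnd_atTop
  have hp0 := hp.weaken hl (show (-1 : ℤ) ≤ 0 by norm_num)
  have hs0 := (IsSymbolReal.inv j).weaken hl (show (-1 : ℤ) ≤ 0 by norm_num)
  refine IsSymbol.div hl (c := 4 * δ) (by positivity) ?_ ((h.symbol_w_of hp).pred.const_mul hl 4) ?_
  · exact (hp0.const_mul hl 2).add hl ((IsSymbol.const 1 j).add hl (hs0.const_mul hl (2 * m)))
  · filter_upwards [hlow] with s hs
    linarith

theorem symbol_one_sub_div {w : ℝ → ℝ} {j : ℕ} (hw : IsSymbolReal j 0 w) :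
    IsSymbolReal j (-2) fun s => (1 - w s) * s⁻¹ * s⁻¹ := by
  have hl := isEnd_atTop
  simpa using (((IsSymbol.const 1 j).sub hl hw).mul hl (IsSymbolReal.inv j)).mul hl
    (IsSymbolReal.inv j)

/-- The bounds behind this are `p = O(s⁻²)`, `p' = O(s⁻³)` and `p'' = O(s⁻³)`. The second derivative
is not improved further, so two derivatives are claimed only at order `-1`, which is enough for the
error terms. -/
theorem symbol_p (hm : 0 ≤ m) (h : IsSmoothProfile m w p q κ) :
    IsSymbolReal 2 (-1) p ∧ IsSymbolReal 1 (-2) p := by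
  have hl := isEnd_atTop
  have hp0 : IsSymbolReal 0 (-2) p := h.isBigO_p hm
  have hp0' : IsSymbolReal 0 (-1) p := hp0.weaken hl (by norm_num)
  have hpd : ∀ᶠ s in atTop, HasDerivAt p (q s) s := by
    filter_upwards [eventually_gt_atTop 0] with s hs using h.hasDerivAt_p hs
  have hqeq : (fun s => m / 2 * ((1 - w s) * s⁻¹ * s⁻¹) - p s * damping m w p s) =ᶠ[atTop] q := by
    filter_upwards [eventually_gt_atTop 0] with s hs using (h.q_eq_damping hs).symm
  have hw1 : IsSymbolReal 1 0 w := h.symbol_w_of hp0'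
  have hκ1 : IsSymbolReal 1 (-2) fun s => (1 - w s) * s⁻¹ * s⁻¹ := symbol_one_sub_div hw1
  have hq0 : IsSymbolReal 0 (-2) q := by
    have h1 := (hκ1.pred.const_mul hl (m / 2)).sub hl (hp0.mul hl (h.symbol_damping hp0'))
    exact h1.congr' hl hqeq
  have hp1 : IsSymbolReal 1 (-1) p :=
    IsSymbolReal.of_hasDerivAt hpd (hp0'.isBigO) hq0
  have hB1 : IsSymbolReal 1 0 (damping m w p) := h.symbol_damping hp1
  set B := damping m w p
  set K : ℝ → ℝ := fun s => (1 - w s) * s⁻¹ * s⁻¹ with hK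
  set e : ℝ → ℝ := fun s => m / 2 * fderiv ℝ K s 1 - p s * fderiv ℝ B s 1 with he
  have he0 : IsSymbolReal 0 (-3) e :=
    ((hκ1.2.2 1 rfl).const_mul hl (m / 2)).sub hl (hp0.mul hl (hB1.2.2 1 rfl))
  have hqd : ∀ᶠ s in atTop, HasDerivAt q (-B s * q s + e s) s := by
    filter_upwards [hl.eventually_nhds hqeq, hpd, hκ1.2.1, hB1.2.1] with s h1 h2 h3 h4
    have h5 := (h3.hasDerivAt.const_mul (m / 2)).sub (h2.mul h4.hasDerivAt)
    refine (h5.congr_of_eventuallyEq (EventuallyEq.symm h1)).congr_deriv ?_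
    simp only [he, fderiv_apply_one_eq_deriv]
    ring
  -- The first-order equation alone gives only `q = O(s⁻²)`. Its derivative `q' = -B q + e`, with `e
  -- = O(s⁻³)`, is damped again and gains one order.
  have hqO : q =O[atTop] fun t => t ^ (-((3 : ℕ) : ℤ)) :=
    isBigO_zpow_of_deriv_eq (y' := fun s => -B s * q s + e s) (B := B) (e := e)
      (c := 1 / 4) (by norm_num) 3 hqd
      (Eventually.of_forall fun s => rfl)
      (by filter_upwards [eventually_gt_atTop 0] with s hs using h.damping_ge hm hs) he0
  have hq0' : IsSymbolReal 0 (-3) q := hqO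
  have hq1 : IsSymbolReal 1 (-2) q := by
    refine IsSymbolReal.of_hasDerivAt hqd hq0.isBigO ?_
    have := ((hB1.pred.neg hl).mul hl hq0').add hl (he0.weaken hl (by norm_num))
    exact this
  exact ⟨IsSymbolReal.of_hasDerivAt hpd hp0'.isBigO hq1,
    IsSymbolReal.of_hasDerivAt hpd hp0.isBigO hq0'⟩

theorem symbol_w_sub (hm : 0 ≤ m) (h : IsSmoothProfile m w p q κ) {W : ℝ}
    (hW : (fun s => w s - W) =O[atTop] fun t => t ^ (-1 : ℤ)) :
    IsSymbolReal 2 (-1) fun s => w s - W := by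
  refine IsSymbolReal.of_hasDerivAt (h' := fun s => -p s) ?_ hW
    ((h.symbol_p hm).2.neg isEnd_atTop)
  filter_upwards [eventually_gt_atTop 0] with s hs using (h.hasDerivAt_w hs).sub_const W

theorem symbol_w (hm : 0 ≤ m) (h : IsSmoothProfile m w p q κ) : IsSymbolReal 2 0 w :=
  h.symbol_w_of (h.symbol_p hm).1.pred

theorem symbol_κ (hm : 0 ≤ m) (h : IsSmoothProfile m w p q κ) : IsSymbolReal 2 (-1) κ := by
  have hl := isEnd_atTop
  have h1 := ((IsSymbol.const 1 2).sub hl (h.symbol_w hm)).mul hl (IsSymbolReal.inv 2)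
  rw [zero_add] at h1
  refine h1.congr' hl ?_
  filter_upwards [eventually_gt_atTop 0] with s hs
  rw [h.κ_eq hs, div_eq_mul_inv]

theorem symbol_gradientFactor_sub (hm : 0 ≤ m) (h : IsSmoothProfile m w p q κ) :
    IsSymbolReal 2 (-1) fun s => gradientFactor m p κ s - 1 := by
  have hl := isEnd_atTop
  refine (((h.symbol_p hm).1.const_mul hl 2).add hl
    ((h.symbol_κ hm).const_mul hl (2 * m))).congr' hl (Eventually.of_forall fun s => ?_)
  simp only [gradientFactor]
  ring

theorem symbol_gradientFactor (hm : 0 ≤ m) (h : IsSmoothProfile m w p q κ) :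
    IsSymbolReal 2 0 (gradientFactor m p κ) := by
  have hl := isEnd_atTop
  refine (((h.symbol_gradientFactor_sub hm).weaken hl (show (-1 : ℤ) ≤ 0 by norm_num)).add hl
    (IsSymbol.const 1 2)).congr' hl (Eventually.of_forall fun s => ?_)
  simp

theorem symbol_scalarProfile (hm : 0 ≤ m) (h : IsSmoothProfile m w p q κ) :
    IsSymbolReal 2 (-1) (scalarProfile m p κ) := by
  have hl := isEnd_atTop
  exact (((h.symbol_κ hm).const_mul hl m).add hl ((h.symbol_p hm).1.const_mul hl 2)).const_mul hl
    (m + 1)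

theorem gradientFactor_ge_one (hm : 0 ≤ m) (h : IsSmoothProfile m w p q κ) {s : ℝ} (hs : 0 ≤ s) :
    1 ≤ gradientFactor m p κ s := by
  have h1 := h.p_pos s hs
  have h2 := mul_nonneg hm (h.κ_pos s hs).le
  unfold gradientFactor
  linarith

theorem scalarProfile_pos (hm : 0 ≤ m) (h : IsSmoothProfile m w p q κ) {s : ℝ} (hs : 0 ≤ s) :
    0 < scalarProfile m p κ s := by
  have h1 := h.p_pos s hs
  have h2 := mul_nonneg hm (h.κ_pos s hs).le
  unfold scalarProfile
  positivity

theorem four_mul_potential {s : ℝ} (hs : 0 < s) (h : IsSmoothProfile m w p q κ) :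
    4 * potential m w p κ s = s * potentialRatio m w p κ s := by
  have hw := (h.w_pos s hs.le).ne'
  unfold potential potentialRatio
  field_simp

theorem potentialRatio_ge_one (hm : 0 ≤ m) (h : IsSmoothProfile m w p q κ) {s : ℝ} (hs : 0 < s) :
    1 ≤ potentialRatio m w p κ s := by
  have h1 := h.gradientFactor_ge_one hm hs.le
  have h2 := h.scalarProfile_pos hm hs.le
  have hw := h.w_pos s hs.le
  have h3 : 1 ≤ gradientFactor m p κ s ^ 2 / w s := by
    rw [le_div_iff₀ hw]
    nlinarith [h.w_lt_one hs]
  have h4 : 0 ≤ 4 * scalarProfile m p κ s * s⁻¹ := by positivity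
  unfold potentialRatio
  linarith

theorem symbol_potentialRatio (hm : 0 ≤ m) (h : IsSmoothProfile m w p q κ) :
    IsSymbolReal 2 0 (potentialRatio m w p κ) := by
  have hl := isEnd_atTop
  obtain ⟨δ, hδ, hlow⟩ := h.eventually_w_ge
  refine (((h.symbol_gradientFactor hm).sq hl).div hl hδ (h.symbol_w hm) hlow).add hl ?_
  exact ((((h.symbol_scalarProfile hm).const_mul hl 4).mul hl (IsSymbolReal.inv 2))).weaken hl
    (by norm_num)

/-- This function is `f / |∇f|² - 1`, the radial coefficient of `F^* g` minus that of the cone. -/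
theorem symbol_radial_error (hm : 0 ≤ m) (h : IsSmoothProfile m w p q κ) :
    IsSymbolReal 2 (-1) fun s =>
      4 * scalarProfile m p κ s * s⁻¹ * w s / gradientFactor m p κ s ^ 2 := by
  have hl := isEnd_atTop
  have h1 := (((h.symbol_scalarProfile hm).const_mul hl 4).mul hl (IsSymbolReal.inv 2)).mul hl
    (h.symbol_w hm)
  refine (h1.weaken hl (show (-1 + -1 + 0 : ℤ) ≤ -1 by norm_num)).div hl one_pos
    ((h.symbol_gradientFactor hm).sq hl) ?_
  filter_upwards [eventually_gt_atTop 0] with s hs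
  nlinarith [h.gradientFactor_ge_one hm hs.le]

/-- With `V = potentialRatio`, the tangential coefficient of `F^* g` is `s / (4 f) = 1 / V`, and `1
- W V = ((w - W) - W (Φ² - 1)) / w - 4 W R / s`, where every term decays. -/
theorem symbol_tangential_error (hm : 0 ≤ m) (h : IsSmoothProfile m w p q κ) {W : ℝ}
    (hW : (fun s => w s - W) =O[atTop] fun t => t ^ (-1 : ℤ)) :
    IsSymbolReal 2 (-1) fun s => 1 / potentialRatio m w p κ s - W := by
  have hl := isEnd_atTop
  obtain ⟨δ, hδ, hlow⟩ := h.eventually_w_ge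
  have hΦ := h.symbol_gradientFactor_sub hm
  have hΦ' := h.symbol_gradientFactor hm
  have h1 : IsSymbolReal 2 (-1) fun s => (gradientFactor m p κ s - 1) *
      (gradientFactor m p κ s + 1) := by
    simpa using hΦ.mul hl (hΦ'.add hl (IsSymbol.const 1 2))
  have h2 := ((h.symbol_w_sub hm hW).sub hl (h1.const_mul hl W)).div hl hδ (h.symbol_w hm) hlow
  have h3 := ((((h.symbol_scalarProfile hm).const_mul hl (4 * W)).mul hl
    (IsSymbolReal.inv 2))).weaken hl (show (-1 + -1 : ℤ) ≤ -1 by norm_num)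
  refine ((h2.sub hl h3).div hl one_pos (h.symbol_potentialRatio hm) ?_).congr' hl ?_
  · filter_upwards [eventually_gt_atTop 0] with s hs using h.potentialRatio_ge_one hm hs
  · filter_upwards [eventually_gt_atTop 0] with s hs
    have hV := (one_pos.trans_le (h.potentialRatio_ge_one hm hs)).ne'
    have hw := (h.w_pos s hs.le).ne'
    rw [div_eq_iff hV]
    have e : (1 / potentialRatio m w p κ s - W) * potentialRatio m w p κ s =
        1 - W * potentialRatio m w p κ s := by
      field_simp
    rw [e, potentialRatio]
    field_simp
    ring

end IsSmoothProfile

/-! ### Inverting the potential -/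

/-- A smooth left inverse of a real function is smooth where the derivative does not vanish. -/
theorem contDiffAt_of_left_inverse {f g : ℝ → ℝ} {f' a : ℝ} (hf : ContDiffAt ℝ ∞ f a)
    (hd : HasDerivAt f f' a) (hf' : f' ≠ 0) (hg : ∀ᶠ x in 𝓝 a, g (f x) = x) :
    ContDiffAt ℝ ∞ g (f a) ∧ HasDerivAt g f'⁻¹ (f a) := by
  have hne : (∞ : WithTop ℕ∞) ≠ 0 := by simp
  have hs : HasStrictDerivAt f f' a := hf.hasStrictDerivAt' hd hne
  refine ⟨?_, (hs.to_local_left_inverse hf' hg).hasDerivAt⟩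
  have he := hd.hasFDerivAt_equiv hf'
  exact (hf.to_localInverse he hne).congr_of_eventuallyEq
    ((hf.hasStrictFDerivAt' he hne).localInverse_unique hg)

/-- `σ` inverts `s ↦ 4 f`, where `f` is the potential as a function of `s = |x|²`. -/
structure IsLevelInverse (m : ℝ) (w p κ σ : ℝ → ℝ) : Prop where
  pos : ∀ t, 4 * potential m w p κ 0 < t → 0 < σ t
  right_inv : ∀ t, 4 * potential m w p κ 0 < t → 4 * potential m w p κ (σ t) = t
  left_inv : ∀ s, 0 < s → σ (4 * potential m w p κ s) = s
  lt : ∀ s, 0 < s → 4 * potential m w p κ 0 < 4 * potential m w p κ s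
  contDiffAt : ∀ t, 4 * potential m w p κ 0 < t → ContDiffAt ℝ ∞ σ t
  hasDerivAt : ∀ t, 4 * potential m w p κ 0 < t →
    HasDerivAt σ (w (σ t) / gradientFactor m p κ (σ t)) t

/-- The derivative of `4 f` in `s` is `Φ / w > 0`, and `4 f ≥ s` makes it reach every value above
its value at `0`. -/
theorem IsSmoothProfile.exists_isLevelInverse {m : ℝ} {w p q κ : ℝ → ℝ} (hm : 0 ≤ m)
    (h : IsSmoothProfile m w p q κ) : ∃ σ, IsLevelInverse m w p κ σ := by
  set P : ℝ → ℝ := fun s => 4 * potential m w p κ s with hP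
  have hsm : ContDiffOn ℝ ∞ P (Ici 0) := contDiffOn_const.mul h.smooth_potential
  have hd : ∀ s, 0 < s → HasDerivAt P (gradientFactor m p κ s / w s) s := fun s hs =>
    (((h.deriv_potential hs.le).hasDerivAt (Ici_mem_nhds hs)).const_mul 4).congr_deriv (by
      have := (h.w_pos s hs.le).ne'
      field_simp)
  have hΦ : ∀ s, 0 ≤ s → 0 < gradientFactor m p κ s := fun s hs =>
    one_pos.trans_le (h.gradientFactor_ge_one hm hs)
  have hmono : StrictMonoOn P (Ici 0) := by
    refine strictMonoOn_of_deriv_pos (convex_Ici 0) hsm.continuousOn fun s hs => ?_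
    rw [interior_Ici] at hs
    rw [(hd s hs).deriv]
    exact div_pos (hΦ s (le_of_lt hs)) (h.w_pos s (le_of_lt hs))
  have hge : ∀ s, 0 < s → s ≤ P s := fun s hs => by
    have h1 : P s = s * potentialRatio m w p κ s := h.four_mul_potential hs
    rw [h1]
    nlinarith [h.potentialRatio_ge_one hm hs]
  have hsurj : ∀ t, P 0 < t → ∃ s, 0 < s ∧ P s = t := by
    intro t ht
    have hb : 0 < max t 1 := lt_max_of_lt_right one_pos
    obtain ⟨s, hs, rfl⟩ := intermediate_value_Icc hb.le
      (hsm.continuousOn.mono Icc_subset_Ici_self) ⟨ht.le, (le_max_left t 1).trans (hge _ hb)⟩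
    rcases hs.1.eq_or_lt with h0 | h0
    · exact absurd ht (by rw [← h0]; exact lt_irrefl _)
    · exact ⟨s, h0, rfl⟩
  choose! σ hσ0 hσ using hsurj
  have hlt : ∀ s, 0 < s → P 0 < P s := fun s hs => hmono self_mem_Ici hs.le hs
  have hleft : ∀ s, 0 < s → σ (P s) = s := fun s hs =>
    hmono.injOn (hσ0 _ (hlt s hs)).le hs.le (hσ _ (hlt s hs))
  have key : ∀ t, P 0 < t → ContDiffAt ℝ ∞ σ t ∧
      HasDerivAt σ (w (σ t) / gradientFactor m p κ (σ t)) t := by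
    intro t ht
    have hs := hσ0 t ht
    have h1 := contDiffAt_of_left_inverse (g := σ) (hsm.contDiffAt (Ici_mem_nhds hs)) (hd _ hs)
      (div_pos (hΦ _ hs.le) (h.w_pos _ hs.le)).ne'
      (by filter_upwards [Ioi_mem_nhds hs] with s hs' using hleft s hs')
    rw [hσ t ht, inv_div] at h1
    exact h1
  exact ⟨σ, hσ0, hσ, hleft, hlt, fun t ht => (key t ht).1, fun t ht => (key t ht).2⟩

namespace IsLevelInverse

variable {m : ℝ} {w p q κ σ : ℝ → ℝ}

theorem eq_mul_potentialRatio (h : IsSmoothProfile m w p q κ) (hσ : IsLevelInverse m w p κ σ)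
    {t : ℝ} (ht : 4 * potential m w p κ 0 < t) : t = σ t * potentialRatio m w p κ (σ t) := by
  rw [← h.four_mul_potential (hσ.pos t ht), hσ.right_inv t ht]

theorem exists_potentialRatio_le (hm : 0 ≤ m) (h : IsSmoothProfile m w p q κ) :
    ∃ C, 0 < C ∧ ∃ s₀, 0 ≤ s₀ ∧ ∀ s, s₀ < s → potentialRatio m w p κ s ≤ C := by
  obtain ⟨C, hC0, hC⟩ := (h.symbol_potentialRatio hm).isBigO.exists_pos
  obtain ⟨a, ha⟩ := eventually_atTop.mp hC.bound
  refine ⟨C, hC0, max a 0, le_max_right _ _, fun s hs => ?_⟩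
  have := ha s ((le_max_left _ _).trans hs.le)
  simp only [zpow_zero, norm_one, mul_one] at this
  exact (le_abs_self _).trans this

theorem tendsto_atTop (h : IsSmoothProfile m w p q κ)
    (hσ : IsLevelInverse m w p κ σ) : Tendsto σ atTop atTop := by
  refine tendsto_atTop_atTop.mpr fun b => ?_
  obtain ⟨M, hM⟩ := (isCompact_Icc (a := (0 : ℝ)) (b := b)).bddAbove_image
    ((contDiffOn_const.mul h.smooth_potential).continuousOn.mono Icc_subset_Ici_self :
      ContinuousOn (fun s => 4 * potential m w p κ s) (Icc 0 b))
  refine ⟨max M (4 * potential m w p κ 0) + 1, fun t ht => ?_⟩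
  have h1 : 4 * potential m w p κ 0 < t := by linarith [le_max_right M (4 * potential m w p κ 0)]
  by_contra! hb
  have h2 := hM (mem_image_of_mem _ (⟨(hσ.pos t h1).le, hb.le⟩ : σ t ∈ Icc 0 b))
  rw [hσ.right_inv t h1] at h2
  linarith [le_max_left M (4 * potential m w p κ 0)]

theorem isTheta (hm : 0 ≤ m) (h : IsSmoothProfile m w p q κ) (hσ : IsLevelInverse m w p κ σ) :
    σ =Θ[atTop] fun t => t ^ (1 : ℤ) := by
  obtain ⟨C, hC, s₀, hs₀, hb⟩ := exists_potentialRatio_le hm h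
  have hev := (eventually_gt_atTop (4 * potential m w p κ 0)).and
    ((hσ.tendsto_atTop h).eventually_gt_atTop s₀)
  simp only [zpow_one]
  constructor
  · refine IsBigO.of_bound 1 ?_
    filter_upwards [hev] with t ⟨ht, hs⟩
    have h1 := hσ.eq_mul_potentialRatio h ht
    have h2 := hσ.pos t ht
    have h3 := h.potentialRatio_ge_one hm h2
    have h4 : σ t ≤ t := by nlinarith
    rw [Real.norm_of_nonneg h2.le, Real.norm_of_nonneg (h2.le.trans h4), one_mul]
    exact h4
  · refine IsBigO.of_bound C ?_
    filter_upwards [hev] with t ⟨ht, hs⟩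
    have h1 := hσ.eq_mul_potentialRatio h ht
    have h2 := hσ.pos t ht
    have h3 := h.potentialRatio_ge_one hm h2
    have h4 : σ t ≤ t := by nlinarith
    rw [Real.norm_of_nonneg h2.le, Real.norm_of_nonneg (h2.le.trans h4)]
    nlinarith [hb _ hs]

/-- Since `σ' = (w / Φ) ∘ σ`, each derivative controlled for `σ` yields the next one. -/
theorem symbol (hm : 0 ≤ m) (h : IsSmoothProfile m w p q κ) (hσ : IsLevelInverse m w p κ σ) :
    IsSymbolReal 2 1 σ := by
  have hl := isEnd_atTop
  have ht := hσ.tendsto_atTop h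
  have hE : IsSymbolReal 2 0 fun s => w s / gradientFactor m p κ s :=
    (h.symbol_w hm).div hl one_pos (h.symbol_gradientFactor hm)
      (by filter_upwards [eventually_ge_atTop 0] with s hs using h.gradientFactor_ge_one hm hs)
  have hd : ∀ᶠ t in atTop, HasDerivAt σ (w (σ t) / gradientFactor m p κ (σ t)) t := by
    filter_upwards [eventually_gt_atTop (4 * potential m w p κ 0)] with t ht using
      hσ.hasDerivAt t ht
  have hO := (hσ.isTheta hm h).1
  have h0 : IsSymbolReal 0 1 σ := hO
  have h1 : IsSymbolReal 1 1 σ := IsSymbolReal.of_hasDerivAt hd hO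
    (by simpa using IsSymbol.comp hl hE.pred.pred h0 ht (hσ.isTheta hm h))
  exact IsSymbolReal.of_hasDerivAt hd hO
    (by simpa using IsSymbol.comp hl hE.pred h1 ht (hσ.isTheta hm h))

end IsLevelInverse

/-! ### Radial maps -/

/-- The map `x ↦ φ(|x|²) x`. -/
def radialMap (φ : ℝ → ℝ) (x : E n) : E n := φ (‖x‖ ^ 2) • x

theorem norm_sq_radialMap (φ : ℝ → ℝ) (x : E n) :
    ‖radialMap φ x‖ ^ 2 = φ (‖x‖ ^ 2) ^ 2 * ‖x‖ ^ 2 := by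
  rw [radialMap, norm_smul, mul_pow, Real.norm_eq_abs, sq_abs]

theorem contDiffAt_radialMap {φ : ℝ → ℝ} {x : E n} (h : ContDiffAt ℝ ∞ φ (‖x‖ ^ 2)) :
    ContDiffAt ℝ ∞ (radialMap φ) x :=
  ContDiffAt.smul (h.comp x (contDiff_norm_sq ℝ).contDiffAt) contDiffAt_id

theorem HasPDeriv.radialMap {φ : ℝ → ℝ} {φ' : ℝ} {x : E n} (h : HasDerivAt φ φ' (‖x‖ ^ 2))
    (a : Fin n) : HasPDeriv (fun y => radialMap φ y a)
      (fun i => φ (‖x‖ ^ 2) * (if i = a then 1 else 0) + 2 * φ' * (x i * x a)) x :=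
  ((HasPDeriv.radial h.hasDerivWithinAt).mul (HasPDeriv.coord a x)).congr_deriv fun i => by ring

theorem fderiv_radialMap_smul_self {φ : ℝ → ℝ} {φ' : ℝ} {x : E n}
    (h : HasDerivAt φ φ' (‖x‖ ^ 2)) (c : ℝ) :
    fderiv ℝ (radialMap φ) x (c • x) = (c * (φ (‖x‖ ^ 2) + 2 * φ' * ‖x‖ ^ 2)) • x := by
  have h1 : HasFDerivAt (fun y : E n => ‖y‖ ^ 2) (2 • innerSL ℝ x) x :=
    (hasStrictFDerivAt_norm_sq x).hasFDerivAt
  have h2 := (h.comp_hasFDerivAt x h1).smul (hasFDerivAt_id x)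
  have h3 : fderiv ℝ (radialMap φ) x = _ := h2.fderiv
  rw [h3]
  simp only [Function.comp_apply, id_eq, add_apply,
    smul_apply, ContinuousLinearMap.id_apply,
    ContinuousLinearMap.smulRight_apply, innerSL_apply_apply, real_inner_smul_right,
    real_inner_self_eq_norm_sq, smul_smul, ← add_smul, smul_eq_mul, nsmul_eq_mul]
  congr 1
  push_cast
  ring

theorem pullback_radialMap {φ ψ : ℝ → ℝ} {φ' : ℝ} {x : E n} (h : HasDerivAt φ φ' (‖x‖ ^ 2))
    (i j : Fin n) :
    pullback (radialMap φ) (radialMetric ψ) x i j =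
      φ (‖x‖ ^ 2) ^ 2 * (if i = j then 1 else 0) +
      (4 * φ (‖x‖ ^ 2) * φ' + 4 * φ' ^ 2 * ‖x‖ ^ 2 +
        ψ (‖radialMap φ x‖ ^ 2) * φ (‖x‖ ^ 2) ^ 2 * (φ (‖x‖ ^ 2) + 2 * φ' * ‖x‖ ^ 2) ^ 2) *
        (x i * x j) := by
  set u : Fin n → E n := fun i => φ (‖x‖ ^ 2) • EuclideanSpace.single i 1 + (2 * φ' * x i) • x
  have hu : ∀ i a, pderiv i (fun y => radialMap φ y a) x = u i a := by
    intro i a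
    rw [(HasPDeriv.radialMap h a).2 i]
    simp [u, PiLp.single_apply, eq_comm]
    ring
  have h1 : pullback (radialMap φ) (radialMetric ψ) x i j =
      metricInner (radialMetric ψ) (radialMap φ x) (u i) (u j) := by
    simp only [pullback, Matrix.of_apply, metricInner, hu]
  have hs : ∀ i, inner ℝ x (EuclideanSpace.single i (1 : ℝ)) = x i := fun i => by
    simp [EuclideanSpace.inner_single_right]
  have hs' : ∀ i, inner ℝ (EuclideanSpace.single i (1 : ℝ)) x = x i := fun i => by
    simp [EuclideanSpace.inner_single_left]
  have hss : inner ℝ (EuclideanSpace.single i (1 : ℝ)) (EuclideanSpace.single j (1 : ℝ)) =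
      if i = j then (1 : ℝ) else 0 := by
    simp [EuclideanSpace.inner_single_left, PiLp.single_apply]
  rw [h1, metricInner_radialMetric]
  simp only [u, radialMap, inner_add_left, inner_add_right, real_inner_smul_left,
    real_inner_smul_right, hs, hs', hss, real_inner_self_eq_norm_sq]
  ring

/-! ### The parametrization of the end by level sets of the potential -/

/-- The map `x ↦ √(σ(|x|²)) x / |x|`. -/
def levelMap (σ : ℝ → ℝ) : E n → E n := radialMap fun t => Real.sqrt (σ t / t)

namespace IsLevelInverse

variable {m : ℝ} {w p q κ σ : ℝ → ℝ}

/-- At the origin the gradient vanishes, so `f` equals the scalar curvature there. This makes the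
inner radius `2 √f(0)` of the end positive. -/
theorem potential_zero_pos (hm : 0 ≤ m) (h : IsSmoothProfile m w p q κ) :
    0 < 4 * potential m w p κ 0 := by
  have := h.scalarProfile_pos hm le_rfl
  simp only [potential, zero_mul, zero_div, zero_add]
  linarith

theorem hasDerivAt_sqrt (hm : 0 ≤ m) (h : IsSmoothProfile m w p q κ)
    (hσ : IsLevelInverse m w p κ σ) {t : ℝ} (ht : 4 * potential m w p κ 0 < t) :
    HasDerivAt (fun t => Real.sqrt (σ t / t))
      ((w (σ t) / gradientFactor m p κ (σ t) - σ t / t) / (2 * t * Real.sqrt (σ t / t))) t := by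
  have ht0 := (potential_zero_pos hm h).trans ht
  have h1 := div_pos (hσ.pos t ht) ht0
  have h2 := (hσ.hasDerivAt t ht).div (hasDerivAt_id t) ht0.ne'
  refine (h2.sqrt h1.ne').congr_deriv ?_
  have h3 := (Real.sqrt_pos.mpr h1).ne'
  simp only [id_eq, mul_one]
  change _ / (2 * Real.sqrt (σ t / t)) = _
  field_simp

theorem contDiffAt_sqrt (hm : 0 ≤ m) (h : IsSmoothProfile m w p q κ)
    (hσ : IsLevelInverse m w p κ σ) {t : ℝ} (ht : 4 * potential m w p κ 0 < t) :
    ContDiffAt ℝ ∞ (fun t => Real.sqrt (σ t / t)) t := by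
  have ht0 := (potential_zero_pos hm h).trans ht
  exact ((hσ.contDiffAt t ht).div contDiffAt_id ht0.ne').sqrt (div_pos (hσ.pos t ht) ht0).ne'

theorem norm_sq_levelMap (hm : 0 ≤ m) (h : IsSmoothProfile m w p q κ)
    (hσ : IsLevelInverse m w p κ σ) {x : E n} (hx : 4 * potential m w p κ 0 < ‖x‖ ^ 2) :
    ‖levelMap σ x‖ ^ 2 = σ (‖x‖ ^ 2) := by
  have ht0 := (potential_zero_pos hm h).trans hx
  rw [levelMap, norm_sq_radialMap, Real.sq_sqrt (div_pos (hσ.pos _ hx) ht0).le,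
    div_mul_cancel₀ _ ht0.ne']

/-- The inverse of the parametrization by level sets. -/
def inverseMap (m : ℝ) (w p κ : ℝ → ℝ) : E n → E n :=
  radialMap fun s => Real.sqrt (4 * potential m w p κ s / s)

theorem inverseMap_levelMap (hm : 0 ≤ m) (h : IsSmoothProfile m w p q κ)
    (hσ : IsLevelInverse m w p κ σ) {x : E n} (hx : 4 * potential m w p κ 0 < ‖x‖ ^ 2) :
    inverseMap m w p κ (levelMap σ x) = x := by
  have ht0 := (potential_zero_pos hm h).trans hx
  have hs := hσ.pos _ hx
  rw [inverseMap, radialMap, hσ.norm_sq_levelMap hm h hx, hσ.right_inv _ hx, levelMap, radialMap,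
    smul_smul, ← Real.sqrt_mul (div_pos ht0 hs).le, div_mul_div_cancel₀ hs.ne', div_self ht0.ne',
    Real.sqrt_one, one_smul]

theorem norm_sq_inverseMap (hm : 0 ≤ m) (h : IsSmoothProfile m w p q κ)
    (hσ : IsLevelInverse m w p κ σ) {y : E n} (hy : 0 < ‖y‖ ^ 2) :
    ‖inverseMap m w p κ y‖ ^ 2 = 4 * potential m w p κ (‖y‖ ^ 2) := by
  have h1 := (potential_zero_pos hm h).trans (hσ.lt _ hy)
  rw [inverseMap, norm_sq_radialMap, Real.sq_sqrt (div_pos h1 hy).le, div_mul_cancel₀ _ hy.ne']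

theorem levelMap_inverseMap (hm : 0 ≤ m) (h : IsSmoothProfile m w p q κ)
    (hσ : IsLevelInverse m w p κ σ) {y : E n} (hy : 0 < ‖y‖ ^ 2) :
    levelMap σ (inverseMap m w p κ y) = y := by
  have h1 := (potential_zero_pos hm h).trans (hσ.lt _ hy)
  rw [levelMap, radialMap, hσ.norm_sq_inverseMap hm h hy, hσ.left_inv _ hy, inverseMap, radialMap,
    smul_smul, ← Real.sqrt_mul (div_pos hy h1).le, div_mul_div_cancel₀ h1.ne', div_self hy.ne',
    Real.sqrt_one, one_smul]

theorem image_levelMap (hm : 0 ≤ m) (h : IsSmoothProfile m w p q κ)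
    (hσ : IsLevelInverse m w p κ σ) :
    levelMap σ '' {x : E n | 4 * potential m w p κ 0 < ‖x‖ ^ 2} = {0}ᶜ := by
  ext y
  constructor
  · rintro ⟨x, hx, rfl⟩ h0
    have h1 := hσ.norm_sq_levelMap hm h hx
    rw [mem_singleton_iff.mp h0, norm_zero] at h1
    have := hσ.pos _ hx
    norm_num at h1
    linarith
  · intro hy
    have hy' : 0 < ‖y‖ ^ 2 := by
      have := norm_pos_iff.mpr hy
      positivity
    refine ⟨inverseMap m w p κ y, ?_, hσ.levelMap_inverseMap hm h hy'⟩
    change 4 * potential m w p κ 0 < ‖inverseMap m w p κ y‖ ^ 2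
    rw [hσ.norm_sq_inverseMap hm h hy']
    exact hσ.lt _ hy'

theorem contDiffAt_inverseMap (hm : 0 ≤ m) (h : IsSmoothProfile m w p q κ)
    (hσ : IsLevelInverse m w p κ σ) {y : E n} (hy : 0 < ‖y‖ ^ 2) :
    ContDiffAt ℝ ∞ (inverseMap m w p κ) y := by
  have h1 := (potential_zero_pos hm h).trans (hσ.lt _ hy)
  refine contDiffAt_radialMap (ContDiffAt.sqrt (ContDiffAt.div ?_ contDiffAt_id hy.ne')
    (div_pos h1 hy).ne')
  exact contDiffAt_const.mul (h.smooth_potential.contDiffAt (Ici_mem_nhds hy))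

theorem potential_levelMap (hm : 0 ≤ m) (h : IsSmoothProfile m w p q κ)
    (hσ : IsLevelInverse m w p κ σ) {x : E n} (hx : 4 * potential m w p κ 0 < ‖x‖ ^ 2) :
    potential m w p κ (‖levelMap σ x‖ ^ 2) = ‖x‖ ^ 2 / 4 := by
  rw [hσ.norm_sq_levelMap hm h hx, eq_div_iff four_ne_zero, mul_comm, hσ.right_inv _ hx]

/-- Both sides are multiples of `x`. On the left the radius `√σ(r²)` has derivative `r σ' / √σ` with
`σ' = w / Φ`; on the right `√f = r / 2` and `|∇f|² = s Φ² / (4 w)`. -/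
theorem fderiv_levelMap (hm : 0 ≤ m) (h : IsSmoothProfile m w p q κ)
    (hσ : IsLevelInverse m w p κ σ) {x : E n} (hx : 4 * potential m w p κ 0 < ‖x‖ ^ 2) :
    fderiv ℝ (levelMap σ) x (‖x‖⁻¹ • x) =
      (Real.sqrt (potential m w p κ (‖levelMap σ x‖ ^ 2)) /
        metricInner (warpedMetric w) (levelMap σ x)
          (grad (warpedMetric w) (fun y => potential m w p κ (‖y‖ ^ 2)) (levelMap σ x))
          (grad (warpedMetric w) (fun y => potential m w p κ (‖y‖ ^ 2)) (levelMap σ x))) •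
        grad (warpedMetric w) (fun y => potential m w p κ (‖y‖ ^ 2)) (levelMap σ x) := by
  have ht0 := (potential_zero_pos hm h).trans hx
  have hr : 0 < ‖x‖ := by
    rcases (norm_nonneg x).eq_or_lt with h0 | h0
    · rw [← h0] at ht0; norm_num at ht0
    · exact h0
  have hs := hσ.pos _ hx
  have hw := h.w_pos _ hs.le
  have hΦ := one_pos.trans_le (h.gradientFactor_ge_one hm hs.le)
  have he := h.eq_κ _ hs.le
  have h1 := div_pos hs ht0
  have hb := Real.sqrt_pos.mpr h1
  have hb2 := Real.sq_sqrt h1.le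
  rw [hσ.potential_levelMap hm h hx, h.grad_potential, h.warpedMetric_eq,
    metricInner_radialMetric]
  simp only [real_inner_smul_left, real_inner_smul_right]
  simp only [real_inner_self_eq_norm_sq]
  rw [hσ.norm_sq_levelMap hm h hx]
  have h4 : Real.sqrt (‖x‖ ^ 2 / 4) = ‖x‖ / 2 := by
    rw [show ‖x‖ ^ 2 / 4 = (‖x‖ / 2) ^ 2 by ring, Real.sqrt_sq (by positivity)]
  rw [h4, levelMap, fderiv_radialMap_smul_self (hσ.hasDerivAt_sqrt hm h hx), radialMap, smul_smul,
    smul_smul]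
  congr 1
  set s := σ (‖x‖ ^ 2)
  set b := Real.sqrt (s / ‖x‖ ^ 2)
  set Φ := gradientFactor m p κ s
  have hsb : s = b ^ 2 * ‖x‖ ^ 2 := by rw [hb2]; field_simp
  have hg : Φ / 2 * (Φ / 2 * s) + κ s / w s * (Φ / 2 * s * (Φ / 2 * s)) =
      s * Φ ^ 2 / (4 * w s) := by
    field_simp
    linear_combination (-4) * he
  rw [hg]
  have h5 : s * Φ ^ 2 / (4 * w s) ≠ 0 := by positivity
  have h6 : b + 2 * ((w s / Φ - s / ‖x‖ ^ 2) / (2 * ‖x‖ ^ 2 * b)) * ‖x‖ ^ 2 = w s / (Φ * b) := by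
    rw [← hb2]
    field_simp
    ring
  rw [h6]
  clear_value b Φ
  generalize w s = W at *
  have h7 : ‖x‖ / 2 / (s * Φ ^ 2 / (4 * W)) * (Φ / 2) * b = ‖x‖ * W * b / (s * Φ) := by
    field_simp
    ring
  rw [h7, hsb]
  field_simp

/-- The pull-back of the metric by the parametrization. -/
theorem pullback_levelMap (hm : 0 ≤ m) (h : IsSmoothProfile m w p q κ)
    (hσ : IsLevelInverse m w p κ σ) {x : E n} (hx : 4 * potential m w p κ 0 < ‖x‖ ^ 2) (W : ℝ)
    (i j : Fin n) :
    pullback (levelMap σ) (warpedMetric w) x i j - coneMetric (1 - W) x i j =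
      (1 / potentialRatio m w p κ (σ (‖x‖ ^ 2)) - W) *
        ((if i = j then 1 else 0) - x i * x j * (‖x‖ ^ 2)⁻¹) +
      4 * scalarProfile m p κ (σ (‖x‖ ^ 2)) * (σ (‖x‖ ^ 2))⁻¹ * w (σ (‖x‖ ^ 2)) /
        gradientFactor m p κ (σ (‖x‖ ^ 2)) ^ 2 * (x i * x j * (‖x‖ ^ 2)⁻¹) := by
  have ht0 := (potential_zero_pos hm h).trans hx
  have hs := hσ.pos _ hx
  have hw := h.w_pos _ hs.le
  have hΦ := one_pos.trans_le (h.gradientFactor_ge_one hm hs.le)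
  have he := h.eq_κ _ hs.le
  have h1 := div_pos hs ht0
  have hb := Real.sqrt_pos.mpr h1
  have hb2 := Real.sq_sqrt h1.le
  have hV := h.potentialRatio_ge_one hm hs
  have htV := hσ.eq_mul_potentialRatio h hx
  have hn := hσ.norm_sq_levelMap hm h hx
  rw [h.warpedMetric_eq]
  rw [levelMap] at hn ⊢
  rw [pullback_radialMap (hσ.hasDerivAt_sqrt hm h hx), hn]
  simp only [coneMetric, sphereForm, radialForm, Matrix.add_apply, Matrix.smul_apply,
    Matrix.sub_apply, Matrix.of_apply, smul_eq_mul, Matrix.one_apply]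
  have hRV : 4 * scalarProfile m p κ (σ (‖x‖ ^ 2)) * (σ (‖x‖ ^ 2))⁻¹ =
      potentialRatio m w p κ (σ (‖x‖ ^ 2)) -
        gradientFactor m p κ (σ (‖x‖ ^ 2)) ^ 2 / w (σ (‖x‖ ^ 2)) := by
    rw [potentialRatio]; ring
  rw [hRV]
  set t := ‖x‖ ^ 2
  set s := σ t
  set b := Real.sqrt (s / t)
  set Φ := gradientFactor m p κ s
  set V := potentialRatio m w p κ s
  have hV0 : 0 < V := one_pos.trans_le hV
  have hb3 : b ^ 2 = 1 / V := by rw [hb2, htV]; field_simp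
  have h6 : b + 2 * ((w s / Φ - s / t) / (2 * t * b)) * t = w s / (Φ * b) := by
    rw [← hb2]
    field_simp
    ring
  have h8 : 4 * b * ((w s / Φ - s / t) / (2 * t * b)) +
      4 * ((w s / Φ - s / t) / (2 * t * b)) ^ 2 * t =
      ((w s / (Φ * b)) ^ 2 - b ^ 2) / t := by
    rw [← h6]
    field_simp
    ring
  rw [h6, h8, show κ s / w s * b ^ 2 * (w s / (Φ * b)) ^ 2 = κ s * w s / Φ ^ 2 by field_simp,
    div_pow, mul_pow, hb3]
  have h9 : κ s = (1 - w s) / s := h.κ_eq hs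
  rw [h9]
  clear_value Φ b V
  generalize w s = u at *
  have hts : t = s * V := htV
  have h10 : u ^ 2 / (Φ ^ 2 * (1 / V)) / t + (1 - u) / s * u / Φ ^ 2 = u * V / (Φ ^ 2 * t) := by
    rw [hts]
    field_simp
    ring
  -- Here `u V / Φ²` is `f / |∇f|²`, the radial coefficient of the pull-back.
  have h11 : (V - Φ ^ 2 / u) * u / Φ ^ 2 = u * V / Φ ^ 2 - 1 := by
    field_simp
  rw [h11]
  linear_combination (x i * x j) * h10

end IsLevelInverse

/-! ### Symbols on Euclidean space -/

/-- Symbols on the end of `ℝⁿ`, with respect to the standard coordinate derivatives. -/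
abbrev IsSymbolE (j : ℕ) (k : ℤ) (f : E n → ℝ) : Prop :=
  IsSymbol (Bornology.cobounded (E n)) (range fun i => EuclideanSpace.single i (1 : ℝ))
    (fun x => ‖x‖) j k f

theorem eventually_cobounded_lt_norm (r : ℝ) : ∀ᶠ x in Bornology.cobounded (E n), r < ‖x‖ :=
  tendsto_norm_cobounded_atTop.eventually_gt_atTop r

theorem isEnd_cobounded : IsEnd (Bornology.cobounded (E n)) fun x => ‖x‖ where
  eventually_nhds {P} h := by
    rw [← comap_norm_atTop, eventually_comap] at h
    obtain ⟨a, ha⟩ := eventually_atTop.mp h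
    filter_upwards [eventually_cobounded_lt_norm a] with x hx
    filter_upwards [continuous_norm.continuousAt.eventually (lt_mem_nhds hx)] with y hy
    exact ha _ hy.le y rfl
  one_le := by
    filter_upwards [eventually_cobounded_lt_norm (n := n) 1] with x hx using hx.le

namespace IsSymbolE

variable {j : ℕ} {k : ℤ} {f : E n → ℝ}

theorem of_pderiv (hO : f =O[Bornology.cobounded (E n)] fun x => ‖x‖ ^ k)
    {d : Fin n → E n → ℝ}
    (hd : ∀ᶠ x in Bornology.cobounded (E n), HasPDeriv f (fun i => d i x) x)
    (h : ∀ i, IsSymbolE j (k - 1) (d i)) : IsSymbolE (j + 1) k f := by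
  refine ⟨hO, hd.mono fun x hx => hx.1, ?_⟩
  rintro _ ⟨i, rfl⟩
  refine (h i).congr' isEnd_cobounded ?_
  filter_upwards [hd] with x hx
  exact (hx.2 i).symm

theorem pderiv (h : IsSymbolE (j + 1) k f) (i : Fin n) :
    IsSymbolE j (k - 1) fun x => pderiv i f x :=
  h.2.2 _ ⟨i, rfl⟩

theorem coord (j : ℕ) (i : Fin n) : IsSymbolE j 1 fun x : E n => x i := by
  have hO : (fun x : E n => x i) =O[Bornology.cobounded (E n)] fun x => ‖x‖ ^ (1 : ℤ) := by
    refine IsBigO.of_bound 1 (Eventually.of_forall fun x => ?_)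
    simpa using PiLp.norm_apply_le x i
  cases j with
  | zero => exact hO
  | succ j =>
    refine of_pderiv hO (d := fun l _ => if l = i then 1 else 0)
      (Eventually.of_forall fun x => HasPDeriv.coord i x) fun l => ?_
    simpa using IsSymbol.const _ j

theorem norm_sq (j : ℕ) : IsSymbolE j 2 fun x : E n => ‖x‖ ^ 2 := by
  have hl := isEnd_cobounded (n := n)
  refine (IsSymbol.sum hl Finset.univ (k := 1 + 1) (f := fun i (x : E n) => x i * x i)
    fun i _ => (coord j i).mul hl (coord j i)).congr' hl (Eventually.of_forall fun x => ?_)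
  exact sum_mul_self x

theorem tendsto_norm_sq :
    Tendsto (fun x : E n => ‖x‖ ^ 2) (Bornology.cobounded (E n)) atTop :=
  (tendsto_pow_atTop two_ne_zero).comp tendsto_norm_cobounded_atTop

theorem comp_norm_sq {h : ℝ → ℝ} (hh : IsSymbolReal j k h) :
    IsSymbolE j (k * 2) fun x : E n => h (‖x‖ ^ 2) :=
  IsSymbol.comp isEnd_cobounded hh (norm_sq j) tendsto_norm_sq
    (by simpa using isTheta_refl (fun x : E n => ‖x‖ ^ 2) _)

theorem inv_norm_sq (j : ℕ) : IsSymbolE j (-2) fun x : E n => (‖x‖ ^ 2)⁻¹ :=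
  comp_norm_sq (IsSymbolReal.inv j)

theorem radialForm (j : ℕ) (a b : Fin n) :
    IsSymbolE j 0 fun x : E n => x a * x b * (‖x‖ ^ 2)⁻¹ := by
  have hl := isEnd_cobounded (n := n)
  exact ((coord j a).mul hl (coord j b)).mul hl (inv_norm_sq j)

end IsSymbolE

/-! ### The conical metric -/

theorem coneMetric_eq {α : ℝ} (hα : α < 1) {x : E n} (hx : x ≠ 0) :
    coneMetric α x = (1 - α) • radialMetric (fun s => α / (1 - α) / s) x := by
  have h1 : 1 - α ≠ 0 := by linarith
  have h2 : ‖x‖ ^ 2 ≠ 0 := by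
    have := norm_pos_iff.mpr hx
    positivity
  ext i j
  simp only [coneMetric, sphereForm, radialForm, radialMetric, Matrix.add_apply,
    Matrix.smul_apply, Matrix.sub_apply, Matrix.of_apply, smul_eq_mul, Matrix.one_apply]
  field_simp
  ring

theorem cone_inverse_factor {α t : ℝ} (hα : α < 1) (ht : t ≠ 0) :
    α / t * (1 + t * (α / (1 - α) / t)) = α / (1 - α) / t := by
  have h1 : 1 - α ≠ 0 := by linarith
  field_simp
  ring

theorem inv_coneMetric {α : ℝ} (hα : α < 1) {x : E n} (hx : x ≠ 0) :
    (coneMetric α x)⁻¹ = (1 - α)⁻¹ •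
      Matrix.of fun i j => (if i = j then 1 else 0) - α / ‖x‖ ^ 2 * (x i * x j) := by
  have h2 : ‖x‖ ^ 2 ≠ 0 := by
    have := norm_pos_iff.mpr hx
    positivity
  rw [coneMetric_eq hα hx, inv_radialMetric (by linarith) (cone_inverse_factor hα h2)]

theorem christoffel_coneMetric {α : ℝ} (hα : α < 1) {x : E n} (hx : x ≠ 0) (k i j : Fin n) :
    christoffel (coneMetric α) x k i j =
      x k * (‖x‖ ^ 2)⁻¹ * (α * ((if i = j then 1 else 0) - x i * x j * (‖x‖ ^ 2)⁻¹)) := by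
  have h1 : 1 - α ≠ 0 := by linarith
  have h2 : ‖x‖ ^ 2 ≠ 0 := by
    have := norm_pos_iff.mpr hx
    positivity
  have hg : coneMetric α =ᶠ[𝓝 x] fun y => (1 - α) • radialMetric (fun s => α / (1 - α) / s) y := by
    filter_upwards [isOpen_ne.mem_nhds hx] with y hy using coneMetric_eq hα hy
  have hd : HasDerivWithinAt (fun s => α / (1 - α) / s) (-(α / (1 - α)) / (‖x‖ ^ 2) ^ 2) (Ici 0)
      (‖x‖ ^ 2) := by
    refine (((hasDerivAt_inv h2).const_mul (α / (1 - α))).congr_deriv ?_).hasDerivWithinAt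
    ring
  rw [christoffel_of_eventuallyEq h1 hg (cone_inverse_factor hα h2) hd]
  split_ifs <;> field_simp <;> ring

/-- In Cartesian coordinates these symbols are smooth off the origin and homogeneous of degree `-1`.
-/
theorem symbol_christoffel_coneMetric {α : ℝ} (hα : α < 1) (j : ℕ) (k a b : Fin n) :
    IsSymbolE j (-1) fun x : E n => christoffel (coneMetric α) x k a b := by
  have hl := isEnd_cobounded (n := n)
  have h1 := ((IsSymbolE.coord j k).mul hl (IsSymbolE.inv_norm_sq j)).mul hl
    (((IsSymbol.const (if a = b then 1 else 0) j).sub hl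
      (IsSymbolE.radialForm j a b)).const_mul hl α)
  refine h1.congr' hl ?_
  filter_upwards [eventually_cobounded_lt_norm 0] with x hx
  rw [christoffel_coneMetric hα (norm_pos_iff.mp hx)]

/-- The covariant derivative with respect to a conical metric improves the decay by one order. -/
theorem symbol_covDeriv {α : ℝ} (hα : α < 1) {m j : ℕ} {k : ℤ}
    {T : E n → (Fin m → Fin n) → ℝ} (hT : ∀ I, IsSymbolE (j + 1) k fun x => T x I)
    (I : Fin (m + 1) → Fin n) :
    IsSymbolE j (k - 1) fun x => covDeriv (coneMetric α) T x I := by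
  have hl := isEnd_cobounded (n := n)
  refine (IsSymbolE.pderiv (hT _) _).sub hl (IsSymbol.sum hl _ fun p _ =>
    IsSymbol.sum hl _ fun l _ => ?_)
  have := (symbol_christoffel_coneMetric hα j l (I 0) (I p.succ)).mul hl
    (hT (Function.update (Fin.tail I) p l)).pred
  rwa [neg_add_eq_sub] at this

/-- The index `i` counts the derivatives still available after `j` have been spent. -/
theorem symbol_iterCovDeriv {α : ℝ} (hα : α < 1) {m : ℕ} {k : ℤ} {T : E n → (Fin m → Fin n) → ℝ}
    (j : ℕ) : ∀ {i : ℕ}, (∀ I, IsSymbolE (i + j) k fun x => T x I) → ∀ I,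
    IsSymbolE i (k - j) fun x => iterCovDeriv (coneMetric α) T j x I := by
  induction j with
  | zero => intro i hT I; simpa [iterCovDeriv] using hT I
  | succ j ih =>
    intro i hT I
    have := symbol_covDeriv hα (ih (i := i + 1) fun I => by
      rw [show i + 1 + j = i + (j + 1) by ring]; exact hT I) I
    rw [show k - ((j + 1 : ℕ) : ℤ) = k - j - 1 by push_cast; ring]
    exact this

theorem isBigO_inv_coneMetric {α : ℝ} (hα : α < 1) (a b : Fin n) :
    (fun x : E n => (coneMetric α x)⁻¹ a b) =O[Bornology.cobounded (E n)] fun _ => (1 : ℝ) := by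
  have hl := isEnd_cobounded (n := n)
  have h1 := ((IsSymbol.const (if a = b then 1 else 0) 0).sub hl
    ((IsSymbolE.radialForm 0 a b).const_mul hl α)).const_mul hl (1 - α)⁻¹
  have h2 := h1.isBigO
  simp only [zpow_zero] at h2
  refine h2.congr' ?_ EventuallyEq.rfl
  filter_upwards [eventually_cobounded_lt_norm 0] with x hx
  rw [inv_coneMetric hα (norm_pos_iff.mp hx)]
  simp only [Matrix.smul_apply, Matrix.of_apply, smul_eq_mul]
  ring

/-- The inverse cone metric has bounded Cartesian components, so bounds on components bound the
norm. -/
theorem isBigO_tensorNorm {α : ℝ} (hα : α < 1) {m : ℕ} {T : E n → (Fin m → Fin n) → ℝ}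
    {ρ : E n → ℝ} (hT : ∀ I, (fun x => T x I) =O[Bornology.cobounded (E n)] ρ) :
    (fun x => tensorNorm (coneMetric α) T x) =O[Bornology.cobounded (E n)] ρ := by
  have h1 : (fun x => ∑ I : Fin m → Fin n, ∑ J : Fin m → Fin n,
      (∏ p, (coneMetric α x)⁻¹ (I p) (J p)) * T x I * T x J)
      =O[Bornology.cobounded (E n)] fun x => ρ x * ρ x := by
    refine IsBigO.fun_sum fun I _ => ?_
    refine IsBigO.fun_sum fun J _ => ?_
    have h2 : (fun x => ∏ p, (coneMetric α x)⁻¹ (I p) (J p))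
        =O[Bornology.cobounded (E n)] fun _ => (1 : ℝ) := by
      simpa using IsBigO.finsetProd (s := Finset.univ)
        fun p _ => isBigO_inv_coneMetric hα (I p) (J p)
    simpa using (h2.mul (hT I)).mul (hT J)
  obtain ⟨C, hC0, hC⟩ := h1.exists_nonneg
  refine IsBigO.of_bound (Real.sqrt C) ?_
  filter_upwards [hC.bound] with x hx
  rw [tensorNorm, Real.norm_of_nonneg (Real.sqrt_nonneg _)]
  refine Real.sqrt_le_iff.mpr ⟨by positivity, ((le_abs_self _).trans hx).trans (le_of_eq ?_)⟩
  rw [mul_pow, Real.sq_sqrt hC0, norm_mul, sq]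

/-! ### Convergence of the soliton to its cone -/

namespace IsLevelInverse

variable {m : ℝ} {w p q κ σ : ℝ → ℝ}

/-- The two error coefficients have order `-1` in `s = σ(|x|²)`, hence order `-2` in `|x|`; they
multiply tensors that are homogeneous of degree `0`. -/
theorem symbol_pullback (hm : 0 ≤ m) (h : IsSmoothProfile m w p q κ)
    (hσ : IsLevelInverse m w p κ σ) {W : ℝ}
    (hW : (fun s => w s - W) =O[atTop] fun t => t ^ (-1 : ℤ)) (i j : Fin n) :
    IsSymbolE 2 (-2) fun x : E n =>
      pullback (levelMap σ) (warpedMetric w) x i j - coneMetric (1 - W) x i j := by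
  have hl := isEnd_cobounded (n := n)
  have hσs := hσ.symbol hm h
  have ht := hσ.tendsto_atTop h
  have hΘ := hσ.isTheta hm h
  have h1 := IsSymbolE.comp_norm_sq (n := n)
    (IsSymbol.comp isEnd_atTop (h.symbol_tangential_error hm hW) hσs ht hΘ)
  have h2 := IsSymbolE.comp_norm_sq (n := n)
    (IsSymbol.comp isEnd_atTop (h.symbol_radial_error hm) hσs ht hΘ)
  refine ((h1.mul hl ((IsSymbol.const (if i = j then 1 else 0) 2).sub hl
    (IsSymbolE.radialForm 2 i j))).add hl (h2.mul hl (IsSymbolE.radialForm 2 i j))).congr' hl ?_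
  filter_upwards [IsSymbolE.tendsto_norm_sq.eventually_gt_atTop (4 * potential m w p κ 0)] with x hx
  exact (hσ.pullback_levelMap hm h hx W i j).symm

theorem isBigO_tensorNorm_pullback (hm : 0 ≤ m) (h : IsSmoothProfile m w p q κ)
    (hσ : IsLevelInverse m w p κ σ) {W : ℝ} (hW0 : 0 < W)
    (hW : (fun s => w s - W) =O[atTop] fun t => t ^ (-1 : ℤ)) {j : ℕ} (hj : j ≤ 2) :
    (fun x : E n => tensorNorm (coneMetric (1 - W)) (iterCovDeriv (coneMetric (1 - W))
      (fun y (I : Fin 2 → Fin n) => pullback (levelMap σ) (warpedMetric w) y (I 0) (I 1) -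
        coneMetric (1 - W) y (I 0) (I 1)) j) x)
      =O[Bornology.cobounded (E n)] fun x => ‖x‖ ^ (-3 * (2 / 3 : ℝ) - (j : ℝ)) := by
  have h1 : (fun x : E n => ‖x‖ ^ (-3 * (2 / 3 : ℝ) - (j : ℝ))) = fun x => ‖x‖ ^ (-2 - (j : ℤ)) := by
    funext x
    rw [← Real.rpow_intCast]
    congr 1
    push_cast
    ring
  rw [h1]
  refine isBigO_tensorNorm (by linarith) fun I => ?_
  refine (symbol_iterCovDeriv (i := 2 - j) (by linarith) j (fun J => ?_) I).isBigO
  rw [Nat.sub_add_cancel hj]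
  exact hσ.symbol_pullback hm h hW (J 0) (J 1)

/-- The end of the soliton is asymptotically conical. -/
theorem isAsymptoticallyConical (hm : 0 ≤ m) (hn : (n : ℝ) = m + 2)
    (h : IsSmoothProfile m w p q κ) (hσ : IsLevelInverse m w p κ σ) :
    IsAsymptoticallyConicalAsSoliton (n := n) (warpedMetric w)
      fun x => potential m w p κ (‖x‖ ^ 2) := by
  refine ⟨h.isExpandingGradientSoliton hn, ?_⟩
  obtain ⟨W, hW0, hW1, -, -, hW⟩ := h.exists_limit hm
  have hc := potential_zero_pos hm h
  have hset : ∀ x : E n, Real.sqrt (4 * potential m w p κ 0) < ‖x‖ ↔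
      4 * potential m w p κ 0 < ‖x‖ ^ 2 := fun x => Real.sqrt_lt hc.le (norm_nonneg x)
  have himg : levelMap σ '' {x : E n | Real.sqrt (4 * potential m w p κ 0) < ‖x‖} = {0}ᶜ := by
    simp only [hset]
    exact hσ.image_levelMap hm h
  -- The end begins at `r₀ = 2 √f(0)`, so the image omits only the origin. The cone has `1 - α = W =
  -- lim w`, and `ε = 2 / 3` matches order `-2`.
  refine ⟨Real.sqrt (4 * potential m w p κ 0), levelMap σ, Real.sqrt_pos.mpr hc, ?_, ?_,
    ⟨inverseMap m w p κ, ?_, ?_⟩, ?_, ?_, ?_, 1 - W, 2 / 3, by linarith, by linarith,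
    by norm_num, fun j hj => hσ.isBigO_tensorNorm_pullback hm h hW0 hW hj⟩
  · intro x hx
    exact (contDiffAt_radialMap (hσ.contDiffAt_sqrt hm h ((hset x).mp hx))).contDiffWithinAt
  · rw [himg]
    exact isOpen_compl_singleton
  · rw [himg]
    intro y hy
    have := norm_pos_iff.mpr hy
    exact (hσ.contDiffAt_inverseMap hm h (by positivity)).contDiffWithinAt
  · intro x hx
    exact hσ.inverseMap_levelMap hm h ((hset x).mp hx)
  · rw [himg, compl_compl]
    exact isCompact_singleton
  · intro x hx
    exact hσ.potential_levelMap hm h ((hset x).mp hx)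
  · intro x hx
    exact hσ.fderiv_levelMap hm h ((hset x).mp hx)

end IsLevelInverse

end ExpandingSoliton

end

theorem propositionA6 (n : ℕ) (hn : 2 ≤ n) (M : EReal) (hM : 0 < M) (w₀ : ℝ → ℝ)
    (hw₀ : ExpandingSoliton.IsBryantSolution n M w₀) :
    ∃ w : ℝ → ℝ,
      ExpandingSoliton.IsBryantSolution n ⊤ w ∧
      Set.EqOn w w₀ (ExpandingSoliton.solDomain M) ∧
      (∀ s, 0 ≤ s → 0 < w s) ∧
      ExpandingSoliton.HasPositiveSectionalCurvature
        (n := n) (ExpandingSoliton.warpedMetric w) ∧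
      ∃ f : ExpandingSoliton.E n → ℝ,
        ExpandingSoliton.IsExpandingGradientSoliton (ExpandingSoliton.warpedMetric w) f ∧
        ExpandingSoliton.IsRotationallySymmetric (ExpandingSoliton.warpedMetric w) f ∧
        ExpandingSoliton.IsAsymptoticallyConicalAsSoliton
          (ExpandingSoliton.warpedMetric w) f := by
  obtain ⟨w, hw, heq⟩ := hw₀.exists_extension hn hM
  -- Now `m = n - 2` is the natural number `k`, as the monomial weights in the smoothness argument
  -- require.
  obtain ⟨k, rfl⟩ := Nat.exists_eq_add_of_le' hn
  obtain ⟨p, q, κ, h⟩ := hw.exists_isSmoothProfile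
  have hm : (0 : ℝ) ≤ k := k.cast_nonneg
  have hn' : ((k + 2 : ℕ) : ℝ) = k + 2 := by push_cast; ring
  obtain ⟨σ, hσ⟩ := h.exists_isLevelInverse hm
  have hcone := hσ.isAsymptoticallyConical hm hn' h
  exact ⟨w, hw, heq, h.w_pos, h.hasPositiveSectionalCurvature, _, hcone.isSoliton,
    h.isRotationallySymmetric _, hcone⟩
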